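/- A multigraph on $n$ labelled vertices is a finite multiset of edges, an edge being an unordered pair $\{v,w\}$ of vertices with $v=w$ allowed (a loop); a loop contributes $2$ to the degree of its vertex. If $G$ has $m$ edges, let $\operatorname{seqv}(G)$ be the number of sequences of vertices $v_1w_1\dots v_mw_m$ such that the multiset of the edges $\{v_i,w_i\}$, $1\le i\le m$, is that of $G$, and let $\kappa(G)=\operatorname{seqv}(G)/(2^m\,m!)$ be its compensation factor. Let $\mathcal{MG}_{n_1,n_2}$ be the set of multigraphs on $n_1+n_2$ labelled vertices with $n_1$ vertices of degree $1$ and $n_2$ vertices of degree $2$, and draw $G$ in $\mathcal{MG}_{n_1,n_2}$ from the configuration model, i.e. with probability proportional to $\kappa(G)$. The size of a connected component is its number of vertices. Theorem. Let $\alpha>0$. For $n_1$ even let $n_2=\lfloor \alpha n_1/2\rfloor$. For $j\ge 1$ let $U_j$ be the number of connected components of size $j$ in a multigraph drawn from the configuration model on $\mathcal{MG}_{n_1,n_2}$. Then, for every $j\ge 2$, as $n_1\to\infty$ along the even integers, \[ \mathbb{E}[U_j]\sim \frac{\alpha^{j-2}}{(1+\alpha)^{j-1}}\,\frac{n_1}{2}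 \qquad\text{and}\qquad \operatorname{Var}(U_j)=O\!\left(\frac{n_1}{2}\right), \] and \[ \mathbb{E}[U_1]\sim \frac12\,\frac{\alpha}{1+\alpha} \qquad\text{and}\qquad \operatorname{Var}(U_1)\sim \frac12\,\frac{\alpha}{1+\alpha}. \] Furthermore, for any integer $q\ge 2$, as $n_1\to\infty$ along the even integers, the vector \[ \frac{1}{\sqrt{n_1/2}}\left(U_j-\frac{\alpha^{j-2}}{(1+\alpha)^{j-1}}\,\frac{n_1}{2}\right)_{2\le j\le q} \] converges in distribution to the multivariate Gaussian $\mathcal{N}(0,H(\alpha))$, where $H(\alpha)=(H_{i,j}(\alpha))_{2\le i,j\le q}$ is the positive semi-definite matrix \[ H_{i,j}(\alpha)=-\frac{\alpha^{i+j-4}}{(1+\alpha)^{i+j-2}}\left(1+\frac{(i-2-\alpha)(j-2-\alpha)}{\alpha(1+\alpha)}\right)+\frac{\mathbf 1_{i=j}}{1+\alpha}\left(\frac{\alpha}{1+\alpha}\right)^{i-2}, \] and $U_1$ converges in distribution to a Poisson random variable of parameter $\frac12\,\frac{\alpha}{1+\alpha}$. -/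

import Mathlib

open MeasureTheory ProbabilityTheory Filter Asymptotics
open scoped Topology NNReal ENNReal

/-- A multigraph on the labelled vertex set `{0, …, n - 1}`: a finite multiset of edges, where an
edge is an unordered pair of vertices.  Loops and multiple edges are allowed. -/
@[ext]
structure LabelledMultigraph (n : ℕ) where
  edges : Multiset (Sym2 (Fin n))

namespace LabelledMultigraph

variable {n : ℕ}

instance instMeasurableSpace : MeasurableSpace (LabelledMultigraph n) := ⊤

instance instDiscreteMeasurableSpace : DiscreteMeasurableSpace (LabelledMultigraph n) := ⟨fun _ => trivial⟩

/-- The degree of a vertex: the number of edges at it, each loop being counted twice. -/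
def degree (G : LabelledMultigraph n) (v : Fin n) : ℕ :=
  G.edges.countP (v ∈ ·) + G.edges.count s(v, v)

/-- The simple graph that has the same adjacencies between distinct vertices (and hence the same
connected components). -/
def toSimple (G : LabelledMultigraph n) : SimpleGraph (Fin n) :=
  SimpleGraph.fromEdgeSet {e | e ∈ G.edges}

/-- The number of connected components with exactly `j` vertices. -/
noncomputable def numComponents (j : ℕ) (G : LabelledMultigraph n) : ℕ :=
  Nat.card {C : G.toSimple.ConnectedComponent // C.supp.ncard = j}

/-- The number `seqv(G)` of sequences of vertices `v₁ w₁ … v_m w_m`, `m` the number of edges,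
such that the multiset of the edges `{v_i, w_i}` is the multiset of edges of `G`. -/
noncomputable def seqv (G : LabelledMultigraph n) : ℕ :=
  Nat.card {s : Fin G.edges.card → Fin n × Fin n //
    Finset.univ.val.map (fun i => s((s i).1, (s i).2)) = G.edges}

/-- The compensation factor `κ(G) = seqv(G) / (2 ^ m m!)`, `m` the number of edges. -/
noncomputable def compensation (G : LabelledMultigraph n) : ℝ≥0 :=
  (G.seqv : ℝ≥0) / (2 ^ G.edges.card * (G.edges.card.factorial : ℝ≥0))

/-- The multigraphs with `n₁` vertices of degree `1`, `n₂` vertices of degree `2`, and no other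
vertex. -/
def degreeOneTwo (n₁ n₂ : ℕ) : Set (LabelledMultigraph (n₁ + n₂)) :=
  {G | {v | G.degree v = 1}.ncard = n₁ ∧ {v | G.degree v = 2}.ncard = n₂}

/-- The measure that gives to each multigraph in the family its compensation factor as mass. -/
noncomputable def weight (n₁ n₂ : ℕ) : Measure (LabelledMultigraph (n₁ + n₂)) :=
  Measure.sum fun G : degreeOneTwo n₁ n₂ => (compensation G.1 : ℝ≥0∞) • Measure.dirac G.1

/-- The distribution of the configuration model: a multigraph of the family is drawn with
probability proportional to its compensation factor. -/
noncomputable def configurationModel (n₁ n₂ : ℕ) : Measure (LabelledMultigraph (n₁ + n₂)) :=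
  (weight n₁ n₂ Set.univ)⁻¹ • weight n₁ n₂

lemma degree_eq_of_mem {n₁ n₂ : ℕ} {G : LabelledMultigraph (n₁ + n₂)}
    (hG : G ∈ degreeOneTwo n₁ n₂) (v : Fin (n₁ + n₂)) : G.degree v = 1 ∨ G.degree v = 2 := by
  have hd : Disjoint {v | G.degree v = 1} {v | G.degree v = 2} := by
    rw [Set.disjoint_left]
    intro a h1 h2
    simp only [Set.mem_ofPred_eq] at h1 h2
    omega
  have hc := Set.ncard_union_eq hd
  rw [hG.1, hG.2] at hc
  have : {v | G.degree v = 1} ∪ {v | G.degree v = 2} = Set.univ := by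
    apply Set.eq_of_subset_of_ncard_le (Set.subset_univ _)
    rw [hc]
    simp [Set.ncard_univ]
  have hv : v ∈ {v | G.degree v = 1} ∪ {v | G.degree v = 2} := this ▸ Set.mem_univ v
  exact hv

lemma finite_degreeOneTwo (n₁ n₂ : ℕ) : (degreeOneTwo n₁ n₂).Finite := by
  have hinj : Function.Injective (edges : LabelledMultigraph (n₁ + n₂) → _) :=
    fun G H h => LabelledMultigraph.ext h
  refine Set.Finite.of_finite_image
    ((Set.finite_Iic (2 • (Finset.univ : Finset (Sym2 (Fin (n₁ + n₂)))).val)).subset ?_)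
    hinj.injOn
  rintro _ ⟨G, hG, rfl⟩
  rw [Set.mem_Iic, Multiset.le_iff_count]
  intro e
  rw [Multiset.count_nsmul, Multiset.count_univ]
  induction e with
  | h a b =>
    have h1 : G.edges.count s(a, b) ≤ G.edges.countP (a ∈ ·) := by
      rw [Multiset.count]
      simp only [Multiset.countP_eq_card_filter]
      refine Multiset.card_le_card (Multiset.monotone_filter_right _ ?_)
      rintro _ rfl
      simp
    have h2 := degree_eq_of_mem hG a
    unfold degree at h2
    omega

lemma seqv_pos (G : LabelledMultigraph n) : 0 < G.seqv := by
  have hex : ∃ s : Fin G.edges.card → Fin n × Fin n,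
      Finset.univ.val.map (fun i => s((s i).1, (s i).2)) = G.edges := by
    obtain ⟨l, hl⟩ := Quotient.exists_rep G.edges
    have hl' : (l : Multiset _) = G.edges := hl
    rw [← hl']
    refine ⟨fun i => (l.get (i.cast (by simp))).out, ?_⟩
    have : ∀ z : Sym2 (Fin n), s(z.out.1, z.out.2) = z := fun z => Quot.out_eq z
    simp only [this]
    have h2 : (fun i : Fin (Multiset.card (l : Multiset (Sym2 (Fin n)))) =>
        l.get (i.cast (by simp))) = l.get := rfl
    rw [h2]
    change Multiset.map l.get (Finset.univ : Finset (Fin l.length)).val = l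
    simp [Fin.univ_val_map]
  obtain ⟨s, hs⟩ := hex
  have : Nonempty {s : Fin G.edges.card → Fin n × Fin n //
    Finset.univ.val.map (fun i => s((s i).1, (s i).2)) = G.edges} := ⟨⟨s, hs⟩⟩
  exact Nat.card_pos

lemma compensation_pos (G : LabelledMultigraph n) : 0 < G.compensation := by
  have := G.seqv_pos
  unfold compensation
  positivity

lemma nonempty_degreeOneTwo (k n₂ : ℕ) : (degreeOneTwo (2 * k) n₂).Nonempty := by
  let f : Fin k → Sym2 (Fin (2 * k + n₂)) := fun i =>
    s(⟨2 * i, by omega⟩, ⟨2 * i + 1, by omega⟩)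
  let g : Fin n₂ → Sym2 (Fin (2 * k + n₂)) := fun i => s(Fin.natAdd _ i, Fin.natAdd _ i)
  let G : LabelledMultigraph (2 * k + n₂) := ⟨Finset.univ.val.map f + Finset.univ.val.map g⟩
  have hdeg : ∀ v, G.degree v = if v.1 < 2 * k then 1 else 2 := by
    intro v
    have h1 : (Finset.univ.val.map f).countP (v ∈ ·) = if v.1 < 2 * k then 1 else 0 := by
      rw [Multiset.countP_map]
      change (Finset.univ.filter fun i => v ∈ f i).card = _
      split_ifs with h
      · rw [Finset.card_eq_one]
        refine ⟨⟨v.1 / 2, by omega⟩, ?_⟩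
        ext i
        simp only [f, Finset.mem_filter, Finset.mem_univ, true_and, Sym2.mem_iff,
          Finset.mem_singleton, Fin.ext_iff]
        omega
      · rw [Finset.card_eq_zero, Finset.filter_eq_empty_iff]
        intro i _
        simp only [f, Sym2.mem_iff, Fin.ext_iff]
        omega
    have h2 : (Finset.univ.val.map g).countP (v ∈ ·) = if v.1 < 2 * k then 0 else 1 := by
      rw [Multiset.countP_map]
      change (Finset.univ.filter fun i => v ∈ g i).card = _
      split_ifs with h
      · rw [Finset.card_eq_zero, Finset.filter_eq_empty_iff]
        intro i _
        simp only [g, Sym2.mem_iff, Fin.ext_iff, Fin.val_natAdd]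
        omega
      · rw [Finset.card_eq_one]
        refine ⟨⟨v.1 - 2 * k, by omega⟩, ?_⟩
        ext i
        simp only [g, Finset.mem_filter, Finset.mem_univ, true_and, Sym2.mem_iff,
          Finset.mem_singleton, Fin.ext_iff, Fin.val_natAdd]
        omega
    have h3 : (Finset.univ.val.map f).count s(v, v) = 0 := by
      rw [Multiset.count_eq_zero]
      simp only [f, Multiset.mem_map, Finset.mem_val, Finset.mem_univ, true_and, not_exists,
        Sym2.eq_iff, Fin.ext_iff]
      omega
    have h4 : (Finset.univ.val.map g).count s(v, v) = if v.1 < 2 * k then 0 else 1 := by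
      rw [Multiset.count_map]
      change (Finset.univ.filter fun i => s(v, v) = g i).card = _
      split_ifs with h
      · rw [Finset.card_eq_zero, Finset.filter_eq_empty_iff]
        intro i _
        simp only [g, Sym2.eq_iff, Fin.ext_iff, Fin.val_natAdd]
        omega
      · rw [Finset.card_eq_one]
        refine ⟨⟨v.1 - 2 * k, by omega⟩, ?_⟩
        ext i
        simp only [g, Finset.mem_filter, Finset.mem_univ, true_and, Sym2.eq_iff,
          Finset.mem_singleton, Fin.ext_iff, Fin.val_natAdd]
        omega
    simp only [degree, G, Multiset.countP_add, Multiset.count_add, h1, h2, h3, h4]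
    split_ifs <;> rfl
  have e1 : {v | G.degree v = 1} = Set.range (Fin.castAdd n₂ : Fin (2 * k) → _) := by
    ext v
    simp only [hdeg, Set.mem_ofPred_eq, Set.mem_range, Fin.ext_iff, Fin.val_castAdd]
    constructor
    · intro h
      exact ⟨⟨v.1, by by_contra h'; simp [h'] at h⟩, rfl⟩
    · rintro ⟨i, hi⟩
      rw [← hi]
      simp
  have e2 : {v | G.degree v = 2} = Set.range (Fin.natAdd (2 * k) : Fin n₂ → _) := by
    ext v
    simp only [hdeg, Set.mem_ofPred_eq, Set.mem_range, Fin.ext_iff, Fin.val_natAdd]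
    constructor
    · intro h
      have : ¬ v.1 < 2 * k := by intro h'; simp [h'] at h
      exact ⟨⟨v.1 - 2 * k, by omega⟩, by simp only; omega⟩
    · rintro ⟨i, hi⟩
      rw [← hi]
      simp
  refine ⟨G, ?_, ?_⟩
  · rw [e1, ← Set.image_univ, Set.ncard_image_of_injective _ (Fin.castAdd_injective _ _)]
    simp [Set.ncard_univ]
  · rw [e2, ← Set.image_univ, Set.ncard_image_of_injective _ (Fin.natAdd_injective _ _)]
    simp [Set.ncard_univ]

instance isProbabilityMeasure_configurationModel (k n₂ : ℕ) :
    IsProbabilityMeasure (configurationModel (2 * k) n₂) := by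
  have hfin := (finite_degreeOneTwo (2 * k) n₂).to_subtype
  have := Fintype.ofFinite (degreeOneTwo (2 * k) n₂)
  obtain ⟨G, hG⟩ := nonempty_degreeOneTwo k n₂
  have huniv : weight (2 * k) n₂ Set.univ =
      ∑ G : degreeOneTwo (2 * k) n₂, (compensation G.1 : ℝ≥0∞) := by
    simp [weight]
  have h0 : weight (2 * k) n₂ Set.univ ≠ 0 := by
    rw [huniv]
    intro h
    rw [Finset.sum_eq_zero_iff] at h
    have := h ⟨G, hG⟩ (Finset.mem_univ _)
    exact (compensation_pos G).ne' (by exact_mod_cast this)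
  have htop : weight (2 * k) n₂ Set.univ ≠ ∞ := by
    rw [huniv]
    exact ENNReal.sum_ne_top.2 fun _ _ => ENNReal.coe_ne_top
  refine ⟨?_⟩
  rw [configurationModel, Measure.smul_apply, smul_eq_mul]
  exact ENNReal.inv_mul_cancel h0 htop

end LabelledMultigraph

/-- The matrix `H(α)`, with rows and columns indexed by `2 ≤ i, j ≤ q`. -/
noncomputable def limitCovariance (α : ℝ) (q : ℕ) :
    Matrix (Finset.Icc 2 q) (Finset.Icc 2 q) ℝ :=
  Matrix.of fun i j =>
    -(α ^ ((i : ℕ) + j - 4) / (1 + α) ^ ((i : ℕ) + j - 2)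
        * (1 + (((i : ℕ) : ℝ) - 2 - α) * (((j : ℕ) : ℝ) - 2 - α) / (α * (1 + α))))
      + (if i = j then 1 else 0) / (1 + α) * (α / (1 + α)) ^ ((i : ℕ) - 2)

/-!
# Component sizes in random multigraphs with degrees one and two

Let `n₁ = 2 k` and `n = n₂`. The components are `k` paths, each with two vertices of degree `1`,
and cycles, so `U_j` is the number of paths with `j - 2` inner vertices plus the number of cycles
with `j` vertices, and `U_1` is the number of loops.

*An exact description of the law.* Weighting by the compensation factor amounts to drawing a
uniform pairing of the `2 (k + n)` half-edges. A uniform pairing is built by inserting the `n`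
vertices of degree `2` successively: a new vertex is placed either as a loop (one way) or in the
middle of an edge, one way for each half-edge, see `Pairing.insertVertex`. A path with `i` inner
vertices has `2 (i + 1)` half-edges and a cycle with `i` vertices has `2 i`, hence the component
sizes form the Markov chain of `chainSum`, a Pólya urn (`integral_configurationModel`). Its one-step
recursion turns into differentiation of generating functions, so that the sum over all histories of
`∏ f_l (size of path l) * g (number of vertices on cycles)` is, up to the factor `2 ^ n n!`, the
coefficient of `z ^ n` in `∏ (∑ f_l(i) z ^ i)` times `∑ a_c g(c) z ^ c`, where
`∑ a_c z ^ c = (1 - z) ^ (-1/2)` (`chainSum_prod`).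

*Moments.* The first two moments of the path counts are ratios of the coefficients of
`(1 - z) ^ (-k - 1/2)`, which are explicit products; they yield the means and variances of `U_j` for
`2 ≤ j`, because the number `c` of vertices on cycles has a bounded second moment:
`(c + 1/2) (c + 3/2)` is an eigenfunction of the urn. The factorial moments of the number of loops
satisfy a recursion with an explicit solution (`chainSum_loops`) and converge to those of a Poisson
variable; they are at most `1`, so the characteristic functions converge too
(`tendsto_mean_pow_loops`).

*Gaussian limit.* Tilting by the geometric law of mean `α` and Cauchy's formula on the unit circle
represent the characteristic function of the path counts as a ratio of two integrals of the form
`∫ Φ(t) ^ k h(t) exp (- i n t) dt`. After the substitution `t = τ / √k` the integrand converges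
pointwise, by the central limit theorem for one geometric variable (`tendsto_tsum_exp_pow`), and is
dominated by a Gaussian (`norm_circleValue_pathSeries_le`); the limit is the Gaussian law that belongs
to independent geometric variables conditioned on their sum (`tendsto_mean_exp_paths`). With `s` the
vector of arguments and `p` the geometric law, the limiting variance is
`∑ p s² - (∑ p s)² - (∑ p s (i - α))² / (α (1 + α))`, which is the quadratic form of `H(α)`
(`dotProduct_limitCovariance`). Lévy's continuity theorem concludes, the cycles being negligible
after division by `√k`.
-/

/-! ### Insertion of a vertex of degree two in a pairing -/

/-- A pairing of the half-edges `H`: a fixed-point-free involution. -/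
abbrev Pairing (H : Type*) := {σ : H → H // Function.Involutive σ ∧ ∀ h, σ h ≠ h}

namespace Pairing

variable {H : Type*} [DecidableEq H]

/-- The pairing of `H ⊕ Bool` in which the two new half-edges form a loop. -/
def addLoop (σ : Pairing H) : Pairing (H ⊕ Bool) :=
  ⟨Sum.map σ.1 Bool.not, by
    constructor
    · rintro (h | b) <;> simp [σ.2.1 _]
    · rintro (h | b) <;> simp [σ.2.2]⟩

/-- The pairing of `H ⊕ Bool` obtained by cutting the edge `{h₀, σ h₀}` at its middle: `h₀` is
paired with the first new half-edge and `σ h₀` with the second one. -/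
def subdivide (σ : Pairing H) (h₀ : H) : Pairing (H ⊕ Bool) :=
  ⟨Sum.elim (fun h => if h = h₀ then .inr false else if h = σ.1 h₀ then .inr true
      else .inl (σ.1 h)) (fun b => bif b then .inl (σ.1 h₀) else .inl h₀), by
    have h1 := σ.2.1
    have h2 := σ.2.2
    constructor
    · rintro (h | b)
      · simp only [Sum.elim_inl]
        split_ifs with h3 h4
        · simp [h3]
        · simp [h4]
        · have : σ.1 h ≠ h₀ := fun h5 => h4 (by rw [← h5, h1])
          have h6 : σ.1 h ≠ σ.1 h₀ := fun h5 => h3 (h1.injective h5)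
          simp [this, h6, h1 h]
      · cases b <;> simp [h2]
    · rintro (h | b)
      · simp only [Sum.elim_inl]
        split_ifs <;> simp [h2]
      · cases b <;> simp⟩

/-- Insertion of a new vertex with two half-edges: as a loop, or in the middle of an edge. -/
def insertVertex (p : Pairing H × Option H) : Pairing (H ⊕ Bool) :=
  p.2.elim p.1.addLoop p.1.subdivide

lemma insertVertex_injective : Function.Injective (insertVertex : Pairing H × Option H → _) := by
  rintro ⟨σ, o⟩ ⟨τ, o'⟩ h
  have h0 : ∀ z, (insertVertex (σ, o)).1 z = (insertVertex (τ, o')).1 z := fun z => by rw [h]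
  have hf := h0 (.inr false)
  have ht := h0 (.inr true)
  rcases o with _ | a <;> rcases o' with _ | b <;>
    simp [insertVertex, addLoop, subdivide] at hf ht
  · congr 1
    ext z
    simpa [insertVertex, addLoop] using h0 (.inl z)
  · subst hf
    congr 1
    ext z
    have := h0 (.inl z)
    simp only [insertVertex, subdivide, Option.elim_some, Sum.elim_inl, ht] at this
    by_cases h3 : z = a
    · rw [h3, ht]
    · by_cases h4 : z = τ.1 a
      · rw [h4, τ.2.1, ← ht, σ.2.1]
      · simpa [h3, h4] using this

/-- The place of insertion is recovered from the partners of the two new half-edges. -/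
lemma insertVertex_surjective : Function.Surjective (insertVertex : Pairing H × Option H → _) := by
  rintro ⟨τ, h1, h2⟩
  have hinj := h1.injective
  rcases hf : τ (.inr false) with a | b
  · rcases ht : τ (.inr true) with a' | b'
    · have haa : a ≠ a' := by
        rintro rfl
        simpa using hinj (hf.trans ht.symm)
      have hfa : τ (.inl a) = .inr false := by rw [← hf, h1]
      have hta : τ (.inl a') = .inr true := by rw [← ht, h1]
      have hex : ∀ h, h ≠ a → h ≠ a' → ∃ z, τ (.inl h) = .inl z := by
        intro h h3 h4
        rcases h5 : τ (.inl h) with z | b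
        · exact ⟨z, rfl⟩
        · exfalso
          have := congrArg τ h5
          rw [h1] at this
          cases b
          · rw [hf] at this; exact h3 (by simpa using this)
          · rw [ht] at this; exact h4 (by simpa using this)
      choose! f hfz using hex
      let σ : H → H := fun h => if h = a then a' else if h = a' then a else f h
      have hfi : ∀ h, h ≠ a → h ≠ a' → f h ≠ a ∧ f h ≠ a' ∧ f (f h) = h ∧ f h ≠ h := by
        intro h h3 h4
        have h5 := congrArg τ (hfz h h3 h4)
        rw [h1] at h5
        have h6 : f h ≠ a := by rintro h7; rw [h7, hfa] at h5; simp at h5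
        have h7 : f h ≠ a' := by rintro h7; rw [h7, hta] at h5; simp at h5
        refine ⟨h6, h7, ?_, ?_⟩
        · rw [hfz _ h6 h7] at h5
          simpa using h5.symm
        · intro h8
          exact h2 (.inl h) (by rw [hfz h h3 h4, h8])
      have hσ : Function.Involutive σ ∧ ∀ h, σ h ≠ h := by
        constructor
        · intro h
          simp only [σ]
          by_cases h3 : h = a
          · simp [h3, haa.symm]
          · by_cases h4 : h = a'
            · simp [h4, haa.symm]
            · obtain ⟨h5, h6, h7, -⟩ := hfi h h3 h4
              simp [h3, h4, h5, h6, h7]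
        · intro h
          simp only [σ]
          split_ifs with h3 h4
          · rw [h3]; exact haa.symm
          · rw [h4]; exact haa
          · exact (hfi h h3 h4).2.2.2
      refine ⟨(⟨σ, hσ⟩, some a), ?_⟩
      have hσa : σ a = a' := by simp [σ]
      ext z
      rcases z with h | b
      · simp only [insertVertex, subdivide, Option.elim_some, Sum.elim_inl, hσa]
        split_ifs with h3 h4
        · rw [h3, hfa]
        · rw [h4, hta]
        · simp [σ, h3, h4, hfz]
      · cases b
        · simp [insertVertex, subdivide, hf]
        · simp [insertVertex, subdivide, ht, hσa]
    · exfalso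
      cases b'
      · have := congrArg τ ht
        rw [h1, hf] at this
        simp at this
      · exact h2 _ ht
  · cases b
    · exact absurd hf (h2 _)
    · have ht : τ (.inr true) = .inr false := by rw [← hf, h1]
      have hex : ∀ h, ∃ z, τ (.inl h) = .inl z := by
        intro h
        rcases h5 : τ (.inl h) with z | b
        · exact ⟨z, rfl⟩
        · exfalso
          have := congrArg τ h5
          rw [h1] at this
          cases b
          · rw [hf] at this; simp at this
          · rw [ht] at this; simp at this
      choose f hfz using hex
      refine ⟨(⟨f, fun h => ?_, fun h h' => ?_⟩, none), ?_⟩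
      · have := congrArg τ (hfz h)
        rw [h1, hfz] at this
        simpa using this.symm
      · exact h2 (.inl h) (by rw [hfz, h'])
      · ext z
        rcases z with h | b
        · simp [insertVertex, addLoop, hfz]
        · cases b <;> simp [insertVertex, addLoop, hf, ht]

end Pairing

/-! ### The connected components of a random pairing -/

namespace Pairing

noncomputable instance {H : Type*} [Finite H] : Fintype (Pairing H) := Fintype.ofFinite _

/-- A sum over the pairings with one more vertex of degree two, split by the place of insertion. -/
lemma sum_insert {H : Type*} [Fintype H] [DecidableEq H] {R : Type*} [AddCommMonoid R]
    (F : Pairing (H ⊕ Bool) → R) :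
    ∑ τ, F τ = ∑ σ : Pairing H, (F σ.addLoop + ∑ h, F (σ.subdivide h)) := by
  rw [← (Equiv.ofBijective _ ⟨insertVertex_injective (H := H), insertVertex_surjective⟩).sum_comp,
    Fintype.sum_prod_type]
  refine Finset.sum_congr rfl fun σ _ => ?_
  rw [Fintype.sum_option]
  rfl

/-- Two vertices are linked if some edge of the pairing joins them. -/
def Linked {H V : Type*} (vtx : H → V) (σ : Pairing H) (v w : V) : Prop :=
  ∃ h, vtx h = v ∧ vtx (σ.1 h) = w

end Pairing

open Pairing

/-- The sum of `F` over all histories of the following process, each of them counted with its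
multiplicity.  The state `x` records, for each of `k` paths and for countably many (mostly empty)
cycles, the number of its vertices of degree `2`.  At time `n` a new vertex of degree `2` becomes
the first vertex of the cycle with index `n`, or is inserted in a path (in one of
`2 * (x + 1)` ways) or in an earlier cycle (in one of `2 * x` ways). -/
def chainSum {R : Type*} [CommRing R] (k : ℕ) : ℕ → ((Fin k ⊕ ℕ → ℕ) → R) → R
  | 0, F => F 0
  | n + 1, F => chainSum k n fun x =>
      F (x + Pi.single (.inr n) 1)
        + ∑ l : Fin k, 2 * ((x (.inl l) : R) + 1) * F (x + Pi.single (.inl l) 1)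
        + ∑ i ∈ Finset.range n, 2 * (x (.inr i) : R) * F (x + Pi.single (.inr i) 1)

/-- The half-edges `H` and the vertices `V` of the multigraphs with `2 * k` vertices of degree `1`
and `n` vertices of degree `2`, together with a labelling of the connected components of each
pairing of the half-edges, by `inl` for the paths and by `inr` for the cycles, and the numbers
`x` of vertices of degree `2` in them. By `sum_x`, the state `x` of a uniform pairing is distributed
as the state at time `n` of the process of `chainSum`. The types `H` and `V` are left free so that
a vertex can be inserted by passing to `H ⊕ Bool` and `Option V`. -/
structure ComponentModel (k n : ℕ) where
  H : Type
  V : Type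
  [fintypeH : Fintype H]
  [fintypeV : Fintype V]
  [decH : DecidableEq H]
  [decV : DecidableEq V]
  vtx : H → V
  card_fiber : ∀ v, Nat.card {h // vtx h = v} = 1 ∨ Nat.card {h // vtx h = v} = 2
  card_one : Nat.card {v // Nat.card {h // vtx h = v} = 1} = 2 * k
  card_two : Nat.card {v // Nat.card {h // vtx h = v} = 2} = n
  lab : Pairing H → V → Fin k ⊕ ℕ
  x : Pairing H → Fin k ⊕ ℕ → ℕ
  lab_vtx : ∀ σ h, lab σ (vtx (σ.1 h)) = lab σ (vtx h)
  linked : ∀ σ v w, lab σ v = lab σ w → Relation.EqvGen (Linked vtx σ) v w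
  card_lab : ∀ σ ℓ, Nat.card {v // lab σ v = ℓ} = x σ ℓ + if ℓ.isLeft then 2 else 0
  card_half : ∀ σ ℓ,
    Nat.card {h // lab σ (vtx h) = ℓ} = 2 * (x σ ℓ + if ℓ.isLeft then 1 else 0)
  x_inr : ∀ σ i, n ≤ i → x σ (.inr i) = 0
  sum_x : ∀ {R : Type} [CommRing R] (F : (Fin k ⊕ ℕ → ℕ) → R),
    ∑ σ, F (x σ) = Fintype.card (Pairing (Fin (2 * k))) * chainSum k n F

attribute [instance] ComponentModel.fintypeH ComponentModel.fintypeV ComponentModel.decH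
  ComponentModel.decV

/-- In a pairing of `2 * k` points the pairs can be numbered from `0` to `k - 1`. -/
lemma exists_pair_numbering {H : Type*} [Fintype H] {k : ℕ} (hH : Fintype.card H = 2 * k)
    (σ : Pairing H) :
    ∃ c : H → Fin k, (∀ a b, c a = c b ↔ b = a ∨ b = σ.1 a) ∧
      ∀ l, Nat.card {a // c a = l} = 2 := by
  obtain ⟨σ, h1, h2⟩ := σ
  let S : Setoid H :=
    { r := fun a b => b = a ∨ b = σ a
      iseqv := by
        refine ⟨fun a => .inl rfl, ?_, ?_⟩
        · rintro a b (rfl | rfl)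
          · simp
          · simp [h1 a]
        · rintro a b c (rfl | rfl) (rfl | rfl)
          · simp
          · simp
          · simp
          · simp [h1 a] }
  classical
  have hfib : ∀ q : Quotient S, Fintype.card {a // Quotient.mk S a = q} = 2 := by
    intro q
    induction q using Quotient.inductionOn with
    | h a =>
      rw [Fintype.card_subtype, Finset.card_eq_two]
      refine ⟨a, σ a, (h2 a).symm, ?_⟩
      ext b
      simp only [Finset.mem_filter, Finset.mem_univ, true_and, Finset.mem_insert,
        Finset.mem_singleton]
      rw [eq_comm, Quotient.eq]
      rfl
  have hcard : Fintype.card (Quotient S) = k := by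
    have := Fintype.card_congr (Equiv.sigmaFiberEquiv (Quotient.mk S))
    rw [Fintype.card_sigma] at this
    simp only [hfib, Finset.sum_const, Finset.card_univ, smul_eq_mul, hH] at this
    omega
  refine ⟨fun a => Fintype.equivFinOfCardEq hcard (Quotient.mk S a), fun a b => ?_, fun l => ?_⟩
  · rw [(Fintype.equivFinOfCardEq hcard).injective.eq_iff, Quotient.eq]
    rfl
  · refine Eq.trans ?_ (hfib ((Fintype.equivFinOfCardEq hcard).symm l))
    rw [Nat.card_eq_fintype_card]
    refine Fintype.card_congr (Equiv.subtypeEquivRight fun a => ?_)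
    rw [Equiv.eq_symm_apply]

/-- The model without vertices of degree `2`. -/
noncomputable def ComponentModel.base (k : ℕ) : ComponentModel k 0 where
  H := Fin (2 * k)
  V := Fin (2 * k)
  vtx := id
  card_fiber v := by simp
  card_one := by simp
  card_two := by simp
  lab σ v := .inl ((exists_pair_numbering (Fintype.card_fin (2 * k)) σ).choose v)
  x _ := 0
  lab_vtx σ h := by
    rw [Sum.inl.injEq, (exists_pair_numbering (Fintype.card_fin (2 * k)) σ).choose_spec.1]
    exact .inr (σ.2.1 h).symm
  linked σ v w h := by
    rw [Sum.inl.injEq, (exists_pair_numbering (Fintype.card_fin (2 * k)) σ).choose_spec.1] at h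
    rcases h with rfl | rfl
    · exact .refl _
    · exact .rel _ _ ⟨v, rfl, rfl⟩
  card_lab σ ℓ := by
    rcases ℓ with l | i
    · simpa using (exists_pair_numbering (Fintype.card_fin (2 * k)) σ).choose_spec.2 l
    · simp
  card_half σ ℓ := by
    rcases ℓ with l | i
    · simpa using (exists_pair_numbering (Fintype.card_fin (2 * k)) σ).choose_spec.2 l
    · simp
  x_inr := by simp
  sum_x F := by simp [chainSum]

open Classical in
lemma card_subtype_option {V : Type*} [Finite V] (P : Option V → Prop) :
    Nat.card {o // P o} = Nat.card {v // P (some v)} + if P none then 1 else 0 := by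
  have := Fintype.ofFinite V
  rw [Nat.card_eq_fintype_card, Nat.card_eq_fintype_card, Fintype.card_subtype,
    Fintype.card_subtype, Finset.card_filter, Finset.card_filter, Fintype.sum_option, add_comm]

open Classical in
lemma card_subtype_sum_bool {H : Type*} [Finite H] (P : H ⊕ Bool → Prop) :
    Nat.card {o // P o} = Nat.card {v // P (.inl v)}
      + ((if P (.inr true) then 1 else 0) + if P (.inr false) then 1 else 0) := by
  have := Fintype.ofFinite H
  rw [Nat.card_eq_fintype_card, Nat.card_eq_fintype_card, Fintype.card_subtype,
    Fintype.card_subtype, Finset.card_filter, Finset.card_filter, Fintype.sum_sum_type,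
    Fintype.sum_bool]

namespace ComponentModel

variable {k n : ℕ} (M : ComponentModel k n)

/-- The vertices of the half-edges after the insertion of a new vertex. -/
def stepVtx : M.H ⊕ Bool → Option M.V := Sum.elim (fun h => some (M.vtx h)) fun _ => none

/-- The label of a newly inserted vertex. -/
def newLab (p : Pairing M.H × Option M.H) : Fin k ⊕ ℕ :=
  p.2.elim (.inr n) fun h => M.lab p.1 (M.vtx h)

/-- The decomposition of a pairing into a smaller pairing and a place of insertion. -/
noncomputable def insertEquiv : Pairing M.H × Option M.H ≃ Pairing (M.H ⊕ Bool) :=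
  Equiv.ofBijective _ ⟨insertVertex_injective, insertVertex_surjective⟩

/-- The labelling after the insertion of a new vertex. -/
noncomputable def stepLab (τ : Pairing (M.H ⊕ Bool)) (o : Option M.V) : Fin k ⊕ ℕ :=
  o.elim (M.newLab (M.insertEquiv.symm τ)) (M.lab (M.insertEquiv.symm τ).1)

/-- The state after the insertion of a new vertex. -/
noncomputable def stepX (τ : Pairing (M.H ⊕ Bool)) : Fin k ⊕ ℕ → ℕ :=
  M.x (M.insertEquiv.symm τ).1 + Pi.single (M.newLab (M.insertEquiv.symm τ)) 1

lemma stepLab_insert (p : Pairing M.H × Option M.H) (o : Option M.V) :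
    M.stepLab (insertVertex p) o = o.elim (M.newLab p) (M.lab p.1) := by
  have : M.insertEquiv.symm (insertVertex p) = p := M.insertEquiv.symm_apply_apply p
  simp [stepLab, this]

lemma stepX_insert (p : Pairing M.H × Option M.H) :
    M.stepX (insertVertex p) = M.x p.1 + Pi.single (M.newLab p) 1 := by
  have : M.insertEquiv.symm (insertVertex p) = p := M.insertEquiv.symm_apply_apply p
  simp [stepX, this]

/-- Edges stay within components after an insertion. -/
lemma stepLab_vtx (τ : Pairing (M.H ⊕ Bool)) (z : M.H ⊕ Bool) :
    M.stepLab τ (M.stepVtx (τ.1 z)) = M.stepLab τ (M.stepVtx z) := by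
  obtain ⟨⟨σ, o⟩, rfl⟩ := insertVertex_surjective τ
  rw [stepLab_insert, stepLab_insert]
  rcases o with _ | h₀
  · rcases z with h | b
    · simp [insertVertex, addLoop, stepVtx, M.lab_vtx]
    · simp [insertVertex, addLoop, stepVtx]
  · rcases z with h | b
    · simp only [insertVertex, subdivide, Option.elim_some, Sum.elim_inl]
      split_ifs with h1 h2
      · simp [stepVtx, newLab, h1]
      · simp [stepVtx, newLab, h2, M.lab_vtx]
      · simp [stepVtx, M.lab_vtx]
    · cases b <;> simp [insertVertex, subdivide, stepVtx, newLab, M.lab_vtx]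

/-- Linked vertices stay linked: the new vertex is linked to both ends of the edge that it cuts. -/
lemma eqvGen_step (p : Pairing M.H × Option M.H) {v w : M.V}
    (h : Relation.EqvGen (Linked M.vtx p.1) v w) :
    Relation.EqvGen (Linked M.stepVtx (insertVertex p)) (some v) (some w) := by
  induction h with
  | refl v => exact .refl _
  | symm v w _ ih => exact ih.symm
  | trans u v w _ _ ih1 ih2 => exact ih1.trans _ _ _ ih2
  | rel v w h =>
    obtain ⟨h, rfl, rfl⟩ := h
    obtain ⟨σ, o⟩ := p
    rcases o with _ | h₀
    · exact .rel _ _ ⟨.inl h, rfl, by simp [insertVertex, addLoop, stepVtx]⟩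
    · have hf : Relation.EqvGen (Linked M.stepVtx (insertVertex (σ, some h₀))) none
          (some (M.vtx h₀)) :=
        .rel _ _ ⟨.inr false, rfl, by simp [insertVertex, subdivide, stepVtx]⟩
      have ht : Relation.EqvGen (Linked M.stepVtx (insertVertex (σ, some h₀))) none
          (some (M.vtx (σ.1 h₀))) :=
        .rel _ _ ⟨.inr true, rfl, by simp [insertVertex, subdivide, stepVtx]⟩
      by_cases h1 : h = h₀
      · subst h1
        exact hf.symm.trans _ _ _ ht
      · by_cases h2 : h = σ.1 h₀
        · subst h2
          rw [σ.2.1]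
          exact ht.symm.trans _ _ _ hf
        · exact .rel _ _ ⟨.inl h, rfl, by simp [insertVertex, subdivide, stepVtx, h1, h2]⟩

lemma newLab_eq_of_stepLab (p : Pairing M.H × Option M.H) {v : M.V}
    (h : M.newLab p = M.lab p.1 v) :
    Relation.EqvGen (Linked M.stepVtx (insertVertex p)) none (some v) := by
  obtain ⟨σ, o⟩ := p
  rcases o with _ | h₀
  · -- the label of a new loop is fresh
    exfalso
    have h1 := M.card_lab σ (M.lab σ v)
    rw [← h] at h1
    simp only [newLab, Option.elim_none, Sum.isLeft_inr, M.x_inr σ n le_rfl] at h1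
    have : Nonempty {w // M.lab σ w = .inr n} := ⟨v, h.symm⟩
    exact Nat.card_pos.ne' h1
  · refine .trans _ _ _ (.rel _ _ ⟨.inr false, rfl, ?_⟩) (M.eqvGen_step (σ, some h₀) (M.linked σ _ _ h))
    simp [insertVertex, subdivide, stepVtx]

/-- Insertion of one more vertex of degree `2`. -/
noncomputable def step : ComponentModel k (n + 1) where
  H := M.H ⊕ Bool
  V := Option M.V
  vtx := M.stepVtx
  card_fiber v := by
    rw [card_subtype_sum_bool]
    rcases v with _ | v
    · simp [stepVtx]
    · simpa [stepVtx] using M.card_fiber v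
  card_one := by
    simp only [card_subtype_sum_bool]
    rw [card_subtype_option]
    simpa [stepVtx] using M.card_one
  card_two := by
    simp only [card_subtype_sum_bool]
    rw [card_subtype_option]
    simpa [stepVtx] using M.card_two
  lab := M.stepLab
  x := M.stepX
  lab_vtx := M.stepLab_vtx
  linked τ v w h := by
    obtain ⟨p, rfl⟩ := insertVertex_surjective τ
    rw [stepLab_insert, stepLab_insert] at h
    rcases v with _ | v <;> rcases w with _ | w
    · exact .refl _
    · exact M.newLab_eq_of_stepLab p h
    · exact (M.newLab_eq_of_stepLab p h.symm).symm
    · exact M.eqvGen_step p (M.linked _ _ _ h)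
  card_lab τ ℓ := by
    obtain ⟨p, rfl⟩ := insertVertex_surjective τ
    simp only [card_subtype_option, stepLab_insert, stepX_insert, Option.elim_some,
      Option.elim_none, Pi.add_apply, Pi.single_apply, M.card_lab, eq_comm (a := ℓ)]
    by_cases h : M.newLab p = ℓ
    · simp only [h, if_true]
      omega
    · simp [h]
  card_half τ ℓ := by
    obtain ⟨p, rfl⟩ := insertVertex_surjective τ
    simp only [card_subtype_sum_bool, stepLab_insert, stepX_insert, Option.elim_some,
      Option.elim_none, Pi.add_apply, Pi.single_apply, M.card_half, eq_comm (a := ℓ), stepVtx,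
      Sum.elim_inl, Sum.elim_inr]
    by_cases h : M.newLab p = ℓ
    · simp only [h, if_true]
      omega
    · simp [h]
  x_inr τ i hi := by
    obtain ⟨⟨σ, o⟩, rfl⟩ := insertVertex_surjective τ
    rw [stepX_insert]
    have h1 := M.x_inr σ i (by omega)
    suffices M.newLab (σ, o) ≠ .inr i by simp [h1, this.symm]
    rcases o with _ | h₀
    · simp [newLab]
      omega
    · intro h
      have h2 := M.card_half σ (.inr i)
      simp only [Sum.isLeft_inr, h1] at h2
      have : Nonempty {h // M.lab σ (M.vtx h) = .inr i} := ⟨h₀, h⟩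
      exact Nat.card_pos.ne' h2
  sum_x F := by
    rw [sum_insert, chainSum, ← M.sum_x]
    refine Finset.sum_congr rfl fun σ _ => ?_
    have h1 := M.stepX_insert (σ, none)
    have h2 : ∀ h, M.stepX (σ.subdivide h) = M.x σ + Pi.single (M.lab σ (M.vtx h)) 1 :=
      fun h => M.stepX_insert (σ, some h)
    have h3 : M.stepX σ.addLoop = M.x σ + Pi.single (.inr n) 1 := h1
    rw [h3, add_assoc]
    congr 1
    simp only [h2]
    have h4 : ∀ h, M.lab σ (M.vtx h) ∈ Finset.univ.disjSum (Finset.range n) := by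
      intro h
      rcases h5 : M.lab σ (M.vtx h) with l | i
      · simp
      · simp only [Finset.inr_mem_disjSum, Finset.mem_range]
        by_contra! h6
        have h7 := M.card_half σ (.inr i)
        simp only [Sum.isLeft_inr, M.x_inr σ i h6] at h7
        have : Nonempty {h // M.lab σ (M.vtx h) = .inr i} := ⟨h, h5⟩
        exact Nat.card_pos.ne' h7
    rw [← Finset.sum_fiberwise_of_maps_to (fun h _ => h4 h), Finset.sum_disjSum]
    have h5 : ∀ ℓ, ∑ h with M.lab σ (M.vtx h) = ℓ, F (M.x σ + Pi.single (M.lab σ (M.vtx h)) 1)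
        = (2 * (M.x σ ℓ + if ℓ.isLeft then 1 else 0) : ℕ) * F (M.x σ + Pi.single ℓ 1) := by
      intro ℓ
      rw [← M.card_half, Nat.card_eq_fintype_card, Fintype.card_subtype, ← nsmul_eq_mul]
      refine Finset.sum_eq_card_nsmul fun h hh => ?_
      rw [(Finset.mem_filter.1 hh).2]
    simp [h5]

end ComponentModel

lemma nonempty_componentModel (k n : ℕ) : Nonempty (ComponentModel k n) := by
  induction n with
  | zero => exact ⟨.base k⟩
  | succ n ih => exact ih.map fun M => M.step

/-! ### From pairings to half-edge labellings -/

/-- The number of components of size `j` in a multigraph with component state `x`: the two ends of a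
path are not counted in `x`. -/
noncomputable def componentCount {k : ℕ} (x : Fin k ⊕ ℕ → ℕ) (j : ℕ) : ℕ :=
  Nat.card {ℓ : Fin k ⊕ ℕ // x ℓ + (if ℓ.isLeft then 2 else 0) = j}

/-- Two functions whose fibres have the same sizes differ by a bijection of their domains. -/
lemma exists_equiv_of_card_fiber {A B C : Type*} [Finite A] [Finite B] {f : A → C} {g : B → C}
    (h : ∀ c, Nat.card {a // f a = c} = Nat.card {b // g b = c}) :
    ∃ e : A ≃ B, ∀ a, g (e a) = f a := by
  let e : ∀ c, {a // f a = c} ≃ {b // g b = c} := fun c => (Finite.card_eq.1 (h c)).some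
  refine ⟨(Equiv.sigmaFiberEquiv f).symm.trans
    ((Equiv.sigmaCongrRight e).trans (Equiv.sigmaFiberEquiv g)), fun a => ?_⟩
  exact (e (f a) ⟨a, rfl⟩).2

/-- Summing over the domain of a map with fibres of constant size. -/
lemma exists_sum_comp_eq {X Y R : Type*} [Fintype X] [Fintype Y] [CommSemiring R] (Φ : X → Y)
    (P : Y → Prop) [DecidablePred P] (hP : ∀ y, P y ↔ ∃ x, Φ x = y)
    (h : ∀ x x', Nat.card {z // Φ z = Φ x} ≤ Nat.card {z // Φ z = Φ x'}) :
    ∃ c : ℕ, c ≠ 0 ∧ ∀ F : Y → R, ∑ x, F (Φ x) = c * ∑ y with P y, F y := by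
  classical
  rcases isEmpty_or_nonempty X with hX | ⟨⟨x₀⟩⟩
  · refine ⟨1, one_ne_zero, fun F => ?_⟩
    have : (Finset.univ.filter P) = ∅ := by
      simp [hP]
    simp [this]
  · refine ⟨Nat.card {z // Φ z = Φ x₀}, ?_, fun F => ?_⟩
    · have : Nonempty {z // Φ z = Φ x₀} := ⟨x₀, rfl⟩
      exact Nat.card_pos.ne'
    · rw [← Finset.sum_fiberwise_of_maps_to (s := Finset.univ) (t := Finset.univ.filter P) (g := Φ)
        (fun x _ => by simpa using (hP _).2 ⟨x, rfl⟩), Finset.mul_sum]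
      refine Finset.sum_congr rfl fun y hy => ?_
      obtain ⟨x, rfl⟩ := (hP y).1 (Finset.mem_filter.1 hy).2
      rw [le_antisymm (h x₀ x) (h x x₀), Nat.card_eq_fintype_card, Fintype.card_subtype,
        ← nsmul_eq_mul]
      refine Finset.sum_eq_card_nsmul fun z hz => ?_
      rw [(Finset.mem_filter.1 hz).2]

namespace Pairing

variable {H : Type*} {m : ℕ}

/-- The pairing of the half-edges that a numbering `β` of them by the two ends of `m` edges
defines. -/
def ofEquiv (β : Fin m × Bool ≃ H) : Pairing H :=
  ⟨fun h => β ((β.symm h).1, !(β.symm h).2), fun h => by simp, fun h h' => by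
    have := congrArg β.symm h'
    simp [Prod.ext_iff] at this⟩

lemma exists_ofEquiv [Fintype H] (hH : Fintype.card H = 2 * m) (σ : Pairing H) :
    ∃ β : Fin m × Bool ≃ H, ofEquiv β = σ := by
  obtain ⟨c, hc, hc2⟩ := exists_pair_numbering hH σ
  have hr : ∀ l, ∃ a, c a = l := by
    intro l
    have : Nat.card {a // c a = l} ≠ 0 := by rw [hc2]; norm_num
    obtain ⟨⟨a, ha⟩⟩ := (Nat.card_ne_zero.1 this).1
    exact ⟨a, ha⟩
  choose r hr using hr
  let f : Fin m × Bool → H := fun z => bif z.2 then σ.1 (r z.1) else r z.1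
  have hcf : ∀ z, c (f z) = z.1 := by
    rintro ⟨l, b⟩
    cases b
    · exact hr l
    · exact ((hc _ _).2 (.inr (σ.2.1 _).symm)).trans (hr l)
  have hf : Function.Injective f := by
    rintro ⟨l, b⟩ ⟨l', b'⟩ h
    obtain rfl : l = l' := by
      have := congrArg c h
      rwa [hcf, hcf] at this
    cases b <;> cases b' <;> simp [f] at h ⊢
    · exact σ.2.2 _ h.symm
    · exact σ.2.2 _ h
  have hb : Function.Bijective f := by
    rw [Fintype.bijective_iff_injective_and_card]
    exact ⟨hf, by simp [hH, mul_comm]⟩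
  refine ⟨.ofBijective f hb, ?_⟩
  ext h
  obtain ⟨⟨l, b⟩, rfl⟩ := hb.2 h
  have h1 : (Equiv.ofBijective f hb).symm (f (l, b)) = (l, b) :=
    (Equiv.ofBijective f hb).symm_apply_apply _
  simp only [ofEquiv, h1]
  cases b
  · simp [f]
  · simp [f, σ.2.1 _]

/-- Every pairing comes from the same number of numberings of the half-edges. -/
lemma exists_sum_ofEquiv [Fintype H] [DecidableEq H] (hH : Fintype.card H = 2 * m) (R : Type*)
    [CommSemiring R] :
    ∃ c : ℕ, c ≠ 0 ∧ ∀ F : Pairing H → R,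
      ∑ β : Fin m × Bool ≃ H, F (ofEquiv β) = c * ∑ σ, F σ := by
  obtain ⟨c, hc, h⟩ := exists_sum_comp_eq (R := R) (ofEquiv : (Fin m × Bool ≃ H) → _) (fun _ => True)
    (by simpa using exists_ofEquiv hH) (fun β₀ β₁ => by
      -- conjugation by `β₁ * β₀⁻¹` maps one fibre to the other
      refine Nat.card_le_card_of_injective
        (fun β => ⟨β.1.trans (β₀.symm.trans β₁), ?_⟩) ?_
      · obtain ⟨β, hβ⟩ := β
        ext h
        have h1 : ∀ h, β ((β.symm h).1, !(β.symm h).2) = β₀ ((β₀.symm h).1, !(β₀.symm h).2) :=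
          fun h => congrFun (congrArg Subtype.val hβ) h
        simp [ofEquiv, h1]
      · rintro ⟨β, hβ⟩ ⟨β', hβ'⟩ h
        simp only [Subtype.mk.injEq] at h ⊢
        ext z
        simpa using congrArg (fun e => β₁.symm (e z)) h)
  exact ⟨c, hc, by simpa using h⟩

end Pairing

namespace ComponentModel

variable {k n : ℕ} (M : ComponentModel k n)

lemma card_H : Fintype.card M.H = 2 * (k + n) := by
  classical
  have h1 := M.card_one
  have h2 := M.card_two
  rw [Nat.card_eq_fintype_card, Fintype.card_subtype] at h1 h2
  have h3 := Fintype.card_congr (Equiv.sigmaFiberEquiv M.vtx)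
  rw [Fintype.card_sigma] at h3
  rw [← h3]
  have h4 : ∀ v, Fintype.card {h // M.vtx h = v} =
      (if Nat.card {h // M.vtx h = v} = 1 then 1 else 0)
        + 2 * (if Nat.card {h // M.vtx h = v} = 2 then 1 else 0) := by
    intro v
    rcases M.card_fiber v with h | h <;> rw [← Nat.card_eq_fintype_card, h] <;> rfl
  simp only [h4, Finset.sum_add_distrib, ← Finset.mul_sum, ← Finset.card_filter, h1, h2]
  ring

/-- A function from the edge ends to the vertices with the prescribed numbers of fibres of size
`1` and `2` comes from a numbering of the half-edges and a labelling of the vertices. -/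
lemma exists_eq_comp {t : Fin (k + n) × Bool → Fin (2 * k + n)}
    (h1 : Nat.card {v // Nat.card {z // t z = v} = 1} = 2 * k)
    (h2 : Nat.card {v // Nat.card {z // t z = v} = 2} = n) :
    ∃ (β : Fin (k + n) × Bool ≃ M.H) (π : M.V ≃ Fin (2 * k + n)),
      (fun z => π (M.vtx (β z))) = t := by
  classical
  have h3 : ∀ v, Nat.card {z // t z = v} = 1 ∨ Nat.card {z // t z = v} = 2 := by
    rw [Nat.card_eq_fintype_card, Fintype.card_subtype] at h1 h2
    have h4 : (Finset.univ.filter fun v => Nat.card {z // t z = v} = 1) ∪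
        (Finset.univ.filter fun v => Nat.card {z // t z = v} = 2) = Finset.univ := by
      rw [← Finset.card_eq_iff_eq_univ, Finset.card_union_of_disjoint, h1, h2, Fintype.card_fin]
      rw [Finset.disjoint_filter]
      intro v _ h3 h4
      omega
    intro v
    have := h4 ▸ Finset.mem_univ v
    simpa using this
  obtain ⟨π, hπ⟩ := exists_equiv_of_card_fiber
    (f := fun v => Nat.card {h // M.vtx h = v}) (g := fun v => Nat.card {z // t z = v}) (by
      intro c
      by_cases hc1 : c = 1
      · rw [hc1, M.card_one, h1]
      by_cases hc2 : c = 2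
      · rw [hc2, M.card_two, h2]
      have : IsEmpty {v // Nat.card {h // M.vtx h = v} = c} :=
        ⟨fun v => by have := M.card_fiber v.1; have := v.2; omega⟩
      have : IsEmpty {v // Nat.card {z // t z = v} = c} :=
        ⟨fun v => by have := h3 v.1; have := v.2; omega⟩
      rw [Nat.card_of_isEmpty, Nat.card_of_isEmpty])
  obtain ⟨β, hβ⟩ := exists_equiv_of_card_fiber (f := t) (g := fun h => π (M.vtx h)) (by
      intro c
      obtain ⟨v, rfl⟩ := π.surjective c
      simp only [π.injective.eq_iff]
      exact hπ v)
  exact ⟨β, π, funext hβ⟩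

lemma card_fiber_comp (β : Fin (k + n) × Bool ≃ M.H) (π : M.V ≃ Fin (2 * k + n)) (j : ℕ) :
    Nat.card {v // Nat.card {z // π (M.vtx (β z)) = v} = j} =
      Nat.card {v // Nat.card {h // M.vtx h = v} = j} := by
  refine (Nat.card_congr (π.subtypeEquiv fun v => ?_)).symm
  rw [eq_iff_iff.symm]
  congr 1
  refine (Nat.card_congr (β.subtypeEquiv fun z => ?_)).symm
  simp

/-- The sum over all functions with the prescribed fibre sizes as a sum over numberings of the
half-edges and labellings of the vertices. -/
lemma exists_sum_comp (R : Type*) [CommSemiring R] :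
    ∃ c : ℕ, c ≠ 0 ∧ ∀ F : (Fin (k + n) × Bool → Fin (2 * k + n)) → R,
      ∑ p : (Fin (k + n) × Bool ≃ M.H) × (M.V ≃ Fin (2 * k + n)), F (fun z => p.2 (M.vtx (p.1 z)))
        = c * ∑ t with Nat.card {v // Nat.card {z // t z = v} = 1} = 2 * k ∧
            Nat.card {v // Nat.card {z // t z = v} = 2} = n, F t := by
  refine exists_sum_comp_eq
    (fun p : (Fin (k + n) × Bool ≃ M.H) × (M.V ≃ Fin (2 * k + n)) => fun z => p.2 (M.vtx (p.1 z)))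
    _ (fun t => ⟨fun h => ?_, ?_⟩) ?_
  · obtain ⟨β, π, h⟩ := M.exists_eq_comp h.1 h.2
    exact ⟨(β, π), h⟩
  · rintro ⟨⟨β, π⟩, rfl⟩
    simp only [M.card_fiber_comp, M.card_one, M.card_two, and_self]
  · rintro ⟨β₀, π₀⟩ ⟨β₁, π₁⟩
    refine Nat.card_le_card_of_injective (fun p => ⟨((β₁.trans β₀.symm).trans p.1.1,
      p.1.2.trans (π₀.symm.trans π₁)), ?_⟩) ?_
    · obtain ⟨⟨β, π⟩, hp⟩ := p
      ext z
      have := congrFun hp (β₀.symm (β₁ z))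
      simp only [Equiv.apply_symm_apply] at this
      simp [this]
    · rintro ⟨⟨β, π⟩, hp⟩ ⟨⟨β', π'⟩, hp'⟩ h
      simp only [Subtype.mk.injEq, Prod.mk.injEq] at h ⊢
      constructor
      · ext z
        simpa using congrArg (fun e => e (β₁.symm (β₀ z))) h.1
      · ext z
        have := congrArg (fun e => π₀ (π₁.symm (e z))) h.2
        simp at this
        rw [this]

end ComponentModel

/-! ### The configuration model as an insertion process -/

namespace LabelledMultigraph

variable {N m : ℕ}

/-- The multigraph whose `i`-th edge has the ends `t (i, false)` and `t (i, true)`. -/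
def ofEnds (t : Fin m × Bool → Fin N) : LabelledMultigraph N :=
  ⟨Finset.univ.val.map fun i => s(t (i, false), t (i, true))⟩

lemma degree_ofEnds (t : Fin m × Bool → Fin N) (v : Fin N) :
    (ofEnds t).degree v = Nat.card {z // t z = v} := by
  rw [degree, ofEnds, Multiset.countP_map, Multiset.count_map, Nat.card_eq_fintype_card,
    Fintype.card_subtype, Finset.card_filter, Fintype.sum_prod_type]
  change (Finset.univ.filter fun i => v ∈ s(t (i, false), t (i, true))).card +
    (Finset.univ.filter fun i => s(v, v) = s(t (i, false), t (i, true))).card = _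
  rw [Finset.card_filter, Finset.card_filter, ← Finset.sum_add_distrib]
  refine Finset.sum_congr rfl fun i _ => ?_
  simp only [Sym2.mem_iff, Sym2.eq_iff, Fintype.sum_bool]
  by_cases h1 : t (i, false) = v <;> by_cases h2 : t (i, true) = v <;>
    simp [h1, h2, eq_comm (a := v)]

/-- Edge ends written as a sequence of ordered pairs. -/
def endsEquiv (m N : ℕ) : (Fin m → Fin N × Fin N) ≃ (Fin m × Bool → Fin N) where
  toFun s z := bif z.2 then (s z.1).2 else (s z.1).1
  invFun t i := (t (i, false), t (i, true))
  left_inv s := by ext i <;> rfl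
  right_inv t := by ext ⟨i, b⟩; cases b <;> rfl

lemma seqv_eq {G : LabelledMultigraph N} (h : G.edges.card = m) :
    G.seqv = Nat.card {t : Fin m × Bool → Fin N // ofEnds t = G} := by
  subst h
  refine Nat.card_congr ((endsEquiv _ _).subtypeEquiv fun s => ?_)
  rw [LabelledMultigraph.ext_iff]
  rfl

lemma exists_ofEnds (G : LabelledMultigraph N) :
    ∃ t : Fin G.edges.card × Bool → Fin N, ofEnds t = G := by
  have h := G.seqv_pos
  rw [seqv_eq rfl] at h
  obtain ⟨⟨t, ht⟩⟩ := (Nat.card_pos_iff.1 h).1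
  exact ⟨t, ht⟩

lemma card_edges_of_mem {k n : ℕ} {G : LabelledMultigraph (2 * k + n)}
    (hG : G ∈ degreeOneTwo (2 * k) n) : G.edges.card = k + n := by
  obtain ⟨t, ht⟩ := G.exists_ofEnds
  have h1 : ∑ v, G.degree v = 2 * G.edges.card := by
    have h3 := Fintype.card_congr (Equiv.sigmaFiberEquiv t)
    rw [Fintype.card_sigma] at h3
    simp only [Fintype.card_prod, Fintype.card_fin, Fintype.card_bool] at h3
    refine Eq.trans ?_ (h3.trans (mul_comm _ _))
    refine Finset.sum_congr rfl fun v _ => ?_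
    conv_lhs => rw [← ht, degree_ofEnds]
    rw [Nat.card_eq_fintype_card]
  have h4 : ∀ v, G.degree v =
      (if G.degree v = 1 then 1 else 0) + 2 * (if G.degree v = 2 then 1 else 0) := by
    intro v
    rcases degree_eq_of_mem hG v with h | h <;> rw [h] <;> rfl
  obtain ⟨h5, h6⟩ := hG
  rw [Set.ncard_eq_toFinset_card'] at h5 h6
  simp only [Set.toFinset_ofPred] at h5 h6
  rw [Finset.sum_congr rfl fun v _ => h4 v] at h1
  simp only [Finset.sum_add_distrib, ← Finset.mul_sum, ← Finset.card_filter] at h1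
  omega

lemma ofEnds_mem_iff {k n : ℕ} (t : Fin (k + n) × Bool → Fin (2 * k + n)) :
    ofEnds t ∈ degreeOneTwo (2 * k) n ↔ Nat.card {v // Nat.card {z // t z = v} = 1} = 2 * k ∧
      Nat.card {v // Nat.card {z // t z = v} = 2} = n := by
  simp only [degreeOneTwo, Set.mem_ofPred_eq, degree_ofEnds, ← Nat.card_coe_set_eq]
  rfl

/-- Components are counted by any labelling of the vertices that separates exactly the components. -/
lemma numComponents_eq {ι : Type*} {G : LabelledMultigraph N} (c : Fin N → ι)
    (hc : ∀ v w, c v = c w ↔ G.toSimple.Reachable v w) {j : ℕ} (hj : j ≠ 0) :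
    G.numComponents j = Nat.card {ℓ // Nat.card {v // c v = ℓ} = j} := by
  let f : G.toSimple.ConnectedComponent → ι :=
    SimpleGraph.ConnectedComponent.lift c fun v w p _ => (hc v w).2 ⟨p⟩
  have hf : ∀ v, f (G.toSimple.connectedComponentMk v) = c v := fun v => rfl
  have hinj : Function.Injective f := by
    intro C D
    induction C using SimpleGraph.ConnectedComponent.ind with | _ v
    induction D using SimpleGraph.ConnectedComponent.ind with | _ w
    intro h
    rw [hf, hf, hc] at h
    exact SimpleGraph.ConnectedComponent.eq.2 h
  have hcard : ∀ C, C.supp.ncard = Nat.card {v // c v = f C} := by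
    intro C
    rw [← Nat.card_coe_set_eq]
    refine Nat.card_congr (Equiv.subtypeEquivRight fun v => ?_)
    rw [SimpleGraph.ConnectedComponent.mem_supp_iff, ← hinj.eq_iff, hf]
  refine Nat.card_congr (Equiv.ofBijective (fun C => ⟨f C.1, by rw [← hcard, C.2]⟩) ⟨?_, ?_⟩)
  · intro C D h
    exact Subtype.ext (hinj (by simpa using h))
  · rintro ⟨ℓ, hℓ⟩
    have : Nat.card {v // c v = ℓ} ≠ 0 := by omega
    obtain ⟨⟨v, rfl⟩⟩ := (Nat.card_ne_zero.1 this).1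
    exact ⟨⟨G.toSimple.connectedComponentMk v, by rw [hcard, hf, hℓ]⟩, Subtype.ext (hf v)⟩

/-- The weighted sum over the multigraphs as a sum over functions from edge ends to vertices. -/
lemma sum_compensation_mul {k n : ℕ} {𝕜 : Type*} [RCLike 𝕜] [Fintype (degreeOneTwo (2 * k) n)]
    (f : LabelledMultigraph (2 * k + n) → 𝕜) :
    ∑ G : degreeOneTwo (2 * k) n, ((G.1.compensation : ℝ) : 𝕜) * f G.1 =
      ((2 ^ (k + n) * ((k + n).factorial : 𝕜)))⁻¹ *
        ∑ t : Fin (k + n) × Bool → Fin (2 * k + n) with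
          Nat.card {v // Nat.card {z // t z = v} = 1} = 2 * k ∧
            Nat.card {v // Nat.card {z // t z = v} = 2} = n, f (ofEnds t) := by
  classical
  rw [← Finset.sum_fiberwise_of_maps_to (t := (degreeOneTwo (2 * k) n).toFinset) (g := ofEnds)
    (fun t ht => by
      rw [Set.mem_toFinset, ofEnds_mem_iff]
      exact (Finset.mem_filter.1 ht).2), Finset.mul_sum,
    ← Finset.sum_set_coe (degreeOneTwo (2 * k) n)]
  refine Finset.sum_congr rfl fun G _ => ?_
  rw [Finset.sum_congr (g := fun _ => f G.1) rfl fun t ht => by rw [(Finset.mem_filter.1 ht).2],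
    Finset.sum_const, nsmul_eq_mul, compensation, card_edges_of_mem G.2,
    seqv_eq (card_edges_of_mem G.2), Nat.card_eq_fintype_card, Fintype.card_subtype,
    Finset.filter_filter]
  have : (Finset.univ.filter fun t : Fin (k + n) × Bool → Fin (2 * k + n) => ofEnds t = G.1) =
      Finset.univ.filter fun t => (Nat.card {v // Nat.card {z // t z = v} = 1} = 2 * k ∧
            Nat.card {v // Nat.card {z // t z = v} = 2} = n) ∧ ofEnds t = G.1 := by
    refine Finset.filter_congr fun t _ => ?_
    rw [← ofEnds_mem_iff]
    exact ⟨fun h => ⟨h ▸ G.2, h⟩, fun h => h.2⟩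
  rw [this]
  push_cast
  ring

end LabelledMultigraph

namespace ComponentModel

variable {k n : ℕ} (M : ComponentModel k n)

open LabelledMultigraph

/-- The components of the multigraph of a pairing have the sizes given by the labelling. -/
lemma numComponents_ofEnds (β : Fin (k + n) × Bool ≃ M.H) (π : M.V ≃ Fin (2 * k + n)) {j : ℕ}
    (hj : j ≠ 0) :
    (ofEnds fun z => π (M.vtx (β z))).numComponents j =
      componentCount (M.x (Pairing.ofEquiv β)) j := by
  set σ := Pairing.ofEquiv β with hσ
  set G := ofEnds fun z => π (M.vtx (β z)) with hG
  have hmem : ∀ i, s(π (M.vtx (β (i, false))), π (M.vtx (β (i, true)))) ∈ G.edges := by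
    intro i
    simp only [hG, ofEnds, Multiset.mem_map]
    exact ⟨i, Finset.mem_univ_val i, rfl⟩
  have hσβ : ∀ z, σ.1 (β z) = β (z.1, !z.2) := fun z => by simp [hσ, Pairing.ofEquiv]
  have hreach : ∀ v w, Relation.EqvGen (Linked M.vtx σ) v w → G.toSimple.Reachable (π v) (π w) := by
    intro v w h
    induction h with
    | refl v => exact .refl _
    | symm v w _ ih => exact ih.symm
    | trans u v w _ _ ih1 ih2 => exact ih1.trans ih2
    | rel v w h =>
      obtain ⟨h, rfl, rfl⟩ := h
      by_cases he : π (M.vtx h) = π (M.vtx (σ.1 h))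
      · rw [he]
      · refine SimpleGraph.Adj.reachable ?_
        rw [toSimple, SimpleGraph.fromEdgeSet_adj]
        refine ⟨?_, he⟩
        obtain ⟨⟨i, b⟩, rfl⟩ := β.surjective h
        rw [hσβ]
        cases b
        · exact hmem i
        · rw [Sym2.eq_swap]
          exact hmem i
  have hadj : ∀ a b, G.toSimple.Reachable a b → M.lab σ (π.symm a) = M.lab σ (π.symm b) := by
    rintro a b ⟨p⟩
    induction p with
    | nil => rfl
    | cons h _ ih =>
      refine Eq.trans ?_ ih
      rw [toSimple, SimpleGraph.fromEdgeSet_adj] at h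
      obtain ⟨h, -⟩ := h
      simp only [hG, ofEnds, Set.mem_ofPred_eq, Multiset.mem_map] at h
      obtain ⟨i, -, h⟩ := h
      have h2 := M.lab_vtx σ (β (i, false))
      rw [hσβ] at h2
      rw [Sym2.eq_iff] at h
      rcases h with ⟨rfl, rfl⟩ | ⟨rfl, rfl⟩
      · simpa using h2.symm
      · simpa using h2
  rw [numComponents_eq (fun a => M.lab σ (π.symm a)) (fun a b => ⟨fun h => ?_, hadj a b⟩) hj]
  · have : ∀ ℓ, Nat.card {a // M.lab σ (π.symm a) = ℓ} = M.x σ ℓ + if ℓ.isLeft then 2 else 0 := by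
      intro ℓ
      rw [← M.card_lab]
      exact Nat.card_congr (π.symm.subtypeEquiv fun a => Iff.rfl)
    simp only [this]
    rfl
  · simpa using hreach _ _ (M.linked σ _ _ h)

end ComponentModel

lemma chainSum_one_ne_zero (k n : ℕ) {R : Type} [CommRing R] [CharZero R] [NoZeroDivisors R] :
    chainSum k n (fun _ => (1 : R)) ≠ 0 := by
  obtain ⟨M⟩ := nonempty_componentModel k n
  intro h
  have h1 := M.sum_x (fun _ => (1 : R))
  rw [h, mul_zero] at h1
  simp only [Finset.sum_const, nsmul_eq_mul, mul_one, Nat.cast_eq_zero, Finset.card_univ,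
    Fintype.card_eq_zero_iff] at h1
  have e : Fin (k + n) × Bool ≃ M.H := Fintype.equivOfCardEq (by simp [M.card_H, mul_comm])
  exact h1.false (Pairing.ofEquiv e)

open LabelledMultigraph in
/-- The law of the component counts in the configuration model, by way of the insertion process. -/
theorem integral_configurationModel (k n : ℕ) {𝕜 : Type} [RCLike 𝕜] (g : (ℕ → ℕ) → 𝕜) :
    ∫ G, g (fun j => G.numComponents (j + 1)) ∂(configurationModel (2 * k) n) =
      chainSum k n (fun x => g fun j => componentCount x (j + 1)) / chainSum k n (fun _ => (1 : 𝕜)) := by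
  classical
  obtain ⟨M⟩ := nonempty_componentModel k n
  have hfin := (finite_degreeOneTwo (2 * k) n).to_subtype
  have := Fintype.ofFinite (degreeOneTwo (2 * k) n)
  -- every integral is the same multiple of a sum over the histories
  obtain ⟨c, hc⟩ : ∃ c : 𝕜, ∀ g : (ℕ → ℕ) → 𝕜,
      ∫ G, g (fun j => G.numComponents (j + 1)) ∂(configurationModel (2 * k) n) =
        c * chainSum k n (fun x => g fun j => componentCount x (j + 1)) := by
    obtain ⟨c₁, hc₁, h₁⟩ := M.exists_sum_comp 𝕜
    obtain ⟨c₂, hc₂, h₂⟩ := Pairing.exists_sum_ofEquiv M.card_H 𝕜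
    refine ⟨((weight (2 * k) n Set.univ)⁻¹.toReal : 𝕜) *
      ((2 ^ (k + n) * ((k + n).factorial : 𝕜))⁻¹ * ((c₁ : 𝕜)⁻¹ * (Fintype.card (M.V ≃ Fin (2 * k + n)) * (c₂ *
        Fintype.card (Pairing (Fin (2 * k))))))), fun g => ?_⟩
    have h3 := h₁ fun t => g fun j => (ofEnds t).numComponents (j + 1)
    have hc₁' : (c₁ : 𝕜) ≠ 0 := by exact_mod_cast hc₁
    rw [← inv_mul_eq_iff_eq_mul₀ hc₁'] at h3
    rw [configurationModel, integral_smul_measure, weight, Measure.sum_fintype,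
      integral_finsetSum_measure (fun G _ => ?_)]
    · have h4 : ∀ G : degreeOneTwo (2 * k) n,
          ∫ G', g (fun j => G'.numComponents (j + 1)) ∂((compensation G.1 : ℝ≥0∞) • Measure.dirac G.1)
          = ((G.1.compensation : ℝ) : 𝕜) * g fun j => G.1.numComponents (j + 1) := by
        intro G
        rw [integral_smul_measure, integral_dirac, ENNReal.coe_toReal, RCLike.real_smul_eq_coe_mul]
      rw [Finset.sum_congr rfl fun G _ => h4 G,
        sum_compensation_mul fun G => g fun j => G.numComponents (j + 1), ← h3]
      simp only [M.numComponents_ofEnds _ _ (Nat.succ_ne_zero _)]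
      rw [Fintype.sum_prod_type_right]
      simp only [h₂ fun σ => g fun j => componentCount (M.x σ) (j + 1), Finset.sum_const,
        M.sum_x fun x => g fun j => componentCount x (j + 1), nsmul_eq_mul, Finset.card_univ,
        RCLike.real_smul_eq_coe_mul]
      ring
    · exact (integrable_dirac (by simp)).smul_measure ENNReal.coe_ne_top
  have h1 := hc fun _ => 1
  rw [integral_const, probReal_univ, one_smul] at h1
  rw [hc, eq_div_iff (chainSum_one_ne_zero k n)]
  linear_combination -chainSum k n (fun x => g fun j => componentCount x (j + 1)) * h1

/-! ### Generating functions of the insertion process -/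

section ChainSum

variable {R : Type} [CommRing R] {k n : ℕ}

lemma chainSum_add (F G : (Fin k ⊕ ℕ → ℕ) → R) :
    chainSum k n (fun x => F x + G x) = chainSum k n F + chainSum k n G := by
  induction n generalizing F G with
  | zero => rfl
  | succ n ih =>
    simp only [chainSum]
    rw [← ih]
    congr 1
    ext x
    simp only [mul_add, Finset.sum_add_distrib]
    ring

lemma chainSum_const_mul (a : R) (F : (Fin k ⊕ ℕ → ℕ) → R) :
    chainSum k n (fun x => a * F x) = a * chainSum k n F := by
  induction n generalizing F with
  | zero => rfl
  | succ n ih =>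
    simp only [chainSum]
    rw [← ih]
    congr 1
    ext x
    simp only [mul_add, Finset.mul_sum]
    ring_nf

lemma chainSum_sum {ι : Type*} (s : Finset ι) (F : ι → (Fin k ⊕ ℕ → ℕ) → R) :
    chainSum k n (fun x => ∑ i ∈ s, F i x) = ∑ i ∈ s, chainSum k n (F i) := by
  classical
  induction s using Finset.induction_on with
  | empty => simpa using chainSum_const_mul (k := k) (n := n) (0 : R) fun _ => 0
  | insert i s hi ih => simp only [Finset.sum_insert hi, chainSum_add, ih]

/-- An invariant of the process: at time `n` only the cycles with index below `n` can be nonempty,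
and there are `n` vertices in total. -/
def IsState (n : ℕ) (x : Fin k ⊕ ℕ → ℕ) : Prop :=
  (∀ i, n ≤ i → x (Sum.inr i) = 0) ∧ ∑ l, x (Sum.inl l) + ∑ i ∈ Finset.range n, x (Sum.inr i) = n

lemma IsState.add_inr_self {x : Fin k ⊕ ℕ → ℕ} (hx : IsState n x) :
    IsState (n + 1) (x + Pi.single (Sum.inr n) 1) := by
  refine ⟨fun i hi => ?_, ?_⟩
  · have := hx.1 i (by omega)
    simp [this, show i ≠ n by omega]
  · have h1 := hx.2
    have h2 := hx.1 n le_rfl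
    have h3 : ∀ i ∈ Finset.range n, (x + Pi.single (Sum.inr n) 1 : Fin k ⊕ ℕ → ℕ) (Sum.inr i) = x (Sum.inr i) := by
      intro i hi
      have := Finset.mem_range.1 hi
      simp [show i ≠ n by omega]
    rw [Finset.sum_range_succ, Finset.sum_congr rfl h3]
    simp [h2]
    omega

lemma IsState.add_inl {x : Fin k ⊕ ℕ → ℕ} (hx : IsState n x) (l : Fin k) :
    IsState (n + 1) (x + Pi.single (Sum.inl l) 1) := by
  refine ⟨fun i hi => ?_, ?_⟩
  · have := hx.1 i (by omega)
    simp [this]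
  · have h1 := hx.2
    have h2 := hx.1 n le_rfl
    simp [Finset.sum_range_succ, h2, Finset.sum_add_distrib, Pi.single_apply]
    omega

lemma IsState.add_inr {x : Fin k ⊕ ℕ → ℕ} (hx : IsState n x) {i : ℕ} (hi : i < n) :
    IsState (n + 1) (x + Pi.single (Sum.inr i) 1) := by
  refine ⟨fun j hj => ?_, ?_⟩
  · have := hx.1 j (by omega)
    simp [this, show j ≠ i by omega]
  · have h1 := hx.2
    have h2 := hx.1 n le_rfl
    have h3 : ∀ j, (Pi.single (Sum.inr i) 1 : Fin k ⊕ ℕ → ℕ) (Sum.inr j) = if i = j then 1 else 0 := by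
      intro j
      simp [Pi.single_apply, eq_comm]
    simp only [Pi.add_apply, h3, Finset.sum_range_succ, Finset.sum_add_distrib,
      Finset.sum_ite_eq, Finset.mem_range, h2]
    simp [show i < n + 1 by omega]
    omega

lemma chainSum_congr {F G : (Fin k ⊕ ℕ → ℕ) → R} (h : ∀ x, IsState n x → F x = G x) :
    chainSum k n F = chainSum k n G := by
  induction n generalizing F G with
  | zero => exact h 0 ⟨by simp, by simp⟩
  | succ n ih =>
    refine ih fun x hx => ?_
    rw [h _ hx.add_inr_self]
    congr 1
    · congr 1
      exact Finset.sum_congr rfl fun l _ => by rw [h _ (hx.add_inl l)]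
    · exact Finset.sum_congr rfl fun i hi => by rw [h _ (hx.add_inr (Finset.mem_range.1 hi))]

/-- If every step of the process multiplies the function `F n` by a constant `b n` on average, then
its sum is a product. -/
lemma chainSum_eq_prod {F : ℕ → (Fin k ⊕ ℕ → ℕ) → R} (b : ℕ → R)
    (h : ∀ n x, IsState n x → F (n + 1) (x + Pi.single (Sum.inr n) 1)
        + ∑ l : Fin k, 2 * ((x (Sum.inl l) : R) + 1) * F (n + 1) (x + Pi.single (Sum.inl l) 1)
        + ∑ i ∈ Finset.range n,
            2 * (x (Sum.inr i) : R) * F (n + 1) (x + Pi.single (Sum.inr i) 1) = b n * F n x) :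
    chainSum k n (F n) = F 0 0 * ∏ l ∈ Finset.range n, b l := by
  induction n with
  | zero => simp [chainSum]
  | succ n ih =>
    rw [chainSum, chainSum_congr (h n), chainSum_const_mul, ih, Finset.prod_range_succ]
    ring

lemma IsState.cast_sum {x : Fin k ⊕ ℕ → ℕ} (hx : IsState n x) :
    (∑ l, (x (Sum.inl l) : R)) + ∑ i ∈ Finset.range n, (x (Sum.inr i) : R) = n := by
  exact_mod_cast congrArg (Nat.cast : ℕ → R) hx.2

/-- The number of pairings grows by the factor `2 (k + l) + 1` at time `l`: there are `2 (k + l)`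
half-edges to insert at, and the new vertex may be a loop. -/
lemma chainSum_one : chainSum k n (fun _ => (1 : R)) = ∏ l ∈ Finset.range n, (2 * ((k : R) + l) + 1) := by
  rw [chainSum_eq_prod (F := fun _ _ => 1) (fun l => 2 * ((k : R) + l) + 1), one_mul]
  intro n x hx
  have := hx.cast_sum (R := R)
  simp only [mul_one, ← Finset.mul_sum, Finset.sum_add_distrib, Finset.sum_const, Finset.card_univ,
    Fintype.card_fin, nsmul_eq_mul]
  linear_combination 2 * this

/-- The number of vertices on cycles. -/
def cycleVertices (n : ℕ) (x : Fin k ⊕ ℕ → ℕ) : ℕ := ∑ i ∈ Finset.range n, x (Sum.inr i)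

lemma IsState.cycleVertices_add_inr_self {x : Fin k ⊕ ℕ → ℕ} (hx : IsState n x) :
    cycleVertices (n + 1) (x + Pi.single (Sum.inr n) 1) = cycleVertices n x + 1 := by
  have := hx.add_inr_self.2
  have := hx.2
  simp only [cycleVertices]
  simp only [Pi.add_apply, Pi.single_apply, reduceCtorEq, if_false, add_zero] at *
  omega

lemma IsState.cycleVertices_add_inl {x : Fin k ⊕ ℕ → ℕ} (hx : IsState n x) (l : Fin k) :
    cycleVertices (n + 1) (x + Pi.single (Sum.inl l) 1) = cycleVertices n x := by
  simp [cycleVertices, Finset.sum_range_succ, hx.1 n le_rfl]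

lemma IsState.cycleVertices_add_inr {x : Fin k ⊕ ℕ → ℕ} (hx : IsState n x) {i : ℕ}
    (hi : i ∈ Finset.range n) :
    cycleVertices (n + 1) (x + Pi.single (Sum.inr i) 1) = cycleVertices n x + 1 := by
  have := (hx.add_inr (Finset.mem_range.1 hi)).2
  have := hx.2
  simp only [cycleVertices]
  simp only [Pi.add_apply, Pi.single_apply, reduceCtorEq, if_false, add_zero] at *
  omega

end ChainSum

section Urn

variable {K : Type} [Field K] [CharZero K] {k n : ℕ}

/-- The coefficients of the power series `(1 - z) ^ (-1/2)`, the weights of the collections of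
cycles. -/
def cycleWeight (K : Type) [Field K] (c : ℕ) : K := ∏ l ∈ Finset.range c, ((l : K) + 1 / 2) / (l + 1)

lemma cycleWeight_succ (c : ℕ) :
    cycleWeight K (c + 1) * (c + 1) = cycleWeight K c * (c + 1 / 2) := by
  rw [cycleWeight, Finset.prod_range_succ, ← cycleWeight]
  have : (c : K) + 1 ≠ 0 := Nat.cast_add_one_ne_zero c
  field_simp

open PowerSeries in
lemma derivative_prod {ι A : Type*} [CommRing A] [DecidableEq ι] (s : Finset ι)
    (f : ι → PowerSeries A) :
    d⁄dX A (∏ i ∈ s, f i) = ∑ i ∈ s, (∏ j ∈ s.erase i, f j) * d⁄dX A (f i) := by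
  induction s using Finset.induction_on with
  | empty => simp
  | insert a s ha ih =>
    rw [Finset.prod_insert ha, Derivation.leibniz, ih, Finset.sum_insert ha,
      Finset.erase_insert ha, smul_eq_mul, smul_eq_mul, Finset.mul_sum, add_comm]
    congr 1
    refine Finset.sum_congr rfl fun i hi => ?_
    have hne : i ≠ a := fun h => ha (h ▸ hi)
    rw [Finset.erase_insert_of_ne hne.symm, Finset.prod_insert (by simp [ha]), mul_assoc]

open PowerSeries in
/-- **Pólya urn**: the sum over the histories of a product of functions of the sizes of the paths
and of the number of vertices on cycles is a coefficient of a product of power series.  Insertion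
of a vertex acts on the series as differentiation. -/
theorem chainSum_prod (f : Fin k → ℕ → K) (g : ℕ → K) :
    chainSum k n (fun x => (∏ l, f l (x (Sum.inl l))) * g (cycleVertices n x)) =
      2 ^ n * n.factorial * coeff n ((∏ l, mk (f l)) * mk fun c => cycleWeight K c * g c) := by
  induction n generalizing f g with
  | zero => simp [chainSum, cycleVertices, cycleWeight, coeff_zero_eq_constantCoeff_apply, map_prod]
  | succ n ih =>
    have hstep : ∀ x : Fin k ⊕ ℕ → ℕ, IsState n x →
        (∏ l, f l ((x + Pi.single (Sum.inr n) 1 : Fin k ⊕ ℕ → ℕ) (Sum.inl l))) *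
            g (cycleVertices (n + 1) (x + Pi.single (Sum.inr n) 1))
          + ∑ l, 2 * ((x (Sum.inl l) : K) + 1) *
            ((∏ l', f l' ((x + Pi.single (Sum.inl l) 1 : Fin k ⊕ ℕ → ℕ) (Sum.inl l'))) *
              g (cycleVertices (n + 1) (x + Pi.single (Sum.inl l) 1)))
          + ∑ i ∈ Finset.range n, 2 * (x (Sum.inr i) : K) *
            ((∏ l', f l' ((x + Pi.single (Sum.inr i) 1 : Fin k ⊕ ℕ → ℕ) (Sum.inl l'))) *
              g (cycleVertices (n + 1) (x + Pi.single (Sum.inr i) 1)))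
        = 2 * ((∏ l, f l (x (Sum.inl l))) *
              (fun c : ℕ => ((c : K) + 1 / 2) * g (c + 1)) (cycleVertices n x))
          + ∑ l, 2 * ((∏ l', Function.update f l (fun a => ((a : K) + 1) * f l (a + 1)) l'
              (x (Sum.inl l'))) * g (cycleVertices n x)) := by
      intro x hx
      have h1 := hx.cycleVertices_add_inr_self
      have h2 := hx.cycleVertices_add_inl
      have h3 : ∀ i ∈ Finset.range n,
          cycleVertices (n + 1) (x + Pi.single (Sum.inr i) 1) = cycleVertices n x + 1 :=
        fun i hi => hx.cycleVertices_add_inr hi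
      have h4 : ∑ i ∈ Finset.range n, 2 * (x (Sum.inr i) : K) *
            ((∏ l', f l' ((x + Pi.single (Sum.inr i) 1 : Fin k ⊕ ℕ → ℕ) (Sum.inl l'))) *
              g (cycleVertices (n + 1) (x + Pi.single (Sum.inr i) 1))) =
          2 * (cycleVertices n x : K) *
            ((∏ l', f l' (x (Sum.inl l'))) * g (cycleVertices n x + 1)) := by
        rw [cycleVertices, Nat.cast_sum, Finset.mul_sum, Finset.sum_mul]
        refine Finset.sum_congr rfl fun i hi => ?_
        rw [h3 i hi]
        simp [cycleVertices]
      have h5 : ∀ l, ((x (Sum.inl l) : K) + 1) * (∏ l', f l' ((x + Pi.single (Sum.inl l) 1 : Fin k ⊕ ℕ → ℕ) (Sum.inl l')))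
          = ∏ l', Function.update f l (fun a => ((a : K) + 1) * f l (a + 1)) l' (x (Sum.inl l')) := by
        intro l
        rw [← Finset.mul_prod_erase _ _ (Finset.mem_univ l),
          ← Finset.mul_prod_erase _ _ (Finset.mem_univ l), ← mul_assoc]
        congr 1
        · simp
        · refine Finset.prod_congr rfl fun l' hl' => ?_
          have := Finset.ne_of_mem_erase hl'
          simp [this]
      rw [h4, h1]
      simp only [h2, ← h5]
      simp only [Pi.add_apply, Pi.single_apply, reduceCtorEq, if_false, add_zero, mul_assoc]
      ring
    rw [chainSum, chainSum_congr hstep, chainSum_add, chainSum_const_mul, chainSum_sum,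
      show _ = _ from ih f (fun c : ℕ => ((c : K) + 1 / 2) * g (c + 1))]
    simp only [chainSum_const_mul, ih]
    have hderiv : ∀ u : ℕ → K, d⁄dX K (mk u) = mk fun a => ((a : K) + 1) * u (a + 1) := by
      intro u
      ext a
      simp [coeff_derivative, mul_comm]
    have hB : (mk fun c => cycleWeight K c * (((c : K) + 1 / 2) * g (c + 1))) =
        d⁄dX K (mk fun c => cycleWeight K c * g c) := by
      rw [hderiv]
      congr 1
      ext c
      rw [← mul_assoc, ← cycleWeight_succ]
      ring
    have hA : ∀ l, (∏ l', mk (Function.update f l (fun a => ((a : K) + 1) * f l (a + 1)) l')) =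
        (∏ l' ∈ Finset.univ.erase l, mk (f l')) * d⁄dX K (mk (f l)) := by
      intro l
      rw [← Finset.mul_prod_erase _ _ (Finset.mem_univ l), hderiv, mul_comm]
      congr 1
      · refine Finset.prod_congr rfl fun l' hl' => ?_
        simp [Finset.ne_of_mem_erase hl']
      · simp
    have hprod : d⁄dX K ((∏ l, mk (f l)) * mk fun c => cycleWeight K c * g c) =
        (∏ l, mk (f l)) * d⁄dX K (mk fun c => cycleWeight K c * g c) +
          ∑ l, ((∏ l' ∈ Finset.univ.erase l, mk (f l')) * d⁄dX K (mk (f l))) *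
            mk fun c => cycleWeight K c * g c := by
      rw [Derivation.leibniz, derivative_prod]
      simp only [smul_eq_mul]
      rw [Finset.mul_sum]
      congr 1
      exact Finset.sum_congr rfl fun l _ => mul_comm _ _
    have hcoeff := congrArg (coeff n) hprod
    rw [coeff_derivative, map_add, map_sum] at hcoeff
    simp only [hB, hA]
    rw [← Finset.mul_sum, ← Finset.mul_sum, Nat.factorial_succ, pow_succ]
    push_cast
    linear_combination (-2 * 2 ^ n * (n.factorial : K)) * hcoeff

end Urn

/-! ### Moments of the numbers of components -/

section Counts

variable {k n : ℕ}

/-- The number of paths with exactly `i` vertices of degree `2`. -/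
def pathCount (x : Fin k ⊕ ℕ → ℕ) (i : ℕ) : ℕ := (Finset.univ.filter fun l => x (Sum.inl l) = i).card

/-- The number of cycles with exactly `j` vertices at time `n`. -/
def cycleCount (n : ℕ) (x : Fin k ⊕ ℕ → ℕ) (j : ℕ) : ℕ :=
  ((Finset.range n).filter fun i => x (Sum.inr i) = j).card

lemma IsState.card_eq {x : Fin k ⊕ ℕ → ℕ} (hx : IsState n x) {j : ℕ} (hj : j ≠ 0) :
    componentCount x j = (Finset.univ.filter fun l => x (Sum.inl l) + 2 = j).card +
      cycleCount n x j := by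
  rw [cycleCount, ← Finset.card_disjSum, componentCount]
  refine Nat.subtype_card _ fun ℓ => ?_
  rcases ℓ with l | i
  · simp
  · simp only [Finset.inr_mem_disjSum, Finset.mem_filter, Finset.mem_range, Sum.isLeft_inr]
    refine ⟨fun h => h.2, fun h => ⟨?_, h⟩⟩
    by_contra! h2
    rw [hx.1 i h2] at h
    exact hj h.symm

lemma IsState.componentCount_add_two {x : Fin k ⊕ ℕ → ℕ} (hx : IsState n x) (i : ℕ) :
    componentCount x (i + 2) = pathCount x i + cycleCount n x (i + 2) := by
  rw [hx.card_eq (by omega), pathCount]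
  simp

lemma IsState.componentCount_one {x : Fin k ⊕ ℕ → ℕ} (hx : IsState n x) :
    componentCount x 1 = cycleCount n x 1 := by
  rw [hx.card_eq (by omega)]
  simp

lemma cycleCount_le (x : Fin k ⊕ ℕ → ℕ) {j : ℕ} (hj : j ≠ 0) :
    cycleCount n x j ≤ cycleVertices n x := by
  rw [cycleCount, Finset.card_filter, cycleVertices]
  refine Finset.sum_le_sum fun i _ => ?_
  split_ifs <;> omega

lemma cycleCount_le_time (x : Fin k ⊕ ℕ → ℕ) (j : ℕ) : cycleCount n x j ≤ n :=
  (Finset.card_filter_le _ _).trans (Finset.card_range n).le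

/-- The average of `F` over all histories of the insertion process. -/
noncomputable def chainMean {K : Type} [Field K] (k n : ℕ) (F : (Fin k ⊕ ℕ → ℕ) → K) : K :=
  chainSum k n F / chainSum k n fun _ => 1

end Counts

section Moments

variable {K : Type} [Field K] [CharZero K] {k n : ℕ}

open PowerSeries in
/-- The coefficient of `z ^ n` in `(1 - z) ^ (-k - 1/2)`, the total weight of the states. -/
noncomputable def totalWeight (K : Type) [Field K] (k n : ℕ) : K :=
  coeff n ((mk fun _ => (1 : K)) ^ k * mk (cycleWeight K))

lemma chainSum_one_eq : chainSum k n (fun _ => (1 : K)) = 2 ^ n * n.factorial * totalWeight K k n := by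
  have := chainSum_prod (K := K) (k := k) (n := n) (fun _ _ => 1) (fun _ => 1)
  simpa [totalWeight] using this

/-- Comparison of the two expressions for the number of histories. -/
lemma totalWeight_eq : totalWeight K k n = ∏ l ∈ Finset.range n, ((k : K) + l + 1 / 2) / (l + 1) := by
  have h := chainSum_one_eq (K := K) (k := k) (n := n)
  rw [chainSum_one] at h
  have h2 : (2 ^ n * n.factorial : K) ≠ 0 := by
    have := Nat.factorial_ne_zero n
    simp [this]
  have h3 : ((n.factorial : ℕ) : K) = ∏ l ∈ Finset.range n, ((l : K) + 1) := by
    rw [← Finset.prod_range_add_one_eq_factorial]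
    push_cast
    rfl
  rw [← mul_right_inj' h2, ← h, Finset.prod_div_distrib, ← h3]
  have h4 : ∏ l ∈ Finset.range n, (2 * ((k : K) + l) + 1) =
      2 ^ n * ∏ l ∈ Finset.range n, ((k : K) + l + 1 / 2) := by
    rw [← Finset.card_range n, ← Finset.prod_const, Finset.card_range, ← Finset.prod_mul_distrib]
    refine Finset.prod_congr rfl fun l _ => ?_
    ring
  rw [h4]
  have h5 : (n.factorial : K) ≠ 0 := by exact_mod_cast Nat.factorial_ne_zero n
  rw [mul_assoc, mul_div_cancel₀ _ h5]

lemma totalWeight_succ_right :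
    totalWeight K k (n + 1) * (n + 1) = totalWeight K k n * (k + n + 1 / 2) := by
  rw [totalWeight_eq, totalWeight_eq, Finset.prod_range_succ, mul_assoc,
    div_mul_cancel₀ _ (Nat.cast_add_one_ne_zero n)]

lemma totalWeight_succ_left :
    totalWeight K (k + 1) n * (k + 1 / 2) = totalWeight K k n * (k + n + 1 / 2) := by
  induction n with
  | zero => simp [totalWeight_eq]
  | succ n ih =>
    have h1 := totalWeight_succ_right (K := K) (k := k) (n := n)
    have h2 := totalWeight_succ_right (K := K) (k := k + 1) (n := n)
    have : (n : K) + 1 ≠ 0 := Nat.cast_add_one_ne_zero n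
    rw [← mul_right_inj' this]
    push_cast at *
    linear_combination (k + 1 / 2 : K) * h2 + (k + n + 1 + 1 / 2 : K) * ih - (k + (n + 1) + 1 / 2 : K) * h1

lemma totalWeight_pos (k n : ℕ) : 0 < totalWeight ℝ k n := by
  rw [totalWeight_eq]
  exact Finset.prod_pos fun l _ => by positivity

open PowerSeries in
lemma mk_indicator {A : Type*} [CommRing A] (i : ℕ) :
    (mk fun a => if a = i then (1 : A) else 0) = X ^ i := by
  ext a
  simp [coeff_X_pow]

open PowerSeries in
/-- The mean of the number of paths with `i` inner vertices: such a path has generating function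
`X ^ i`, and the `k` other ones are unrestricted. -/
lemma chainSum_pathCount (i : ℕ) :
    chainSum (k + 1) (n + i) (fun x => (pathCount x i : K)) =
      2 ^ (n + i) * (n + i).factorial * ((k + 1) * totalWeight K k n) := by
  have h1 : ∀ l : Fin (k + 1), chainSum (k + 1) (n + i) (fun x => if x (Sum.inl l) = i then (1 : K) else 0)
      = 2 ^ (n + i) * (n + i).factorial * totalWeight K k n := by
    intro l
    have h2 := chainSum_prod (K := K) (n := n + i)
      (fun l' a => if l' = l then (if a = i then 1 else 0) else 1) (fun _ => 1)
    have h3 : ∀ x : Fin (k + 1) ⊕ ℕ → ℕ, (∏ l', if l' = l then (if x (Sum.inl l') = i then (1 : K) else 0) else 1)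
        = if x (Sum.inl l) = i then (1 : K) else 0 := by
      intro x
      rw [Finset.prod_ite_eq']
      simp
    simp only [h3, mul_one] at h2
    rw [h2, ← Finset.mul_prod_erase _ _ (Finset.mem_univ l),
      Finset.prod_congr (g := fun _ => mk fun _ => (1 : K)) rfl fun l' hl' => by
        simp [Finset.ne_of_mem_erase hl'],
      Finset.prod_const, Finset.card_erase_of_mem (Finset.mem_univ l)]
    simp only [if_true, mk_indicator, Finset.card_univ, Fintype.card_fin, Nat.add_sub_cancel]
    rw [mul_assoc (X ^ i), mul_comm (X ^ i), coeff_mul_X_pow]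
    rfl
  simp only [pathCount, Finset.card_filter, Nat.cast_sum, Nat.cast_ite, Nat.cast_one, Nat.cast_zero]
  rw [chainSum_sum, Finset.sum_congr rfl fun l _ => h1 l]
  simp
  ring

open PowerSeries in
/-- The second factorial moment of the number of paths with `i` inner vertices, from the ordered
pairs of such paths. -/
lemma chainSum_pathCount_sq (i : ℕ) :
    chainSum (k + 2) (n + i + i) (fun x => (pathCount x i : K) * (pathCount x i - 1)) =
      2 ^ (n + i + i) * (n + i + i).factorial * ((k + 2) * (k + 1) * totalWeight K k n) := by
  have h1 : ∀ l l₂ : Fin (k + 2), l₂ ≠ l →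
      chainSum (k + 2) (n + i + i) (fun x => (if x (Sum.inl l) = i then (1 : K) else 0) * if x (Sum.inl l₂) = i then (1 : K) else 0)
      = 2 ^ (n + i + i) * (n + i + i).factorial * totalWeight K k n := by
    intro l l₂ hl
    have h2 := chainSum_prod (K := K) (n := n + i + i)
      (fun l' a => (if l' = l then (if a = i then 1 else 0) else 1) * (if l' = l₂ then (if a = i then 1 else 0) else 1))
      (fun _ => 1)
    have h3 : ∀ x : Fin (k + 2) ⊕ ℕ → ℕ, (∏ l', (if l' = l then (if x (Sum.inl l') = i then (1 : K) else 0) else 1)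
        * (if l' = l₂ then (if x (Sum.inl l') = i then 1 else 0) else 1))
        = (if x (Sum.inl l) = i then (1 : K) else 0) * if x (Sum.inl l₂) = i then (1 : K) else 0 := by
      intro x
      rw [Finset.prod_mul_distrib, Finset.prod_ite_eq', Finset.prod_ite_eq']
      simp
    have hm : l₂ ∈ Finset.univ.erase l := by simp [hl]
    simp only [h3, mul_one] at h2
    rw [h2, ← Finset.mul_prod_erase _ _ (Finset.mem_univ l), ← Finset.mul_prod_erase _ _ hm,
      Finset.prod_congr (g := fun _ => mk fun _ => (1 : K)) rfl fun l' hl' => by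
        have h4 := Finset.ne_of_mem_erase hl'
        have h5 := Finset.ne_of_mem_erase (Finset.mem_of_mem_erase hl')
        simp [h4, h5],
      Finset.prod_const, Finset.card_erase_of_mem hm, Finset.card_erase_of_mem (Finset.mem_univ l)]
    simp only [if_true, hl, hl.symm, if_false, mul_one, one_mul, mk_indicator, Finset.card_univ, Fintype.card_fin]
    rw [show k + 2 - 1 - 1 = k by omega, mul_assoc (X ^ i), mul_assoc (X ^ i), mul_comm (X ^ i), coeff_mul_X_pow,
      mul_comm (X ^ i), coeff_mul_X_pow]
    rfl
  have h6 : ∀ x : Fin (k + 2) ⊕ ℕ → ℕ, (pathCount x i : K) * (pathCount x i - 1) =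
      ∑ l, ∑ l₂ ∈ Finset.univ.erase l,
        (if x (Sum.inl l) = i then (1 : K) else 0) * if x (Sum.inl l₂) = i then (1 : K) else 0 := by
    intro x
    have h7 : (pathCount x i : K) = ∑ l, if x (Sum.inl l) = i then (1 : K) else 0 := by
      rw [pathCount, Finset.card_filter]
      push_cast
      rfl
    have h8 : ∀ l, (∑ l₂ ∈ Finset.univ.erase l,
        (if x (Sum.inl l) = i then (1 : K) else 0) * if x (Sum.inl l₂) = i then (1 : K) else 0) =
        (if x (Sum.inl l) = i then (1 : K) else 0) * (pathCount x i - 1) := by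
      intro l
      rw [← Finset.mul_sum, Finset.sum_erase_eq_sub (Finset.mem_univ l), ← h7]
      split_ifs <;> simp
    rw [Finset.sum_congr rfl fun l _ => h8 l, ← Finset.sum_mul, ← h7]
  simp only [h6]
  rw [chainSum_sum]
  rw [Finset.sum_congr rfl fun l _ => (chainSum_sum _ _).trans
    (Finset.sum_congr rfl fun l₂ hl₂ => h1 l l₂ (Finset.ne_of_mem_erase hl₂))]
  simp only [Finset.sum_const, Finset.card_erase_of_mem (Finset.mem_univ _), Finset.card_univ,
    Fintype.card_fin, nsmul_eq_mul]
  rw [show k + 2 - 1 = k + 1 by omega]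
  push_cast
  ring

/-- The second moment of the number of vertices on cycles. -/
lemma chainSum_cycleVertices_sq :
    chainSum k n (fun x => ((cycleVertices n x : K) + 1 / 2) * (cycleVertices n x + 3 / 2)) =
      3 / 4 * ∏ l ∈ Finset.range n, (2 * ((k : K) + l) + 5) := by
  rw [chainSum_eq_prod
    (F := fun n x => ((cycleVertices n x : K) + 1 / 2) * (cycleVertices n x + 3 / 2))
    (fun l => 2 * ((k : K) + l) + 5)]
  · simp [cycleVertices]
    norm_num
  · intro n x hx
    have h := hx.cast_sum (R := K)
    have h1 : (cycleVertices n x : K) = ∑ i ∈ Finset.range n, (x (Sum.inr i) : K) := by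
      simp [cycleVertices]
    rw [← h1] at h
    rw [Finset.sum_congr (s₁ := Finset.range n) rfl fun i hi => by
      rw [hx.cycleVertices_add_inr hi]]
    simp only [hx.cycleVertices_add_inr_self, hx.cycleVertices_add_inl, ← Finset.sum_mul,
      ← Finset.mul_sum, ← h1, Finset.sum_add_distrib, Finset.sum_const, Finset.card_univ,
      Fintype.card_fin, nsmul_eq_mul, mul_one]
    push_cast
    linear_combination 2 * ((cycleVertices n x : K) + 1 / 2) * (cycleVertices n x + 3 / 2) * h

/-- Adding a vertex changes the number of loops: either the vertex is a new loop, or it is inserted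
in a loop, or neither. -/
lemma IsState.sum_loops {x : Fin k ⊕ ℕ → ℕ} (hx : IsState n x) (φ : ℕ → K) :
    φ (cycleCount (n + 1) (x + Pi.single (Sum.inr n) 1) 1)
      + ∑ l : Fin k, 2 * ((x (Sum.inl l) : K) + 1) *
          φ (cycleCount (n + 1) (x + Pi.single (Sum.inl l) 1) 1)
      + ∑ i ∈ Finset.range n, 2 * (x (Sum.inr i) : K) *
          φ (cycleCount (n + 1) (x + Pi.single (Sum.inr i) 1) 1) =
    φ (cycleCount n x 1 + 1) + 2 * ((k : K) + n - cycleCount n x 1) * φ (cycleCount n x 1)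
      + 2 * cycleCount n x 1 * φ (cycleCount n x 1 - 1) := by
  have hn := hx.1 n le_rfl
  have h1 : cycleCount (n + 1) (x + Pi.single (Sum.inr n) 1) 1 = cycleCount n x 1 + 1 := by
    rw [cycleCount, Finset.range_add_one, Finset.filter_insert]
    rw [if_pos (by simp [hn]), Finset.card_insert_of_notMem (by simp), cycleCount]
    congr 2
    refine Finset.filter_congr fun i hi => ?_
    have := Finset.mem_range.1 hi
    simp [show i ≠ n by omega]
  have h2 : ∀ l, cycleCount (n + 1) (x + Pi.single (Sum.inl l) 1) 1 = cycleCount n x 1 := by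
    intro l
    rw [cycleCount, Finset.range_add_one, Finset.filter_insert, if_neg (by simp [hn]), cycleCount]
    simp
  have h3 : ∀ i ∈ Finset.range n, 2 * (x (Sum.inr i) : K) *
      φ (cycleCount (n + 1) (x + Pi.single (Sum.inr i) 1) 1) =
      2 * x (Sum.inr i) * φ (cycleCount n x 1) + (if x (Sum.inr i) = 1 then (1 : K) else 0) *
        (2 * φ (cycleCount n x 1 - 1) - 2 * φ (cycleCount n x 1)) := by
    intro i hi
    have hin := Finset.mem_range.1 hi
    have h4 : cycleCount (n + 1) (x + Pi.single (Sum.inr i) 1) 1 =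
        (((Finset.range n).filter fun i => x (Sum.inr i) = 1).erase i).card
          + if x (Sum.inr i) = 0 then 1 else 0 := by
      rw [cycleCount, Finset.range_add_one, Finset.filter_insert,
        if_neg (by simp [hn, show n ≠ i by omega])]
      split_ifs with h0
      · rw [Finset.erase_eq_of_notMem (by simp [h0]), ← Finset.card_insert_of_notMem (a := i) (by simp [h0])]
        congr 1
        ext j
        by_cases hj : j = i
        · simp [hj, h0, hin]
        · simp [hj]
      · rw [add_zero]
        congr 1
        ext j
        by_cases hj : j = i
        · simp [hj, h0]
        · simp [hj]
    rw [h4]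
    by_cases h0 : x (Sum.inr i) = 0
    · simp [h0]
    by_cases h5 : x (Sum.inr i) = 1
    · rw [Finset.card_erase_of_mem (by simp [h5, hin]), ← cycleCount]
      simp [h5]
    · rw [Finset.erase_eq_of_notMem (by simp [h5]), ← cycleCount]
      simp [h0, h5]
  have h4 : (cycleCount n x 1 : K) = ∑ i ∈ Finset.range n, if x (Sum.inr i) = 1 then (1 : K) else 0 := by
    rw [cycleCount, Finset.card_filter]
    push_cast
    rfl
  have h := hx.cast_sum (R := K)
  rw [Finset.sum_congr rfl h3]
  simp only [h1, h2, Finset.sum_add_distrib, ← Finset.sum_mul, ← Finset.mul_sum, ← h4,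
    Finset.sum_const, Finset.card_univ, Fintype.card_fin, nsmul_eq_mul, mul_one]
  linear_combination 2 * φ (cycleCount n x 1) * h

/-- The factorial moments of the number of loops. -/
lemma chainSum_loops (r : ℕ) :
    chainSum k n (fun x => ((cycleCount n x 1).descFactorial r : K)) *
        ∏ l ∈ Finset.range r, (2 * ((k : K) + n) - 1 - 2 * l) =
      chainSum k n (fun _ => (1 : K)) * n.descFactorial r := by
  induction n generalizing r with
  | zero =>
    rcases r with _ | r
    · simp
    · simp [chainSum, cycleCount]
  | succ n ih =>
    rcases r with _ | r
    · simp
    have hstep : chainSum k (n + 1) (fun x => ((cycleCount (n + 1) x 1).descFactorial (r + 1) : K)) =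
        (2 * ((k : K) + n) + 1 - 2 * (r + 1)) *
          chainSum k n (fun x => ((cycleCount n x 1).descFactorial (r + 1) : K)) +
        (r + 1) * chainSum k n (fun x => ((cycleCount n x 1).descFactorial r : K)) := by
      rw [chainSum, chainSum_congr fun x hx => hx.sum_loops fun a => (a.descFactorial (r + 1) : K),
        ← chainSum_const_mul, ← chainSum_const_mul, ← chainSum_add]
      congr 1
      ext x
      generalize cycleCount n x 1 = L
      have h1 : ((L + 1).descFactorial (r + 1) : K) =
          L.descFactorial (r + 1) + (r + 1) * L.descFactorial r := by
        rw [Nat.succ_descFactorial_succ, Nat.descFactorial_succ]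
        push_cast
        rcases le_or_gt r L with h | h
        · push_cast [Nat.cast_sub h]
          ring
        · simp [Nat.descFactorial_of_lt h]
      have h2 : (L : K) * ((L - 1).descFactorial (r + 1) : K) =
          (L - (r + 1)) * L.descFactorial (r + 1) := by
        rcases L with _ | L
        · simp
        · rw [Nat.succ_descFactorial_succ, Nat.add_sub_cancel, Nat.descFactorial_succ]
          push_cast
          rcases le_or_gt r L with h | h
          · push_cast [Nat.cast_sub h]
            ring
          · simp [Nat.descFactorial_of_lt h]
      rw [h1]
      linear_combination 2 * h2
    have hone : chainSum k (n + 1) (fun _ => (1 : K)) =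
        chainSum k n (fun _ => (1 : K)) * (2 * ((k : K) + n) + 1) := by
      rw [chainSum_one, chainSum_one, Finset.prod_range_succ]
    have hD : ∏ l ∈ Finset.range (r + 1), (2 * ((k : K) + (n + 1 : ℕ)) - 1 - 2 * l) =
        (2 * ((k : K) + n) + 1) * ∏ l ∈ Finset.range r, (2 * ((k : K) + n) - 1 - 2 * l) := by
      rw [Finset.prod_range_succ', mul_comm]
      congr 1
      · push_cast; ring
      · refine Finset.prod_congr rfl fun l _ => ?_
        push_cast; ring
    have hd : ((n + 1).descFactorial (r + 1) : K) =
        n.descFactorial (r + 1) + (r + 1) * n.descFactorial r := by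
      rw [Nat.succ_descFactorial_succ, Nat.descFactorial_succ]
      push_cast
      rcases le_or_gt r n with h | h
      · push_cast [Nat.cast_sub h]
        ring
      · simp [Nat.descFactorial_of_lt h]
    have ih1 := ih (r + 1)
    have ih2 := ih r
    rw [Finset.prod_range_succ] at ih1
    rw [hstep, hone, hD, hd]
    linear_combination (2 * ((k : K) + n) + 1) * ih1 + (r + 1) * (2 * ((k : K) + n) + 1) * ih2

end Moments

/-! ### Asymptotics of the moments -/

section Order

variable {k n : ℕ}

lemma chainSum_mono {F G : (Fin k ⊕ ℕ → ℕ) → ℝ} (h : ∀ x, IsState n x → F x ≤ G x) :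
    chainSum k n F ≤ chainSum k n G := by
  induction n generalizing F G with
  | zero => exact h 0 ⟨by simp, by simp⟩
  | succ n ih =>
    refine ih fun x hx => ?_
    gcongr with l _ i hi
    · exact h _ hx.add_inr_self
    · exact h _ (hx.add_inl l)
    · exact h _ (hx.add_inr (Finset.mem_range.1 hi))

lemma norm_chainSum_le (F : (Fin k ⊕ ℕ → ℕ) → ℂ) :
    ‖chainSum k n F‖ ≤ chainSum k n fun x => ‖F x‖ := by
  induction n generalizing F with
  | zero => exact le_rfl
  | succ n ih =>
    refine (ih _).trans (chainSum_mono fun x _ => ?_)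
    refine (norm_add₃_le).trans ?_
    gcongr
    · refine (norm_sum_le _ _).trans (Finset.sum_le_sum fun l _ => ?_)
      rw [norm_mul, norm_mul]
      norm_cast
    · refine (norm_sum_le _ _).trans (Finset.sum_le_sum fun l _ => ?_)
      simp

lemma chainSum_one_pos : 0 < chainSum k n fun _ => (1 : ℝ) := by
  rw [chainSum_one]
  exact Finset.prod_pos fun l _ => by positivity

lemma chainMean_mono {F G : (Fin k ⊕ ℕ → ℕ) → ℝ} (h : ∀ x, IsState n x → F x ≤ G x) :
    chainMean k n F ≤ chainMean k n G :=
  div_le_div_of_nonneg_right (chainSum_mono h) chainSum_one_pos.le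

lemma chainMean_const {K : Type} [Field K] [CharZero K] (a : K) : chainMean k n (fun _ => a) = a := by
  have : (fun _ : Fin k ⊕ ℕ → ℕ => a) = fun _ => a * 1 := by simp
  rw [chainMean, this, chainSum_const_mul, mul_div_cancel_right₀ _ (chainSum_one_ne_zero k n)]

lemma chainMean_nonneg {F : (Fin k ⊕ ℕ → ℕ) → ℝ} (h : ∀ x, IsState n x → 0 ≤ F x) :
    0 ≤ chainMean k n F := by
  rw [← chainMean_const (k := k) (n := n) (0 : ℝ)]
  exact chainMean_mono h

lemma chainMean_congr {K : Type} [Field K] {F G : (Fin k ⊕ ℕ → ℕ) → K}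
    (h : ∀ x, IsState n x → F x = G x) : chainMean k n F = chainMean k n G := by
  rw [chainMean, chainSum_congr h, chainMean]

lemma chainMean_add {K : Type} [Field K] (F G : (Fin k ⊕ ℕ → ℕ) → K) :
    chainMean k n (fun x => F x + G x) = chainMean k n F + chainMean k n G := by
  rw [chainMean, chainSum_add, add_div, chainMean, chainMean]

lemma chainMean_const_mul {K : Type} [Field K] (a : K) (F : (Fin k ⊕ ℕ → ℕ) → K) :
    chainMean k n (fun x => a * F x) = a * chainMean k n F := by
  rw [chainMean, chainSum_const_mul, mul_div_assoc, chainMean]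

lemma chainMean_sub {K : Type} [Field K] (F G : (Fin k ⊕ ℕ → ℕ) → K) :
    chainMean k n (fun x => F x - G x) = chainMean k n F - chainMean k n G := by
  have : (fun x => F x - G x) = fun x => F x + (-1) * G x := by ext; ring
  rw [this, chainMean_add, chainMean_const_mul]
  ring

lemma map_chainSum {R S : Type} [CommRing R] [CommRing S] (φ : R →+* S)
    (F : (Fin k ⊕ ℕ → ℕ) → R) : φ (chainSum k n F) = chainSum k n fun x => φ (F x) := by
  induction n generalizing F with
  | zero => rfl
  | succ n ih =>
    have h2 : φ 2 = 2 := map_ofNat φ 2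
    rw [chainSum, chainSum, ih]
    simp [h2]

lemma chainMean_ofReal (F : (Fin k ⊕ ℕ → ℕ) → ℝ) :
    ((chainMean k n F : ℝ) : ℂ) = chainMean k n fun x => (F x : ℂ) := by
  have h := map_chainSum (k := k) (n := n) Complex.ofRealHom
  simp only [Complex.ofRealHom_eq_coe] at h
  rw [chainMean, Complex.ofReal_div, h, h, chainMean, Complex.ofReal_one]

lemma norm_chainMean_le (F : (Fin k ⊕ ℕ → ℕ) → ℂ) :
    ‖chainMean k n F‖ ≤ chainMean k n fun x => ‖F x‖ := by
  have h : ‖chainSum k n fun _ => (1 : ℂ)‖ = chainSum k n fun _ => (1 : ℝ) := by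
    rw [chainSum_one, chainSum_one, norm_prod]
    refine Finset.prod_congr rfl fun l _ => ?_
    norm_cast
  rw [chainMean, norm_div, h]
  exact div_le_div_of_nonneg_right (norm_chainSum_le F) chainSum_one_pos.le

end Order

section Asymptotics

/-- `f k` equals the constant `c` up to an error of order `1 / k`. -/
def EqUpToInv (f : ℕ → ℝ) (c : ℝ) : Prop := (fun k => f k - c) =O[atTop] fun k => (k : ℝ)⁻¹

lemma EqUpToInv.congr' {f g : ℕ → ℝ} {c : ℝ} (hf : EqUpToInv f c) (h : f =ᶠ[atTop] g) :
    EqUpToInv g c :=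
  IsBigO.congr' hf (h.mono fun k hk => by simp only [hk]) .rfl

lemma inv_isBigO_one : (fun k : ℕ => (k : ℝ)⁻¹) =O[atTop] fun _ => (1 : ℝ) :=
  (tendsto_inv_atTop_nhds_zero_nat (𝕜 := ℝ)).isBigO_one ℝ

lemma EqUpToInv.tendsto {f : ℕ → ℝ} {c : ℝ} (hf : EqUpToInv f c) : Tendsto f atTop (𝓝 c) := by
  have := hf.trans_tendsto (tendsto_inv_atTop_nhds_zero_nat (𝕜 := ℝ))
  simpa using this.add_const c

lemma EqUpToInv.mul {f g : ℕ → ℝ} {c d : ℝ} (hf : EqUpToInv f c) (hg : EqUpToInv g d) :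
    EqUpToInv (fun k => f k * g k) (c * d) := by
  have h1 : (fun k => (f k - c) * g k) =O[atTop] fun k => (k : ℝ)⁻¹ * 1 :=
    IsBigO.mul hf (hg.tendsto.isBigO_one ℝ)
  have h2 : (fun k => c * (g k - d)) =O[atTop] fun k => (k : ℝ)⁻¹ := IsBigO.const_mul_left hg c
  simp only [mul_one] at h1
  exact (h1.add h2).congr_left fun k => by ring

lemma isEquivalent_of_sub_isBigO {v : ℕ → ℝ} {b : ℝ} (hb : 0 < b)
    (hv : (fun k => v k - b * k) =O[atTop] fun _ => (1 : ℝ)) :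
    v ~[atTop] fun k : ℕ => b * (k : ℝ) := by
  have hk : Tendsto (fun k : ℕ => (k : ℝ)) atTop atTop := tendsto_natCast_atTop_atTop
  have h0 : (fun _ : ℕ => (1 : ℝ)) =o[atTop] fun k : ℕ => (k : ℝ) :=
    isLittleO_const_left.2 (.inr (tendsto_norm_atTop_atTop.comp hk))
  exact (hv.trans_isLittleO h0).const_mul_right hb.ne'

lemma tendsto_atTop_of_sub_isBigO {b : ℝ} (hb : 0 < b) {N : ℕ → ℕ}
    (hN : (fun k => (N k : ℝ) - b * k) =O[atTop] fun _ => (1 : ℝ)) : Tendsto N atTop atTop :=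
  tendsto_natCast_atTop_iff.1 ((isEquivalent_of_sub_isBigO hb hN).symm.tendsto_atTop
    (tendsto_natCast_atTop_atTop.const_mul_atTop hb))

/-- A quotient of two sequences of linear growth. -/
lemma eqUpToInv_div {u v : ℕ → ℝ} {a b : ℝ} (hb : 0 < b)
    (hu : (fun k => u k - a * k) =O[atTop] fun _ => (1 : ℝ))
    (hv : (fun k => v k - b * k) =O[atTop] fun _ => (1 : ℝ)) :
    EqUpToInv (fun k => u k / v k) (a / b) := by
  have hk : Tendsto (fun k : ℕ => (k : ℝ)) atTop atTop := tendsto_natCast_atTop_atTop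
  have hv2 := isEquivalent_of_sub_isBigO hb hv
  have hvO : (fun k => (v k)⁻¹) =O[atTop] fun k : ℕ => (k : ℝ)⁻¹ := by
    refine hv2.inv.isBigO.trans ?_
    have : (fun k : ℕ => b * (k : ℝ))⁻¹ = fun k : ℕ => b⁻¹ * (k : ℝ)⁻¹ := by
      ext k
      simp [mul_comm]
    rw [this]
    exact (isBigO_refl _ _).const_mul_left _
  have hne : ∀ᶠ k in atTop, v k ≠ 0 := by
    have : Tendsto v atTop atTop := hv2.symm.tendsto_atTop (hk.const_mul_atTop hb)
    filter_upwards [this.eventually_gt_atTop 0] with k hk using hk.ne'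
  have h1 : (fun k => ((u k - a * k) - a / b * (v k - b * k)) * (v k)⁻¹) =O[atTop]
      fun k : ℕ => 1 * (k : ℝ)⁻¹ := (hu.sub (hv.const_mul_left _)).mul hvO
  simp only [one_mul] at h1
  refine h1.congr' ?_ .rfl
  filter_upwards [hne] with k hk
  field_simp
  ring

/-- The ratio of total weights when one path with `i` vertices of degree `2` is removed. -/
lemma eqUpToInv_totalWeight {α : ℝ} (hα : 0 < α) {K N : ℕ → ℕ}
    (hK : (fun k => (K k : ℝ) - k) =O[atTop] fun _ => (1 : ℝ))
    (hN : (fun k => (N k : ℝ) - α * k) =O[atTop] fun _ => (1 : ℝ)) (i : ℕ) :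
    EqUpToInv (fun k => totalWeight ℝ (K k) (N k) / totalWeight ℝ (K k + 1) (N k + i))
      (α ^ i / (1 + α) ^ (i + 1)) := by
  have hc : ∀ c : ℝ, (fun _ : ℕ => c) =O[atTop] fun _ => (1 : ℝ) := fun c =>
    isBigO_const_const _ one_ne_zero _
  have hv : ∀ c : ℝ, (fun k => ((K k : ℝ) + N k + c) - (1 + α) * k) =O[atTop] fun _ => (1 : ℝ) :=
    fun c => ((hK.add hN).add (hc c)).congr_left fun k => by ring
  have h1 : (0 : ℝ) < 1 + α := by linarith
  induction i with
  | zero =>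
    have h5 := eqUpToInv_div h1 (u := fun k => (K k : ℝ) + 1 / 2) (a := 1)
      ((hK.add (hc (1 / 2))).congr_left fun k => by ring) (hv (1 / 2))
    rw [pow_zero, zero_add, pow_one]
    refine h5.congr' (.of_forall fun k => ?_)
    have h2 := totalWeight_succ_left (K := ℝ) (k := K k) (n := N k)
    have h3 := totalWeight_pos (K k + 1) (N k)
    have h4 : (0 : ℝ) < K k + N k + 1 / 2 := by positivity
    beta_reduce
    rw [add_zero, div_eq_div_iff h4.ne' h3.ne']
    linarith
  | succ i ih =>
    have h2 := ih.mul (eqUpToInv_div h1 (u := fun k => (N k : ℝ) + (i + 1)) (a := α)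
      ((hN.add (hc (i + 1))).congr_left fun k => by ring) (hv (i + 3 / 2)))
    rw [div_mul_div_comm, ← pow_succ, ← pow_succ] at h2
    refine h2.congr' (.of_forall fun k => ?_)
    have h3 := totalWeight_succ_right (K := ℝ) (k := K k + 1) (n := N k + i)
    have h4 := totalWeight_pos (K k + 1) (N k + i)
    have h5 := totalWeight_pos (K k + 1) (N k + (i + 1))
    have h6 : (0 : ℝ) < K k + N k + (i + 3 / 2) := by positivity
    beta_reduce
    rw [← add_assoc (N k)] at h5
    change _ = _ / totalWeight ℝ (K k + 1) (N k + i + 1)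
    rw [div_mul_div_comm, div_eq_div_iff (by positivity) h5.ne']
    push_cast at h3
    linear_combination totalWeight ℝ (K k) (N k) * h3

variable {α : ℝ} {N : ℕ → ℕ}

/-- The mean number of paths with `i` vertices of degree `2`. -/
lemma eqUpToInv_mean_pathCount (hα : 0 < α)
    (hN : (fun k => (N k : ℝ) - α * k) =O[atTop] fun _ => (1 : ℝ)) (i : ℕ) :
    EqUpToInv (fun k => chainMean k (N k) (fun x => (pathCount x i : ℝ)) / k)
      (α ^ i / (1 + α) ^ (i + 1)) := by
  have hc : ∀ c : ℝ, (fun _ : ℕ => c) =O[atTop] fun _ => (1 : ℝ) := fun c =>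
    isBigO_const_const _ one_ne_zero _
  have hNt := tendsto_atTop_of_sub_isBigO hα hN
  have h1 : (fun k => ((k - 1 : ℕ) : ℝ) - k) =O[atTop] fun _ => (1 : ℝ) := by
    refine (hc (-1)).congr' ?_ .rfl
    filter_upwards [eventually_ge_atTop 1] with k hk
    push_cast [Nat.cast_sub hk]
    ring
  have h2 : (fun k => ((N k - i : ℕ) : ℝ) - α * k) =O[atTop] fun _ => (1 : ℝ) := by
    refine (hN.add (hc (-i))).congr' ?_ .rfl
    filter_upwards [hNt.eventually_ge_atTop i] with k hk
    push_cast [Nat.cast_sub hk]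
    ring
  refine (eqUpToInv_totalWeight hα h1 h2 i).congr' ?_
  filter_upwards [eventually_ge_atTop 1, hNt.eventually_ge_atTop i] with k hk hk2
  obtain ⟨k', rfl⟩ := Nat.exists_eq_add_of_le' hk
  obtain ⟨n, hn⟩ := Nat.exists_eq_add_of_le' hk2
  rw [hn, chainMean, chainSum_pathCount, chainSum_one_eq]
  simp only [Nat.add_sub_cancel]
  have h3 : ((n + i).factorial : ℝ) ≠ 0 := by exact_mod_cast Nat.factorial_ne_zero _
  have h4 := (totalWeight_pos (k' + 1) (n + i)).ne'
  have h5 : ((k' + 1 : ℕ) : ℝ) ≠ 0 := by positivity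
  push_cast at h5 ⊢
  field_simp

/-- The second factorial moment of the number of paths with `i` vertices of degree `2`. -/
lemma eqUpToInv_mean_pathCount_sq (hα : 0 < α)
    (hN : (fun k => (N k : ℝ) - α * k) =O[atTop] fun _ => (1 : ℝ)) (i : ℕ) :
    EqUpToInv (fun k => chainMean k (N k) (fun x => (pathCount x i : ℝ) * (pathCount x i - 1)) /
      (k * (k - 1))) ((α ^ i / (1 + α) ^ (i + 1)) ^ 2) := by
  have hc : ∀ c : ℝ, (fun _ : ℕ => c) =O[atTop] fun _ => (1 : ℝ) := fun c =>
    isBigO_const_const _ one_ne_zero _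
  have hNt := tendsto_atTop_of_sub_isBigO hα hN
  have h1 : ∀ a : ℕ, (fun k => ((k - a : ℕ) : ℝ) - k) =O[atTop] fun _ => (1 : ℝ) := by
    intro a
    refine (hc (-a)).congr' ?_ .rfl
    filter_upwards [eventually_ge_atTop a] with k hk
    push_cast [Nat.cast_sub hk]
    ring
  have h2 : ∀ a : ℕ, (fun k => ((N k - a : ℕ) : ℝ) - α * k) =O[atTop] fun _ => (1 : ℝ) := by
    intro a
    refine (hN.add (hc (-a))).congr' ?_ .rfl
    filter_upwards [hNt.eventually_ge_atTop a] with k hk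
    push_cast [Nat.cast_sub hk]
    ring
  rw [sq]
  refine ((eqUpToInv_totalWeight hα (h1 1) (h2 i) i).mul
    (eqUpToInv_totalWeight hα (h1 2) (h2 (i + i)) i)).congr' ?_
  filter_upwards [eventually_ge_atTop 2, hNt.eventually_ge_atTop (i + i)] with k hk hk2
  obtain ⟨k', rfl⟩ := Nat.exists_eq_add_of_le' hk
  obtain ⟨n, hn⟩ := Nat.exists_eq_add_of_le' hk2
  have hn' : N (k' + 2) = n + i + i := by omega
  rw [hn', chainMean, chainSum_pathCount_sq, chainSum_one_eq]
  have h3 : ((n + i + i).factorial : ℝ) ≠ 0 := by exact_mod_cast Nat.factorial_ne_zero _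
  have h4 := (totalWeight_pos (k' + 2) (n + i + i)).ne'
  have h5 : ((k' + 1 : ℕ) : ℝ) ≠ 0 := by positivity
  have h6 := (totalWeight_pos (k' + 1) (n + i)).ne'
  have h7 : ((k' + 2 : ℕ) : ℝ) ≠ 0 := by positivity
  rw [show n + i + i - i = n + i by omega, show n + i + i - (i + i) = n by omega,
    show k' + 2 - 1 = k' + 1 by omega, show k' + 2 - 2 = k' by omega]
  push_cast at h5 h7 ⊢
  have h8 : (k' : ℝ) + 2 - 1 ≠ 0 := by
    have : (k' : ℝ) + 2 - 1 = k' + 1 := by ring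
    rwa [this]
  rw [show k' + 1 + 1 = k' + 2 by omega]
  field_simp
  ring

/-- The mean square distance of the number of paths with `i` vertices of degree `2` from the
asymptotic mean. -/
lemma isBigO_mean_sq_pathCount (hα : 0 < α)
    (hN : (fun k => (N k : ℝ) - α * k) =O[atTop] fun _ => (1 : ℝ)) (i : ℕ) :
    (fun k : ℕ => chainMean k (N k) fun x => ((pathCount x i : ℝ) - α ^ i / (1 + α) ^ (i + 1) * k) ^ 2)
      =O[atTop] fun k => (k : ℝ) := by
  have h1 := eqUpToInv_mean_pathCount hα hN i
  have h2 := eqUpToInv_mean_pathCount_sq hα hN i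
  generalize α ^ i / (1 + α) ^ (i + 1) = p at h1 h2 ⊢
  rw [EqUpToInv] at h1 h2
  have hk1 : (fun k : ℕ => (k : ℝ) ^ 2) =O[atTop] fun k => (k : ℝ) ^ 2 := isBigO_refl _ _
  have hkk : (fun k : ℕ => (k : ℝ)) =O[atTop] fun k => (k : ℝ) := isBigO_refl _ _
  have hk2 : (fun k : ℕ => (k : ℝ) * (k - 1)) =O[atTop] fun k => (k : ℝ) ^ 2 := by
    refine IsBigO.of_bound 1 (.of_forall fun k => ?_)
    rcases k with _ | k
    · simp
    · push_cast
      rw [one_mul, add_sub_cancel_right, Real.norm_of_nonneg (by positivity),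
        Real.norm_of_nonneg (by positivity)]
      nlinarith [(Nat.cast_nonneg k : (0 : ℝ) ≤ k)]
  have e1 := hk2.mul h2
  have e2 := hk1.mul (h1.const_mul_left (2 * p))
  have e3 := hkk.mul (h1.trans inv_isBigO_one)
  have h3 : ∀ᶠ k : ℕ in atTop, (k : ℝ) ^ 2 * (k : ℝ)⁻¹ = k := by
    filter_upwards [eventually_ge_atTop 1] with k hk
    have : (k : ℝ) ≠ 0 := by positivity
    field_simp
  have e1' := e1.congr' .rfl h3
  have e2' := e2.congr' .rfl h3
  simp only [mul_one] at e3
  have e4 := hkk.const_mul_left (p - p ^ 2)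
  refine (((e1'.sub e2').add e3).add e4).congr' ?_ .rfl
  filter_upwards [eventually_ge_atTop 2] with k hk
  have hk0 : (k : ℝ) ≠ 0 := by positivity
  have hk1 : (k : ℝ) - 1 ≠ 0 := by
    have : (2 : ℝ) ≤ k := by exact_mod_cast hk
    linarith
  have h5 : (chainMean k (N k) fun x => ((pathCount x i : ℝ) - p * k) ^ 2) =
      chainMean k (N k) (fun x => (pathCount x i : ℝ) * (pathCount x i - 1)) +
        (1 - 2 * p * k) * chainMean k (N k) (fun x => (pathCount x i : ℝ)) + p ^ 2 * k ^ 2 := by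
    rw [← chainMean_const_mul, ← chainMean_add, ← chainMean_const (k := k) (n := N k) (p ^ 2 * (k : ℝ) ^ 2),
      ← chainMean_add]
    congr 1
    ext x
    ring
  rw [h5]
  field_simp
  ring

/-- The second moment of the number of vertices on cycles is bounded. -/
lemma isBigO_mean_cycleVertices
    (hN : (fun k => (N k : ℝ) - α * k) =O[atTop] fun _ => (1 : ℝ)) :
    (fun k : ℕ => chainMean k (N k) fun x => ((cycleVertices (N k) x : ℝ) + 1 / 2) *
      (cycleVertices (N k) x + 3 / 2)) =O[atTop] fun _ => (1 : ℝ) := by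
  have hc : ∀ c : ℝ, (fun _ : ℕ => c) =O[atTop] fun _ => (1 : ℝ) := fun c =>
    isBigO_const_const _ one_ne_zero _
  have h1 : ∀ k n : ℕ, chainMean k n (fun x => ((cycleVertices n x : ℝ) + 1 / 2) *
      (cycleVertices n x + 3 / 2)) =
      3 / 4 * (((n : ℝ) + (k + 1 / 2)) / (k + 1 / 2)) * (((n : ℝ) + (k + 3 / 2)) / (k + 3 / 2)) := by
    intro k n
    rw [chainMean, chainSum_cycleVertices_sq, chainSum_one, mul_div_assoc, ← Finset.prod_div_distrib,
      mul_assoc]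
    congr 1
    induction n with
    | zero =>
      have h1 : (k : ℝ) + 1 / 2 ≠ 0 := by positivity
      have h2 : (k : ℝ) + 3 / 2 ≠ 0 := by positivity
      rw [Finset.prod_range_zero, Nat.cast_zero, zero_add, zero_add, div_self h1, div_self h2,
        mul_one]
    | succ n ih =>
      rw [Finset.prod_range_succ, ih]
      push_cast
      have h1 : (k : ℝ) + 1 / 2 ≠ 0 := by positivity
      have h2 : (k : ℝ) + 3 / 2 ≠ 0 := by positivity
      have h3 : 2 * ((k : ℝ) + n) + 1 ≠ 0 := by positivity
      field_simp
      ring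
  simp only [h1]
  have h2 : ∀ c : ℝ, (fun k : ℕ => ((N k : ℝ) + (k + c)) / (k + c)) =O[atTop] fun _ => (1 : ℝ) := by
    intro c
    have h3 := eqUpToInv_div (u := fun k => (N k : ℝ) + (k + c)) (v := fun k => (k : ℝ) + c)
      (a := α + 1) one_pos ((hN.add (hc c)).congr_left fun k => by ring)
      ((hc c).congr_left fun k => by ring)
    exact h3.tendsto.isBigO_one ℝ
  have h3 := (((h2 (1 / 2)).const_mul_left (3 / 4)).mul (h2 (3 / 2)))
  simpa using h3

/-- The factorial moments of the number of loops converge to those of a Poisson variable. -/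
lemma tendsto_mean_loops (hα : 0 < α)
    (hN : (fun k => (N k : ℝ) - α * k) =O[atTop] fun _ => (1 : ℝ)) (r : ℕ) :
    Tendsto (fun k : ℕ => chainMean k (N k) fun x => ((cycleCount (N k) x 1).descFactorial r : ℝ)) atTop
      (𝓝 ((1 / 2 * (α / (1 + α))) ^ r)) := by
  have hc : ∀ c : ℝ, (fun _ : ℕ => c) =O[atTop] fun _ => (1 : ℝ) := fun c =>
    isBigO_const_const _ one_ne_zero _
  have hNt := tendsto_atTop_of_sub_isBigO hα hN
  have h1 : ∀ l : ℕ, Tendsto (fun k : ℕ => ((N k : ℝ) - l) / (2 * ((k : ℝ) + N k) - 1 - 2 * l)) atTop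
      (𝓝 (1 / 2 * (α / (1 + α)))) := by
    intro l
    have h2 := eqUpToInv_div (u := fun k => (N k : ℝ) - l) (v := fun k => 2 * ((k : ℝ) + N k) - 1 - 2 * l)
      (a := α) (b := 2 * (1 + α)) (by linarith) ((hN.add (hc (-l))).congr_left fun k => by ring)
      (((hN.const_mul_left 2).add (hc (- 1 - 2 * l))).congr_left fun k => by ring)
    have h3 := h2.tendsto
    have h4 : (0 : ℝ) < 1 + α := by linarith
    rwa [show α / (2 * (1 + α)) = 1 / 2 * (α / (1 + α)) by field_simp] at h3
  have h2 := tendsto_finsetProd (Finset.range r) fun l _ => h1 l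
  rw [Finset.prod_const, Finset.card_range] at h2
  refine h2.congr' ?_
  filter_upwards [eventually_ge_atTop r, hNt.eventually_ge_atTop r] with k hk hk2
  have h3 := chainSum_loops (K := ℝ) (k := k) (n := N k) r
  have h4 : ∏ l ∈ Finset.range r, (2 * ((k : ℝ) + N k) - 1 - 2 * l) ≠ 0 := by
    refine Finset.prod_ne_zero_iff.2 fun l hl => ?_
    have h5 : (l : ℝ) + 1 ≤ k := by exact_mod_cast (Finset.mem_range.1 hl).trans_le hk
    have h6 : (0 : ℝ) ≤ N k := Nat.cast_nonneg _
    have : 0 < 2 * ((k : ℝ) + N k) - 1 - 2 * l := by linarith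
    exact this.ne'
  rw [Finset.prod_div_distrib, chainMean, div_eq_div_iff h4 chainSum_one_pos.ne', h3, mul_comm]
  congr 1
  rw [Nat.descFactorial_eq_prod_range, Nat.cast_prod]
  refine Finset.prod_congr rfl fun l hl => ?_
  rw [Nat.cast_sub]
  exact ((Finset.mem_range.1 hl).le).trans hk2

/-- The factorial moments of the number of loops are at most `1`. -/
lemma mean_loops_le_one {k n : ℕ} (hk : k ≠ 0) (r : ℕ) :
    chainMean k n (fun x => ((cycleCount n x 1).descFactorial r : ℝ)) ≤ 1 := by
  rcases lt_or_ge n r with h | h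
  · rw [chainMean_congr (G := fun _ => 0) fun x _ => by
      rw [Nat.descFactorial_of_lt ((cycleCount_le_time x 1).trans_lt h), Nat.cast_zero], chainMean_const]
    exact zero_le_one
  · have h3 := chainSum_loops (K := ℝ) (k := k) (n := n) r
    have hk1 : (1 : ℝ) ≤ k := by exact_mod_cast Nat.one_le_iff_ne_zero.2 hk
    have h4 : ∀ l ∈ Finset.range r, 0 < (2 * ((k : ℝ) + n) - 1 - 2 * l) ∧
        ((n - l : ℕ) : ℝ) ≤ 2 * ((k : ℝ) + n) - 1 - 2 * l := by
      intro l hl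
      have h5 : (l : ℝ) + 1 ≤ n := by exact_mod_cast (Finset.mem_range.1 hl).trans_le h
      rw [Nat.cast_sub ((Finset.mem_range.1 hl).le.trans h)]
      constructor <;> linarith
    have h5 : 0 < ∏ l ∈ Finset.range r, (2 * ((k : ℝ) + n) - 1 - 2 * l) :=
      Finset.prod_pos fun l hl => (h4 l hl).1
    rw [chainMean, div_le_one chainSum_one_pos, ← mul_le_mul_iff_left₀ h5, h3]
    refine mul_le_mul_of_nonneg_left ?_ chainSum_one_pos.le
    rw [Nat.descFactorial_eq_prod_range, Nat.cast_prod]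
    exact Finset.prod_le_prod (fun l _ => Nat.cast_nonneg _) fun l hl => (h4 l hl).2

/-- The characteristic function of the number of loops converges to that of a Poisson variable. -/
lemma tendsto_mean_pow_loops (hα : 0 < α)
    (hN : (fun k => (N k : ℝ) - α * k) =O[atTop] fun _ => (1 : ℝ)) (w : ℂ) :
    Tendsto (fun k : ℕ => chainMean k (N k) fun x => (1 + w) ^ (cycleCount (N k) x 1)) atTop
      (𝓝 (Complex.exp (((1 / 2 * (α / (1 + α)) : ℝ) : ℂ) * w))) := by
  -- the binomial series in terms of factorial moments
  have hbin : ∀ k n : ℕ, chainMean k n (fun x => (1 + w) ^ (cycleCount n x 1)) =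
      ∑' r : ℕ, ((chainMean k n fun x => ((cycleCount n x 1).descFactorial r : ℝ) : ℝ) : ℂ) *
        (w ^ r / r.factorial) := by
    intro k n
    have h1 : ∀ r, ((chainMean k n fun x => ((cycleCount n x 1).descFactorial r : ℝ) : ℝ) : ℂ) =
        chainMean k n fun x => ((cycleCount n x 1).descFactorial r : ℂ) := by
      intro r
      rw [chainMean_ofReal]
      simp
    have h2 : ∀ x : Fin k ⊕ ℕ → ℕ, (1 + w) ^ (cycleCount n x 1) = ∑ r ∈ Finset.range (n + 1),
        (w ^ r / r.factorial) * ((cycleCount n x 1).descFactorial r : ℂ) := by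
      intro x
      rw [add_comm, add_pow]
      refine Eq.trans (Finset.sum_subset (Finset.range_mono (Nat.succ_le_succ (cycleCount_le_time x 1)))
        fun r _ hr => ?_) (Finset.sum_congr rfl fun r _ => ?_)
      · rw [Nat.choose_eq_zero_of_lt (by simpa using hr)]
        simp
      · rw [Nat.descFactorial_eq_factorial_mul_choose]
        have : (r.factorial : ℂ) ≠ 0 := by exact_mod_cast Nat.factorial_ne_zero r
        push_cast
        field_simp
        simp
    rw [tsum_eq_sum (s := Finset.range (n + 1))]
    · simp only [h2]
      rw [chainMean, chainSum_sum, Finset.sum_div]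
      refine Finset.sum_congr rfl fun r _ => ?_
      rw [h1, chainSum_const_mul, chainMean]
      ring
    · intro r hr
      rw [h1, chainMean_congr (G := fun _ => 0) fun x _ => by
        rw [Nat.descFactorial_of_lt ((cycleCount_le_time x 1).trans_lt (by simpa using hr)), Nat.cast_zero],
        chainMean_const, zero_mul]
  simp only [hbin]
  rw [Complex.exp_eq_exp_ℂ, NormedSpace.exp_eq_tsum_div]
  refine tendsto_tsum_of_dominated_convergence (bound := fun r => ‖w‖ ^ r / r.factorial)
    (Real.summable_pow_div_factorial _) (fun r => ?_) ?_
  · have := ((Complex.continuous_ofReal.tendsto _).comp (tendsto_mean_loops hα hN r)).mul_const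
      (w ^ r / r.factorial)
    convert! this using 2
    push_cast
    rw [mul_pow]
    ring
  · filter_upwards [eventually_ge_atTop 1] with k hk r
    rw [norm_mul, norm_div, norm_pow, Complex.norm_natCast]
    have h1 := mean_loops_le_one (k := k) (n := N k) (by omega) r
    have h2 : 0 ≤ chainMean k (N k) fun x => ((cycleCount (N k) x 1).descFactorial r : ℝ) :=
      chainMean_nonneg fun _ _ => Nat.cast_nonneg _
    rw [Complex.norm_real, Real.norm_of_nonneg h2]
    exact mul_le_of_le_one_left (by positivity) h1

end Asymptotics

/-! ### Fourier coefficients and characteristic functions -/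

section Fourier

open PowerSeries

/-- The value on the unit circle, at angle `t`, of a power series with summable coefficients. -/
noncomputable def circleValue (f : PowerSeries ℂ) (t : ℝ) : ℂ :=
  ∑' m, coeff m f * Complex.exp (m * t * Complex.I)

lemma norm_exp_nat_mul (m : ℕ) (t : ℝ) : ‖Complex.exp (m * t * Complex.I)‖ = 1 := by
  have := Complex.norm_exp_ofReal_mul_I (m * t)
  push_cast at this
  exact this

lemma norm_coeff_mul_exp (f : PowerSeries ℂ) (t : ℝ) (m : ℕ) :
    ‖coeff m f * Complex.exp (m * t * Complex.I)‖ = ‖coeff m f‖ := by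
  rw [norm_mul, norm_exp_nat_mul, mul_one]

lemma summable_coeff_mul {f g : PowerSeries ℂ} (hf : Summable fun m => ‖coeff m f‖)
    (hg : Summable fun m => ‖coeff m g‖) : Summable fun m => ‖coeff m (f * g)‖ := by
  have h := summable_norm_sum_mul_antidiagonal_of_summable_norm (f := fun m => coeff m f)
    (g := fun m => coeff m g) hf hg
  refine h.congr fun m => ?_
  rw [coeff_mul]

lemma circleValue_mul {f g : PowerSeries ℂ} (hf : Summable fun m => ‖coeff m f‖)
    (hg : Summable fun m => ‖coeff m g‖) (t : ℝ) :
    circleValue (f * g) t = circleValue f t * circleValue g t := by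
  rw [circleValue, circleValue, circleValue, tsum_mul_tsum_eq_tsum_sum_antidiagonal_of_summable_norm]
  · refine tsum_congr fun m => ?_
    rw [coeff_mul, Finset.sum_mul]
    refine Finset.sum_congr rfl fun p hp => ?_
    rw [← Finset.HasAntidiagonal.mem_antidiagonal.1 hp]
    push_cast
    rw [add_mul, add_mul, Complex.exp_add]
    ring
  · simpa only [norm_coeff_mul_exp] using hf
  · simpa only [norm_coeff_mul_exp] using hg

lemma circleValue_pow {f : PowerSeries ℂ} (hf : Summable fun m => ‖coeff m f‖) (k : ℕ) :
    (Summable fun m => ‖coeff m (f ^ k)‖) ∧ ∀ t, circleValue (f ^ k) t = circleValue f t ^ k := by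
  induction k with
  | zero =>
    constructor
    · refine summable_of_ne_finset_zero (s := {0}) fun m hm => ?_
      rw [pow_zero, coeff_one, if_neg (by simpa using hm), norm_zero]
    · intro t
      rw [circleValue, tsum_eq_single 0]
      · simp
      · intro m hm
        simp [coeff_one, hm]
  | succ k ih =>
    refine ⟨?_, fun t => ?_⟩
    · rw [pow_succ]
      exact summable_coeff_mul ih.1 hf
    · rw [pow_succ, circleValue_mul ih.1 hf, ih.2, pow_succ]

lemma continuous_circleValue {f : PowerSeries ℂ} (hf : Summable fun m => ‖coeff m f‖) :
    Continuous (circleValue f) :=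
  continuous_tsum (fun m => by fun_prop) hf fun m t => (norm_coeff_mul_exp f t m).le

lemma norm_circleValue_le {f : PowerSeries ℂ} (hf : Summable fun m => ‖coeff m f‖) (t : ℝ) :
    ‖circleValue f t‖ ≤ ∑' m, ‖coeff m f‖ := by
  have h : Summable fun m => ‖coeff m f * Complex.exp (m * t * Complex.I)‖ := by
    simpa only [norm_coeff_mul_exp] using hf
  refine (norm_tsum_le_tsum_norm h).trans_eq ?_
  simp only [norm_coeff_mul_exp]

lemma integral_exp_int_mul (a : ℤ) :
    ∫ t in (-Real.pi)..Real.pi, Complex.exp (a * t * Complex.I) = if a = 0 then (2 * Real.pi : ℂ) else 0 := by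
  split_ifs with h
  · simp [h]
    ring
  · have h1 : (a : ℂ) * Complex.I ≠ 0 := mul_ne_zero (by exact_mod_cast h) Complex.I_ne_zero
    have h2 := integral_exp_mul_complex (a := -Real.pi) (b := Real.pi) h1
    have h3 : ∀ t : ℂ, (a : ℂ) * Complex.I * t = a * t * Complex.I := fun t => by ring
    simp only [h3] at h2
    rw [h2, div_eq_zero_iff]
    left
    rw [sub_eq_zero, Complex.exp_eq_exp_iff_exists_int]
    refine ⟨a, ?_⟩
    push_cast
    ring

/-- The coefficients of a power series are the Fourier coefficients of its values on the circle. -/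
lemma integral_circleValue {f : PowerSeries ℂ} (hf : Summable fun m => ‖coeff m f‖) (n : ℕ) :
    ∫ t in (-Real.pi)..Real.pi, circleValue f t * Complex.exp (-(n * t * Complex.I)) =
      2 * Real.pi * coeff n f := by
  have h := intervalIntegral.hasSum_intervalIntegral_of_summable_norm (a := -Real.pi) (b := Real.pi)
    (f := fun m : ℕ => (⟨fun t : ℝ => coeff m f * Complex.exp (m * t * Complex.I) *
      Complex.exp (-(n * t * Complex.I)), by fun_prop⟩ : C(ℝ, ℂ))) ?_
  · have h1 : ∀ m : ℕ, ∫ t in (-Real.pi)..Real.pi, coeff m f * Complex.exp (m * t * Complex.I) *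
        Complex.exp (-(n * t * Complex.I)) = if m = n then 2 * Real.pi * coeff n f else 0 := by
      intro m
      have h2 := integral_exp_int_mul (m - n)
      have h3 : ∀ t : ℝ, coeff m f * Complex.exp (m * t * Complex.I) * Complex.exp (-(n * t * Complex.I))
          = coeff m f * Complex.exp (((m - n : ℤ) : ℂ) * t * Complex.I) := by
        intro t
        rw [mul_assoc, ← Complex.exp_add]
        congr 2
        push_cast
        ring
      simp only [h3]
      rw [intervalIntegral.integral_const_mul, h2]
      by_cases hmn : m = n
      · subst hmn
        simp
        ring
      · rw [if_neg (by omega), if_neg hmn, mul_zero]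
    simp only [ContinuousMap.coe_mk, h1] at h
    have h4 := h.unique (hasSum_ite_eq n _)
    rw [← h4]
    refine intervalIntegral.integral_congr fun t _ => ?_
    rw [circleValue, tsum_mul_right]
  · refine Summable.of_nonneg_of_le (fun _ => norm_nonneg _) (fun m => ?_) hf
    refine (ContinuousMap.norm_le _ (norm_nonneg _)).2 fun t => ?_
    have h5 := norm_exp_nat_mul n t.1
    rw [ContinuousMap.restrict_apply, ContinuousMap.coe_mk, norm_mul, norm_coeff_mul_exp,
      Complex.exp_neg, norm_inv, h5, inv_one, mul_one]

end Fourier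

section CharacteristicFunction

/-- The remainder of the expansion of order one of `exp (i x)`. -/
lemma norm_exp_sub_one_sub_le (x : ℝ) :
    ‖Complex.exp (x * Complex.I) - 1 - x * Complex.I‖ ≤ 3 * x ^ 2 := by
  have hx : ‖(x : ℂ) * Complex.I‖ = |x| := by simp
  rcases le_or_gt |x| 1 with h | h
  · have := Complex.norm_exp_sub_one_sub_id_le (x := x * Complex.I) (by rw [hx]; exact h)
    rw [hx, sq_abs] at this
    nlinarith [sq_nonneg x]
  · have h1 := norm_sub_le (Complex.exp (x * Complex.I) - 1) (x * Complex.I)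
    have h2 := norm_sub_le (Complex.exp (x * Complex.I)) 1
    rw [Complex.norm_exp_ofReal_mul_I, norm_one] at h2
    rw [hx] at h1
    rw [← sq_abs]
    nlinarith

lemma tendsto_mul_exp_sub_one_sub (x : ℝ) :
    Tendsto (fun k : ℕ => (k : ℂ) * (Complex.exp ((x / √k : ℝ) * Complex.I) - 1 -
      (x / √k : ℝ) * Complex.I)) atTop (𝓝 (-(x ^ 2 / 2 : ℝ))) := by
  have h0 : Tendsto (fun k : ℕ => |x| ^ 3 / √k) atTop (𝓝 0) :=
    tendsto_const_nhds.div_atTop (Real.tendsto_sqrt_atTop.comp tendsto_natCast_atTop_atTop)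
  rw [tendsto_iff_norm_sub_tendsto_zero]
  refine squeeze_zero' (.of_forall fun _ => norm_nonneg _) ?_ h0
  have h1 : Tendsto (fun k : ℕ => |x| / √k) atTop (𝓝 0) :=
    tendsto_const_nhds.div_atTop (Real.tendsto_sqrt_atTop.comp tendsto_natCast_atTop_atTop)
  filter_upwards [h1.eventually_le_const one_pos, eventually_gt_atTop 0] with k hk hk0
  have hs : 0 < √(k : ℝ) := Real.sqrt_pos.2 (by exact_mod_cast hk0)
  have hss : √(k : ℝ) ^ 2 = k := Real.sq_sqrt (Nat.cast_nonneg k)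
  have hz : ‖((x / √k : ℝ) : ℂ) * Complex.I‖ = |x| / √k := by
    rw [norm_mul, Complex.norm_I, mul_one, Complex.norm_real, Real.norm_eq_abs, abs_div,
      abs_of_pos hs]
  have h2 := Complex.exp_bound (x := ((x / √k : ℝ) : ℂ) * Complex.I) (by rw [hz]; exact hk)
    (n := 3) (by norm_num)
  rw [hz] at h2
  have h3 : (k : ℂ) * (Complex.exp ((x / √k : ℝ) * Complex.I) - 1 - (x / √k : ℝ) * Complex.I) -
      -(x ^ 2 / 2 : ℝ) = k * (Complex.exp ((x / √k : ℝ) * Complex.I) -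
        ∑ m ∈ Finset.range 3, (((x / √k : ℝ) : ℂ) * Complex.I) ^ m / m.factorial) := by
    have h4 : (k : ℂ) = (√(k : ℝ) : ℂ) ^ 2 := by exact_mod_cast hss.symm
    have h5 : (√(k : ℝ) : ℂ) ≠ 0 := by exact_mod_cast hs.ne'
    have hI : Complex.I ^ 2 = -1 := Complex.I_sq
    simp only [Finset.sum_range_succ, Finset.sum_range_zero, Nat.factorial]
    rw [mul_pow _ _ 2, hI, h4]
    push_cast
    field_simp
    ring
  rw [h3, norm_mul, Complex.norm_natCast]
  calc (k : ℝ) * _ ≤ k * ((|x| / √k) ^ 3 * 1) := by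
        refine mul_le_mul_of_nonneg_left (h2.trans ?_) (Nat.cast_nonneg k)
        refine mul_le_mul_of_nonneg_left ?_ (by positivity)
        norm_num [Nat.factorial]
    _ = |x| ^ 3 / √k := by
        nth_rewrite 1 [← hss]
        field_simp

/-- The central limit theorem for a discrete law on `ℕ`, in terms of characteristic functions. -/
lemma tendsto_tsum_exp_pow {p X : ℕ → ℝ} (hp : ∀ i, 0 ≤ p i) (hp1 : HasSum p 1)
    (hX : HasSum (fun i => p i * X i) 0) (hX2 : Summable fun i => p i * X i ^ 2) :
    Tendsto (fun k : ℕ => (∑' i, (p i : ℂ) * Complex.exp ((X i / √k : ℝ) * Complex.I)) ^ k) atTop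
      (𝓝 (Complex.exp (-(∑' i, p i * X i ^ 2 : ℝ) / 2))) := by
  have hp1' : HasSum (fun i => (p i : ℂ)) 1 := by
    have := Complex.hasSum_ofReal.2 hp1
    rwa [Complex.ofReal_one] at this
  have hX' : HasSum (fun i => ((p i * X i : ℝ) : ℂ)) 0 := by
    have := Complex.hasSum_ofReal.2 hX
    rwa [Complex.ofReal_zero] at this
  have hb : ∀ k : ℕ, Summable fun i => (p i : ℂ) * (Complex.exp ((X i / √k : ℝ) * Complex.I) - 1 -
      (X i / √k : ℝ) * Complex.I) := by
    intro k
    refine Summable.of_norm_bounded (hX2.mul_left (3 / √k ^ 2)) fun i => ?_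
    rw [norm_mul, Complex.norm_real, Real.norm_eq_abs, abs_of_nonneg (hp i)]
    refine (mul_le_mul_of_nonneg_left (norm_exp_sub_one_sub_le _) (hp i)).trans_eq ?_
    rw [div_pow]
    ring
  -- the terms of order zero and one of the expansion are the total mass and the mean
  have h1 : ∀ k : ℕ, (∑' i, (p i : ℂ) * Complex.exp ((X i / √k : ℝ) * Complex.I)) =
      1 + ∑' i, (p i : ℂ) * (Complex.exp ((X i / √k : ℝ) * Complex.I) - 1 -
        (X i / √k : ℝ) * Complex.I) := by
    intro k
    have h2 := (hp1'.add (hb k).hasSum).add (hX'.mul_right (Complex.I / (√k : ℝ)))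
    rw [zero_mul, add_zero] at h2
    rw [← h2.tsum_eq]
    refine tsum_congr fun i => ?_
    push_cast
    ring
  simp only [h1]
  refine Complex.tendsto_one_add_pow_exp_of_tendsto ?_
  simp only [← tsum_mul_left]
  have h3 : (-(∑' i, p i * X i ^ 2 : ℝ) / 2 : ℂ) = ∑' i, (p i : ℂ) * (-(X i ^ 2 / 2 : ℝ)) := by
    rw [Complex.ofReal_tsum, ← tsum_neg, ← tsum_div_const]
    refine tsum_congr fun i => ?_
    push_cast
    ring
  rw [h3]
  refine tendsto_tsum_of_dominated_convergence (hX2.mul_left 3) (fun i => ?_) (.of_forall fun k i => ?_)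
  · have := (tendsto_mul_exp_sub_one_sub (X i)).const_mul (p i : ℂ)
    refine this.congr fun k => by ring
  · rw [norm_mul, norm_mul, Complex.norm_natCast, Complex.norm_real, Real.norm_eq_abs,
      abs_of_nonneg (hp i)]
    have h4 := norm_exp_sub_one_sub_le (X i / √k)
    rcases Nat.eq_zero_or_pos k with rfl | hk
    · simp only [Nat.cast_zero, zero_mul]
      have := hp i
      positivity
    · have hk' : (0 : ℝ) < k := by exact_mod_cast hk
      rw [div_pow, Real.sq_sqrt hk'.le] at h4
      calc (k : ℝ) * (p i * _) ≤ k * (p i * (3 * (X i ^ 2 / k))) :=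
            mul_le_mul_of_nonneg_left (mul_le_mul_of_nonneg_left h4 (hp i)) hk'.le
        _ = 3 * (p i * X i ^ 2) := by field_simp

end CharacteristicFunction

/-! ### Bounds for the generating functions on the circle -/

section GeometricLaw

/-- The geometric law on `ℕ` of mean `α`. It is the limit law of the number of vertices of degree
two on a given path. -/
noncomputable def geometricLaw (α : ℝ) (i : ℕ) : ℝ := α ^ i / (1 + α) ^ (i + 1)

variable {α : ℝ}

lemma geometricLaw_pos (hα : 0 < α) (i : ℕ) : 0 < geometricLaw α i := by
  unfold geometricLaw
  positivity

lemma geometricLaw_eq (i : ℕ) : geometricLaw α i = 1 / (1 + α) * (α / (1 + α)) ^ i := by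
  rw [geometricLaw, div_pow, pow_succ, div_mul_div_comm, one_mul, mul_comm (1 + α)]

lemma hasSum_geometricLaw_choose (hα : 0 < α) (r : ℕ) :
    HasSum (fun i => (i.choose r : ℝ) * geometricLaw α i) (α ^ r) := by
  have hρ0 : 0 < α / (1 + α) := by positivity
  have hρ1 : α / (1 + α) < 1 := (div_lt_one (by positivity)).2 (by linarith)
  have h := (hasSum_choose_mul_geometric_of_norm_lt_one r (r := α / (1 + α))
    (by rwa [Real.norm_eq_abs, abs_of_pos hρ0])).mul_left (1 / (1 + α) * (α / (1 + α)) ^ r)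
  have h1 : 1 - α / (1 + α) = 1 / (1 + α) := by field_simp; ring
  rw [h1] at h
  have h2 : 1 / (1 + α) * (α / (1 + α)) ^ r * (1 / (1 / (1 + α)) ^ (r + 1)) = α ^ r := by
    rw [div_pow, div_pow, one_pow, pow_succ]
    field_simp
  rw [h2] at h
  rw [← hasSum_nat_add_iff' r]
  rw [Finset.sum_eq_zero, sub_zero]
  · refine h.congr_fun ?_
    intro i
    rw [geometricLaw_eq, pow_add]
    ring
  · intro i hi
    rw [Nat.choose_eq_zero_of_lt (Finset.mem_range.1 hi)]
    simp

lemma hasSum_geometricLaw (hα : 0 < α) : HasSum (geometricLaw α) 1 := by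
  simpa using hasSum_geometricLaw_choose hα 0

lemma hasSum_geometricLaw_sub (hα : 0 < α) :
    HasSum (fun i => geometricLaw α i * (i - α)) 0 := by
  have h := (hasSum_geometricLaw_choose hα 1).sub ((hasSum_geometricLaw hα).mul_left α)
  rw [pow_one, mul_one, sub_self] at h
  refine h.congr_fun fun i => ?_
  rw [Nat.choose_one_right]
  ring

lemma hasSum_geometricLaw_sq (hα : 0 < α) :
    HasSum (fun i => geometricLaw α i * (i - α) ^ 2) (α * (1 + α)) := by
  have h := (((hasSum_geometricLaw_choose hα 2).mul_left 2).add
    ((hasSum_geometricLaw_choose hα 1).mul_left (1 - 2 * α))).add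
      ((hasSum_geometricLaw hα).mul_left (α ^ 2))
  have h1 : 2 * α ^ 2 + (1 - 2 * α) * α ^ 1 + α ^ 2 * 1 = α * (1 + α) := by ring
  rw [h1] at h
  refine h.congr_fun fun i => ?_
  rw [Nat.choose_one_right, Nat.cast_choose_two]
  ring

end GeometricLaw

section GeneratingFunctions

open PowerSeries

lemma cycleWeight_nonneg (c : ℕ) : 0 ≤ cycleWeight ℝ c :=
  Finset.prod_nonneg fun l _ => by positivity

lemma cycleWeight_le_one (c : ℕ) : cycleWeight ℝ c ≤ 1 := by
  refine Finset.prod_le_one (fun l _ => by positivity) fun l _ => ?_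
  rw [div_le_one (by positivity)]
  linarith

lemma ofReal_cycleWeight (c : ℕ) : ((cycleWeight ℝ c : ℝ) : ℂ) = cycleWeight ℂ c := by
  simp [cycleWeight]

/-- The generating function of a path whose number of vertices of degree two has geometric law,
each value `i` being given the additional weight `u i`. -/
noncomputable def pathSeries (α : ℝ) (u : ℕ → ℂ) : PowerSeries ℂ :=
  mk fun i => (geometricLaw α i : ℂ) * u i

/-- The generating function of the vertices on cycles, in the same variable as `pathSeries`. -/
noncomputable def cycleSeries (α : ℝ) : PowerSeries ℂ :=
  mk fun c => ((cycleWeight ℝ c * (α / (1 + α)) ^ c : ℝ) : ℂ)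

variable {α : ℝ}

/-- Tilting both generating functions by the same geometric factor does not change the ratio. -/
lemma chainMean_prod (hα : 0 < α) (k n : ℕ) (u : ℕ → ℂ) :
    chainMean k n (fun x => ∏ l, u (x (Sum.inl l))) =
      coeff n (pathSeries α u ^ k * cycleSeries α) /
        coeff n (pathSeries α (fun _ => 1) ^ k * cycleSeries α) := by
  have hα1 : (1 + α : ℂ) ≠ 0 := by
    have : (1 + α : ℝ) ≠ 0 := by positivity
    exact_mod_cast this
  have hα0 : (α : ℂ) ≠ 0 := by exact_mod_cast hα.ne'
  have key : ∀ u : ℕ → ℂ, coeff n (pathSeries α u ^ k * cycleSeries α) =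
      (1 / (1 + α) : ℂ) ^ k * (α / (1 + α) : ℂ) ^ n *
        coeff n ((mk u) ^ k * mk (cycleWeight ℂ)) := by
    intro u
    have h1 : pathSeries α u = C (1 / (1 + α) : ℂ) * rescale (α / (1 + α) : ℂ) (mk u) := by
      ext i
      rw [pathSeries, coeff_mk, coeff_C_mul, coeff_rescale, coeff_mk, geometricLaw_eq]
      push_cast
      ring
    have h2 : cycleSeries α = rescale (α / (1 + α) : ℂ) (mk (cycleWeight ℂ)) := by
      ext i
      rw [cycleSeries, coeff_mk, coeff_rescale, coeff_mk, ← ofReal_cycleWeight]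
      push_cast
      ring
    rw [h1, h2, mul_pow, ← map_pow, ← map_pow, mul_assoc, ← map_mul, coeff_C_mul, coeff_rescale,
      mul_assoc]
  have h := fun u : ℕ → ℂ => chainSum_prod (k := k) (n := n) (fun _ => u) (fun _ => (1 : ℂ))
  simp only [mul_one, Finset.prod_const, Finset.card_univ, Fintype.card_fin] at h
  have h3 := h fun _ => 1
  simp only [Finset.prod_const_one] at h3
  have h0 : (1 / (1 + α) : ℂ) ^ k * (α / (1 + α) : ℂ) ^ n ≠ 0 :=
    mul_ne_zero (pow_ne_zero _ (one_div_ne_zero hα1)) (pow_ne_zero _ (div_ne_zero hα0 hα1))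
  have h4 : (2 : ℂ) ^ n * (n.factorial : ℂ) ≠ 0 :=
    mul_ne_zero (pow_ne_zero _ two_ne_zero) (by exact_mod_cast n.factorial_ne_zero)
  rw [chainMean, h, h3, key, key, mul_div_mul_left _ _ h0]
  exact mul_div_mul_left _ _ h4

lemma summable_cycleSeries (hα : 0 < α) : Summable fun m => ‖coeff m (cycleSeries α)‖ := by
  have hρ0 : 0 ≤ α / (1 + α) := by positivity
  have hρ1 : α / (1 + α) < 1 := (div_lt_one (by positivity)).2 (by linarith)
  refine Summable.of_nonneg_of_le (fun _ => norm_nonneg _) (fun m => ?_)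
    (summable_geometric_of_lt_one hρ0 hρ1)
  rw [cycleSeries, coeff_mk, Complex.norm_real, Real.norm_eq_abs,
    abs_of_nonneg (mul_nonneg (cycleWeight_nonneg m) (by positivity))]
  exact mul_le_of_le_one_left (by positivity) (cycleWeight_le_one m)

lemma circleValue_cycleSeries_zero_ne_zero (hα : 0 < α) : circleValue (cycleSeries α) 0 ≠ 0 := by
  have hs := summable_cycleSeries hα
  have h0 : ∀ m, 0 ≤ cycleWeight ℝ m * (α / (1 + α)) ^ m := fun m =>
    mul_nonneg (cycleWeight_nonneg m) (by positivity)
  have hs' : Summable fun m => cycleWeight ℝ m * (α / (1 + α)) ^ m := by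
    refine hs.congr fun m => ?_
    rw [cycleSeries, coeff_mk, Complex.norm_real, Real.norm_eq_abs, abs_of_nonneg (h0 m)]
  have h1 : circleValue (cycleSeries α) 0 = ((∑' m, cycleWeight ℝ m * (α / (1 + α)) ^ m : ℝ) : ℂ) := by
    rw [circleValue, Complex.ofReal_tsum]
    refine tsum_congr fun m => ?_
    rw [cycleSeries, coeff_mk]
    simp
  rw [h1]
  have h2 := hs'.tsum_pos h0 0 (by simp [cycleWeight])
  exact_mod_cast h2.ne'

lemma norm_coeff_pathSeries (hα : 0 < α) {u : ℕ → ℂ} (hu : ∀ i, ‖u i‖ ≤ 1) (m : ℕ) :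
    ‖coeff m (pathSeries α u)‖ ≤ geometricLaw α m := by
  rw [pathSeries, coeff_mk, norm_mul, Complex.norm_real, Real.norm_eq_abs,
    abs_of_pos (geometricLaw_pos hα m)]
  exact mul_le_of_le_one_right (geometricLaw_pos hα m).le (hu m)

lemma summable_pathSeries (hα : 0 < α) {u : ℕ → ℂ} (hu : ∀ i, ‖u i‖ ≤ 1) :
    Summable fun m => ‖coeff m (pathSeries α u)‖ :=
  Summable.of_nonneg_of_le (fun _ => norm_nonneg _) (norm_coeff_pathSeries hα hu)
    (hasSum_geometricLaw hα).summable

/-- Two consecutive atoms suffice to bound a characteristic function away from one. -/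
lemma norm_add_mul_exp_le {a b : ℝ} (ha : 0 < a) (hb : 0 < b) {t : ℝ} (ht : |t| ≤ Real.pi) :
    ‖(a : ℂ) + b * Complex.exp (t * Complex.I)‖ ≤
      a + b - a * b / (a + b) * (2 / Real.pi ^ 2) * t ^ 2 := by
  have hcos := Real.cos_le_one_sub_mul_cos_sq ht
  have h1 : ‖(a : ℂ) + b * Complex.exp (t * Complex.I)‖ ^ 2 =
      (a + b) ^ 2 - 2 * (a * b) * (1 - Real.cos t) := by
    rw [← Complex.normSq_eq_norm_sq, Complex.normSq_apply, Complex.exp_mul_I, ← Complex.ofReal_cos,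
      ← Complex.ofReal_sin]
    simp only [Complex.add_re, Complex.add_im, Complex.mul_re, Complex.mul_im, Complex.ofReal_re,
      Complex.ofReal_im, Complex.I_re, Complex.I_im]
    linear_combination b ^ 2 * Real.sin_sq_add_cos_sq t
  have hab : 0 < a + b := by positivity
  have h2 : a * b / (a + b) * (2 / Real.pi ^ 2) * t ^ 2 ≤ a * b / (a + b) * (1 - Real.cos t) := by
    rw [mul_assoc]
    exact mul_le_mul_of_nonneg_left (by linarith) (by positivity)
  have h3 : ‖(a : ℂ) + b * Complex.exp (t * Complex.I)‖ ≤ a + b - a * b / (a + b) * (1 - Real.cos t) := by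
    have h4 : a * b / (a + b) * (1 - Real.cos t) ≤ a + b := by
      have : a * b / (a + b) ≤ (a + b) / 2 := by
        rw [div_le_iff₀ hab]
        nlinarith [sq_nonneg a, sq_nonneg b, mul_pos ha hb]
      have h5 : 1 - Real.cos t ≤ 2 := by linarith [Real.neg_one_le_cos t]
      have h6 : 0 ≤ 1 - Real.cos t := by linarith [Real.cos_le_one t]
      nlinarith
    -- `√(S² - 2 D) ≤ S - D / S`, in squared form
    refine le_of_sq_le_sq ?_ (by linarith)
    rw [h1]
    have h7 : a * b = a * b / (a + b) * (a + b) := by field_simp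
    generalize a * b / (a + b) = e at h7 ⊢
    rw [h7]
    linarith [sq_nonneg (e * (1 - Real.cos t))]
  linarith

/-- The generating function of a path is bounded on the circle by a Gaussian, uniformly in the
weights that are one at two consecutive places. -/
lemma norm_circleValue_pathSeries_le (hα : 0 < α) (a : ℕ) :
    ∃ c : ℝ, 0 < c ∧ ∀ u : ℕ → ℂ, (∀ i, ‖u i‖ ≤ 1) → u a = 1 → u (a + 1) = 1 →
      ∀ t : ℝ, |t| ≤ Real.pi → ‖circleValue (pathSeries α u) t‖ ≤ Real.exp (-c * t ^ 2) := by
  have hpa := geometricLaw_pos hα a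
  have hpb := geometricLaw_pos hα (a + 1)
  refine ⟨geometricLaw α a * geometricLaw α (a + 1) / (geometricLaw α a + geometricLaw α (a + 1)) *
    (2 / Real.pi ^ 2), by positivity, fun u hu ha hb t ht => ?_⟩
  have hs := summable_pathSeries hα hu
  have hs' : Summable fun m => coeff m (pathSeries α u) * Complex.exp (m * t * Complex.I) := by
    refine Summable.of_norm ?_
    simpa only [norm_coeff_mul_exp] using hs
  have hab : a ∉ ({a + 1} : Finset ℕ) := by simp
  have h1 := hs'.sum_add_tsum_compl (s := ({a, a + 1} : Finset ℕ))
  have h2 := (hasSum_geometricLaw hα).summable.sum_add_tsum_compl (s := ({a, a + 1} : Finset ℕ))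
  rw [Finset.sum_insert hab, Finset.sum_singleton] at h1 h2
  rw [(hasSum_geometricLaw hα).tsum_eq] at h2
  rw [circleValue, ← h1]
  have h3 : ‖coeff a (pathSeries α u) * Complex.exp (a * t * Complex.I) +
      coeff (a + 1) (pathSeries α u) * Complex.exp ((a + 1 : ℕ) * t * Complex.I)‖ =
      ‖(geometricLaw α a : ℂ) + geometricLaw α (a + 1) * Complex.exp (t * Complex.I)‖ := by
    rw [pathSeries, coeff_mk, coeff_mk, ha, hb, Nat.cast_add, Nat.cast_one, add_mul, add_mul, one_mul,
      Complex.exp_add]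
    have h := norm_mul (Complex.exp (a * t * Complex.I))
      ((geometricLaw α a : ℂ) + geometricLaw α (a + 1) * Complex.exp (t * Complex.I))
    rw [norm_exp_nat_mul, one_mul] at h
    rw [← h]
    congr 1
    ring
  have h4 : ‖∑' m : ↑(({a, a + 1} : Finset ℕ) : Set ℕ)ᶜ,
      coeff (m : ℕ) (pathSeries α u) * Complex.exp ((m : ℕ) * t * Complex.I)‖ ≤
      ∑' m : ↑(({a, a + 1} : Finset ℕ) : Set ℕ)ᶜ, geometricLaw α m := by
    refine tsum_of_norm_bounded ((hasSum_geometricLaw hα).summable.subtype _).hasSum fun m => ?_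
    rw [norm_coeff_mul_exp]
    exact norm_coeff_pathSeries hα hu m
  have h5 := norm_add_mul_exp_le hpa hpb ht
  have h6 := Real.add_one_le_exp (-(geometricLaw α a * geometricLaw α (a + 1) /
    (geometricLaw α a + geometricLaw α (a + 1)) * (2 / Real.pi ^ 2)) * t ^ 2)
  refine (norm_add_le _ _).trans ?_
  rw [h3]
  linarith

end GeneratingFunctions

/-! ### The local limit theorem for the paths -/

section LocalLimit

open PowerSeries

variable {α : ℝ}

/-- The factor that a path with `i` inner vertices contributes to the characteristic function of
`(∑ over the paths of s) / √k`. -/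
noncomputable def pathPhase (s : ℕ → ℝ) (k : ℕ) (i : ℕ) : ℂ :=
  Complex.exp ((s i / √k : ℝ) * Complex.I)

lemma norm_pathPhase (s : ℕ → ℝ) (k i : ℕ) : ‖pathPhase s k i‖ = 1 :=
  Complex.norm_exp_ofReal_mul_I _

/-- The integrand, after rescaling, of the Cauchy integral for the coefficient of
`pathSeries ^ k * cycleSeries`, centred by `exp (- i √k m)`. -/
noncomputable def localIntegrand (α : ℝ) (s : ℕ → ℝ) (m : ℝ) (k n : ℕ) (τ : ℝ) : ℂ :=
  Complex.exp (-(√k * m : ℝ) * Complex.I) *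
    (circleValue (pathSeries α (pathPhase s k)) (τ / √k) ^ k * circleValue (cycleSeries α) (τ / √k) *
      Complex.exp (-(n * (τ / √k : ℝ) * Complex.I)))

lemma continuous_localIntegrand (hα : 0 < α) (s : ℕ → ℝ) (m : ℝ) (k n : ℕ) :
    Continuous (localIntegrand α s m k n) := by
  have h1 := continuous_circleValue (summable_pathSeries hα fun i => (norm_pathPhase s k i).le)
  have h2 := continuous_circleValue (summable_cycleSeries hα)
  have h3 : Continuous fun τ : ℝ => τ / √(k : ℝ) := continuous_id.div_const _
  unfold localIntegrand
  have h4 := h1.comp h3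
  have h5 := h2.comp h3
  refine continuous_const.mul (((h4.pow k).mul h5).mul ?_)
  fun_prop

/-- Cauchy's formula in the rescaled variable `τ = √k t`. -/
lemma integral_localIntegrand (hα : 0 < α) (s : ℕ → ℝ) (m : ℝ) {k : ℕ} (hk : 0 < k) (n : ℕ) :
    ∫ τ, (Set.Ioc (-(Real.pi * √k)) (Real.pi * √k)).indicator (localIntegrand α s m k n) τ =
      √k * (2 * Real.pi) * Complex.exp (-(√k * m : ℝ) * Complex.I) *
        coeff n (pathSeries α (pathPhase s k) ^ k * cycleSeries α) := by
  have hs : 0 < √(k : ℝ) := Real.sqrt_pos.2 (by exact_mod_cast hk)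
  have h1 := summable_pathSeries hα fun i => (norm_pathPhase s k i).le
  have h2 := summable_cycleSeries hα
  have h3 := circleValue_pow h1 k
  have h4 := integral_circleValue (summable_coeff_mul h3.1 h2) n
  have h5 := intervalIntegral.integral_comp_div (a := -(Real.pi * √k)) (b := Real.pi * √k)
    (fun t : ℝ => circleValue (pathSeries α (pathPhase s k) ^ k * cycleSeries α) t *
      Complex.exp (-(n * t * Complex.I))) hs.ne'
  rw [neg_div, mul_div_cancel_right₀ _ hs.ne', h4] at h5
  rw [integral_indicator measurableSet_Ioc, ← intervalIntegral.integral_of_le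
    (by have := Real.pi_pos; nlinarith [mul_pos this hs])]
  unfold localIntegrand
  rw [intervalIntegral.integral_const_mul]
  simp only [circleValue_mul h3.1 h2, h3.2] at h5
  rw [h5, Complex.real_smul]
  ring

/-- The Gaussian bound of the integrand, from the two path sizes `a` and `a + 1` at which `s`
vanishes. -/
lemma localIntegrand_bound (hα : 0 < α) (s : ℕ → ℝ) {a : ℕ} (ha : ∀ i, a ≤ i → s i = 0) (m : ℝ) :
    ∃ c : ℝ, 0 < c ∧ ∃ M : ℝ, ∀ k n : ℕ, 0 < k → ∀ τ : ℝ,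
      ‖(Set.Ioc (-(Real.pi * √k)) (Real.pi * √k)).indicator (localIntegrand α s m k n) τ‖ ≤
        M * Real.exp (-c * τ ^ 2) := by
  obtain ⟨c, hc, h⟩ := norm_circleValue_pathSeries_le hα a
  refine ⟨c, hc, ∑' m, ‖coeff m (cycleSeries α)‖, fun k n hk τ => ?_⟩
  have hk' : (0 : ℝ) < k := by exact_mod_cast hk
  have hs : 0 < √(k : ℝ) := Real.sqrt_pos.2 hk'
  have hM : 0 ≤ ∑' m, ‖coeff m (cycleSeries α)‖ := tsum_nonneg fun _ => norm_nonneg _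
  by_cases hτ : τ ∈ Set.Ioc (-(Real.pi * √k)) (Real.pi * √k)
  · rw [Set.indicator_of_mem hτ]
    have h1 := h (pathPhase s k) (fun i => (norm_pathPhase s k i).le)
      (by simp [pathPhase, ha a le_rfl]) (by simp [pathPhase, ha (a + 1) (Nat.le_succ a)])
      (τ / √k) (by rw [abs_div, abs_of_pos hs, div_le_iff₀ hs]; exact abs_le.2 ⟨hτ.1.le, hτ.2⟩)
    have h2 := norm_circleValue_le (summable_cycleSeries hα) (τ / √k)
    have h3 : ‖Complex.exp (-(√k * m : ℝ) * Complex.I)‖ = 1 := by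
      rw [← Complex.ofReal_neg]
      exact Complex.norm_exp_ofReal_mul_I _
    have h4 : ‖Complex.exp (-(n * (τ / √k : ℝ) * Complex.I))‖ = 1 := by
      rw [Complex.exp_neg, norm_inv, norm_exp_nat_mul, inv_one]
    rw [localIntegrand, norm_mul, norm_mul, norm_mul, h3, h4, norm_pow, one_mul, mul_one, mul_comm]
    refine mul_le_mul h2 ((pow_le_pow_left₀ (norm_nonneg _) h1 k).trans_eq ?_) (by positivity) hM
    rw [← Real.exp_nat_mul, div_pow, Real.sq_sqrt hk'.le]
    congr 1
    field_simp
  · rw [Set.indicator_of_notMem hτ, norm_zero]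
    positivity

/-- The mean and the second moment, under the geometric law, of the variable whose characteristic
function is the limit of the integrand at `τ`. -/
lemma hasSum_phase (hα : 0 < α) (s : ℕ → ℝ) {a : ℕ} (ha : ∀ i, a ≤ i → s i = 0) (τ : ℝ) :
    let m := ∑ i ∈ Finset.range a, geometricLaw α i * s i
    HasSum (fun i => geometricLaw α i * (s i - m + τ * (i - α))) 0 ∧
    HasSum (fun i => geometricLaw α i * (s i - m + τ * (i - α)) ^ 2)
      ((∑ i ∈ Finset.range a, geometricLaw α i * s i ^ 2) - m ^ 2 +
        2 * τ * (∑ i ∈ Finset.range a, geometricLaw α i * (s i * (i - α))) +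
          τ ^ 2 * (α * (1 + α))) := by
  intro m
  have h0 := hasSum_geometricLaw hα
  have h1 := hasSum_geometricLaw_sub hα
  have h2 := hasSum_geometricLaw_sq hα
  have hf : ∀ f : ℕ → ℝ, (∀ i, s i = 0 → f i = 0) → HasSum f (∑ i ∈ Finset.range a, f i) :=
    fun f hf => hasSum_sum_of_ne_finset_zero fun i hi =>
      hf i (ha i (by simpa using hi))
  have h3 := hf (fun i => geometricLaw α i * s i) (fun i hi => by simp [hi])
  have h4 := hf (fun i => geometricLaw α i * s i ^ 2) (fun i hi => by simp [hi])
  have h5 := hf (fun i => geometricLaw α i * (s i * (i - α))) (fun i hi => by simp [hi])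
  constructor
  · have h := (h3.sub (h0.mul_left m)).add (h1.mul_left τ)
    rw [mul_one, sub_self, mul_zero, add_zero] at h
    refine h.congr_fun fun i => ?_
    ring
  · have h := (((((h4.sub (h3.mul_left (2 * m))).add (h0.mul_left (m ^ 2))).add
      (h5.mul_left (2 * τ))).sub (h1.mul_left (2 * τ * m))).add (h2.mul_left (τ ^ 2)))
    have h6 : 2 * m * m = 2 * m * ∑ i ∈ Finset.range a, geometricLaw α i * s i := rfl
    rw [← h6] at h
    have h7 := h.congr_fun (g := fun i => geometricLaw α i * (s i - m + τ * (i - α)) ^ 2)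
      fun i => by ring
    have h8 : ∀ S B : ℝ, S - 2 * m * m + m ^ 2 * 1 + 2 * τ * B - 2 * τ * m * 0 +
        τ ^ 2 * (α * (1 + α)) = S - m ^ 2 + 2 * τ * B + τ ^ 2 * (α * (1 + α)) :=
      fun S B => by ring
    rwa [h8] at h7

variable {N : ℕ → ℕ}

lemma tendsto_sub_div_sqrt (hN : (fun k => (N k : ℝ) - α * k) =O[atTop] fun _ => (1 : ℝ)) :
    Tendsto (fun k : ℕ => ((N k : ℝ) - α * k) / √k) atTop (𝓝 0) := by
  have h1 : Tendsto (fun k : ℕ => (√(k : ℝ))⁻¹) atTop (𝓝 0) :=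
    tendsto_inv_atTop_zero.comp (Real.tendsto_sqrt_atTop.comp tendsto_natCast_atTop_atTop)
  have h2 := hN.mul (isBigO_refl (fun k : ℕ => (√(k : ℝ))⁻¹) atTop)
  simp only [one_mul] at h2
  exact h2.trans_tendsto h1

/-- The pointwise limit of the integrand. The bounded difference between `N k` and `α k` disappears
after division by `√k`. -/
lemma tendsto_localIntegrand (hα : 0 < α)
    (hN : (fun k => (N k : ℝ) - α * k) =O[atTop] fun _ => (1 : ℝ))
    (s : ℕ → ℝ) {a : ℕ} (ha : ∀ i, a ≤ i → s i = 0) (τ : ℝ) :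
    let m := ∑ i ∈ Finset.range a, geometricLaw α i * s i
    Tendsto (fun k : ℕ => (Set.Ioc (-(Real.pi * √k)) (Real.pi * √k)).indicator
        (localIntegrand α s m k (N k)) τ) atTop
      (𝓝 (Complex.exp (-((∑ i ∈ Finset.range a, geometricLaw α i * s i ^ 2) - m ^ 2 +
        2 * τ * (∑ i ∈ Finset.range a, geometricLaw α i * (s i * (i - α))) +
          τ ^ 2 * (α * (1 + α)) : ℝ) / 2) * circleValue (cycleSeries α) 0)) := by
  intro m
  obtain ⟨hX, hX2⟩ := hasSum_phase hα s ha τ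
  have h1 := tendsto_tsum_exp_pow (fun i => (geometricLaw_pos hα i).le) (hasSum_geometricLaw hα) hX
    hX2.summable
  rw [hX2.tsum_eq] at h1
  have hsq : Tendsto (fun k : ℕ => √(k : ℝ)) atTop atTop :=
    Real.tendsto_sqrt_atTop.comp tendsto_natCast_atTop_atTop
  have h2 : Tendsto (fun k : ℕ => circleValue (cycleSeries α) (τ / √k)) atTop
      (𝓝 (circleValue (cycleSeries α) 0)) :=
    ((continuous_circleValue (summable_cycleSeries hα)).tendsto 0).comp
      (tendsto_const_nhds.div_atTop hsq)
  have h3 : Tendsto (fun k : ℕ => Complex.exp (-(τ * (((N k : ℝ) - α * k) / √k) : ℝ) * Complex.I)) atTop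
      (𝓝 1) := by
    have h4 : Tendsto (fun k : ℕ => τ * (((N k : ℝ) - α * k) / √k)) atTop (𝓝 0) := by
      simpa using (tendsto_sub_div_sqrt hN).const_mul τ
    have h5 : Continuous fun x : ℝ => Complex.exp (-(x : ℂ) * Complex.I) := by fun_prop
    have h6 := (h5.tendsto 0).comp h4
    rw [Complex.ofReal_zero, neg_zero, zero_mul, Complex.exp_zero] at h6
    exact h6
  have h7 := (h1.mul h2).mul h3
  rw [mul_one] at h7
  refine h7.congr' ?_
  have h8 : Tendsto (fun k : ℕ => Real.pi * √(k : ℝ)) atTop atTop :=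
    hsq.const_mul_atTop Real.pi_pos
  filter_upwards [h8.eventually_gt_atTop |τ|, eventually_gt_atTop 0] with k hk hk0
  have hs : 0 < √(k : ℝ) := Real.sqrt_pos.2 (by exact_mod_cast hk0)
  have hss : (√(k : ℝ) : ℂ) ^ 2 = k := by exact_mod_cast Real.sq_sqrt (Nat.cast_nonneg k)
  have hs' : (√(k : ℝ) : ℂ) ≠ 0 := by exact_mod_cast hs.ne'
  rw [Set.indicator_of_mem (show τ ∈ Set.Ioc _ _ from ⟨(abs_lt.1 hk).1, (abs_lt.1 hk).2.le⟩),
    localIntegrand]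
  -- the centring of each of the `k` factors of the power
  have h9 : (∑' i, (geometricLaw α i : ℂ) *
      Complex.exp (((s i - m + τ * (i - α)) / √k : ℝ) * Complex.I)) =
      circleValue (pathSeries α (pathPhase s k)) (τ / √k) *
        Complex.exp (-((m + τ * α) / √k : ℝ) * Complex.I) := by
    rw [circleValue, ← tsum_mul_right]
    refine tsum_congr fun i => ?_
    rw [pathSeries, coeff_mk, pathPhase, mul_assoc, mul_assoc, ← Complex.exp_add, ← Complex.exp_add]
    congr 2
    push_cast
    ring
  rw [h9, mul_pow, ← Complex.exp_nat_mul]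
  have h10 : Complex.exp ((k : ℂ) * (-((m + τ * α) / √k : ℝ) * Complex.I)) *
      Complex.exp (-(τ * (((N k : ℝ) - α * k) / √k) : ℝ) * Complex.I) =
      Complex.exp (-(√k * m : ℝ) * Complex.I) *
        Complex.exp (-((N k : ℂ) * (τ / √k : ℝ) * Complex.I)) := by
    rw [← Complex.exp_add, ← Complex.exp_add]
    congr 1
    push_cast
    rw [← hss]
    field_simp
    ring
  linear_combination circleValue (pathSeries α (pathPhase s k)) (τ / √k) ^ k *
    circleValue (cycleSeries α) (τ / √k) * h10

/-- The limit of the Cauchy integrals. -/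
lemma tendsto_integral_localIntegrand (hα : 0 < α)
    (hN : (fun k => (N k : ℝ) - α * k) =O[atTop] fun _ => (1 : ℝ))
    (s : ℕ → ℝ) {a : ℕ} (ha : ∀ i, a ≤ i → s i = 0) :
    let m := ∑ i ∈ Finset.range a, geometricLaw α i * s i
    Tendsto (fun k : ℕ => ∫ τ, (Set.Ioc (-(Real.pi * √k)) (Real.pi * √k)).indicator
        (localIntegrand α s m k (N k)) τ) atTop
      (𝓝 (Complex.exp (-((∑ i ∈ Finset.range a, geometricLaw α i * s i ^ 2) - m ^ 2 -
        (∑ i ∈ Finset.range a, geometricLaw α i * (s i * (i - α))) ^ 2 / (α * (1 + α)) : ℝ) / 2) *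
          ((∫ τ : ℝ, Real.exp (-(α * (1 + α) / 2) * τ ^ 2) : ℝ) : ℂ) *
            circleValue (cycleSeries α) 0)) := by
  intro m
  obtain ⟨c, hc, M, hb⟩ := localIntegrand_bound hα s ha m
  have h1 := tendsto_integral_filter_of_dominated_convergence (l := atTop) (μ := volume)
    (F := fun (k : ℕ) τ => (Set.Ioc (-(Real.pi * √k)) (Real.pi * √k)).indicator
        (localIntegrand α s m k (N k)) τ) (fun τ => M * Real.exp (-c * τ ^ 2))
    (.of_forall fun k => (continuous_localIntegrand hα s m k (N k)).aestronglyMeasurable.indicator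
      measurableSet_Ioc)
    ((eventually_gt_atTop 0).mono fun k hk => .of_forall fun τ => hb k (N k) hk τ)
    ((integrable_exp_neg_mul_sq hc).const_mul M)
    (.of_forall fun τ => tendsto_localIntegrand hα hN s ha τ)
  refine h1.trans_eq ?_
  congr 1
  rw [integral_mul_const]
  congr 1
  set A := (∑ i ∈ Finset.range a, geometricLaw α i * s i ^ 2) - m ^ 2
  set B := ∑ i ∈ Finset.range a, geometricLaw α i * (s i * (i - α))
  -- completion of the square
  have hσ : α * (1 + α) ≠ 0 := by positivity
  have h2 : ∀ τ : ℝ, Complex.exp (-(A + 2 * τ * B + τ ^ 2 * (α * (1 + α)) : ℝ) / 2) =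
      Complex.exp (-(A - B ^ 2 / (α * (1 + α)) : ℝ) / 2) *
        (Real.exp (-(α * (1 + α) / 2) * (τ + B / (α * (1 + α))) ^ 2) : ℝ) := by
    intro τ
    rw [Complex.ofReal_exp, ← Complex.exp_add]
    congr 1
    have : -(A + 2 * τ * B + τ ^ 2 * (α * (1 + α))) / 2 = -(A - B ^ 2 / (α * (1 + α))) / 2 +
        -(α * (1 + α) / 2) * (τ + B / (α * (1 + α))) ^ 2 := by
      field_simp
      ring
    exact_mod_cast congrArg (fun x : ℝ => (x : ℂ)) this
  simp only [h2]
  rw [integral_const_mul, integral_complex_ofReal, integral_add_right_eq_self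
    (fun τ : ℝ => Real.exp (-(α * (1 + α) / 2) * τ ^ 2))]

/-- The central limit theorem for additive statistics of the paths. The variance of the limit is
that of independent geometric variables, less a term due to conditioning on their sum. -/
theorem tendsto_mean_exp_paths (hα : 0 < α)
    (hN : (fun k => (N k : ℝ) - α * k) =O[atTop] fun _ => (1 : ℝ))
    (s : ℕ → ℝ) {a : ℕ} (ha : ∀ i, a ≤ i → s i = 0) :
    let m := ∑ i ∈ Finset.range a, geometricLaw α i * s i
    Tendsto (fun k : ℕ => Complex.exp (-(√k * m : ℝ) * Complex.I) *
        chainMean k (N k) fun x => ∏ l, pathPhase s k (x (Sum.inl l))) atTop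
      (𝓝 (Complex.exp (-((∑ i ∈ Finset.range a, geometricLaw α i * s i ^ 2) - m ^ 2 -
        (∑ i ∈ Finset.range a, geometricLaw α i * (s i * (i - α))) ^ 2 / (α * (1 + α)) : ℝ) / 2))) := by
  intro m
  have h1 := tendsto_integral_localIntegrand hα hN s ha
  have h2 := tendsto_integral_localIntegrand hα hN (fun _ => 0) (a := 0) fun _ _ => rfl
  simp only [Finset.range_zero, Finset.sum_empty] at h2
  have hG : ((∫ τ : ℝ, Real.exp (-(α * (1 + α) / 2) * τ ^ 2) : ℝ) : ℂ) ≠ 0 := by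
    rw [integral_gaussian]
    have : 0 < √(Real.pi / (α * (1 + α) / 2)) := Real.sqrt_pos.2 (by have := Real.pi_pos; positivity)
    exact_mod_cast this.ne'
  have hH := circleValue_cycleSeries_zero_ne_zero hα
  have h3 := h1.div h2 (by
    refine mul_ne_zero (mul_ne_zero (Complex.exp_ne_zero _) hG) hH)
  have h4 : ∀ z : ℂ, z * ((∫ τ : ℝ, Real.exp (-(α * (1 + α) / 2) * τ ^ 2) : ℝ) : ℂ) *
      circleValue (cycleSeries α) 0 / (Complex.exp (-(0 - 0 ^ 2 - 0 ^ 2 / (α * (1 + α)) : ℝ) / 2) *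
      ((∫ τ : ℝ, Real.exp (-(α * (1 + α) / 2) * τ ^ 2) : ℝ) : ℂ) * circleValue (cycleSeries α) 0) = z := by
    intro z
    have h5 : Complex.exp (-(0 - 0 ^ 2 - 0 ^ 2 / (α * (1 + α)) : ℝ) / 2) = 1 := by simp
    rw [h5, one_mul, mul_assoc]
    exact mul_div_cancel_right₀ _ (mul_ne_zero hG hH)
  rw [h4] at h3
  refine h3.congr' ?_
  filter_upwards [eventually_gt_atTop 0] with k hk
  have hs : (√(k : ℝ) : ℂ) ≠ 0 := by
    have : 0 < √(k : ℝ) := Real.sqrt_pos.2 (by exact_mod_cast hk)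
    exact_mod_cast this.ne'
  have hpi : (2 * Real.pi : ℂ) ≠ 0 := by
    have := Real.pi_pos
    exact_mod_cast (by positivity : (2 * Real.pi : ℝ) ≠ 0)
  have h6 : pathPhase (fun _ => 0) k = fun _ => 1 := by
    funext i
    simp [pathPhase]
  rw [Pi.div_apply, integral_localIntegrand hα s m hk, integral_localIntegrand hα _ _ hk,
    chainMean_prod hα, h6]
  have h7 : Complex.exp (-(√k * 0 : ℝ) * Complex.I) = 1 := by simp
  rw [h7, mul_one, mul_assoc, mul_div_mul_left _ _ (mul_ne_zero hs hpi), mul_div_assoc]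

end LocalLimit

/-! ### Means, variances and the Poisson limit -/

section Transfer

open LabelledMultigraph

/-- The expectation of a function of the component counts, as a mean over the insertion process. -/
lemma integral_eq_chainMean (k n : ℕ) {𝕜 : Type} [RCLike 𝕜] (g : (ℕ → ℕ) → 𝕜) :
    ∫ G, g (fun j => G.numComponents (j + 1)) ∂(configurationModel (2 * k) n) =
      chainMean k n fun x => g fun j => componentCount x (j + 1) :=
  integral_configurationModel k n g

lemma memLp_numComponents (k n j : ℕ) (p : ℝ≥0∞) :
    MemLp (fun G => (G.numComponents j : ℝ)) p (configurationModel (2 * k) n) := by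
  refine MemLp.of_bound Measurable.of_discrete.aestronglyMeasurable (2 * k + n : ℕ) (.of_forall fun G => ?_)
  rw [Real.norm_natCast, Nat.cast_le, numComponents]
  calc _ ≤ Nat.card G.toSimple.ConnectedComponent := Finite.card_subtype_le _
    _ ≤ Nat.card (Fin (2 * k + n)) := Nat.card_le_card_of_surjective _ Quot.mk_surjective
    _ = 2 * k + n := Nat.card_fin _

lemma integral_numComponents_add_two (k n i : ℕ) :
    ∫ G, (G.numComponents (i + 2) : ℝ) ∂(configurationModel (2 * k) n) =
      chainMean k n (fun x => (pathCount x i : ℝ)) +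
        chainMean k n (fun x => (cycleCount n x (i + 2) : ℝ)) := by
  rw [integral_eq_chainMean k n fun u => (u (i + 1) : ℝ), ← chainMean_add]
  refine chainMean_congr fun x hx => ?_
  exact_mod_cast congrArg (Nat.cast (R := ℝ)) (hx.componentCount_add_two i)

lemma variance_numComponents_add_two_le (k n i : ℕ) (c : ℝ) :
    Var[fun G => (G.numComponents (i + 2) : ℝ); configurationModel (2 * k) n] ≤
      chainMean k n fun x => ((pathCount x i + cycleCount n x (i + 2) : ℝ) - c) ^ 2 := by
  rw [← variance_sub_const Measurable.of_discrete.aestronglyMeasurable c]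
  refine (variance_le_expectation_sq Measurable.of_discrete.aestronglyMeasurable).trans_eq ?_
  refine (integral_eq_chainMean k n fun u => ((u (i + 1) : ℝ) - c) ^ 2).trans ?_
  refine chainMean_congr fun x hx => ?_
  rw [← Nat.cast_add, ← hx.componentCount_add_two]

lemma integral_numComponents_one (k n : ℕ) {𝕜 : Type} [RCLike 𝕜] (g : ℕ → 𝕜) :
    ∫ G, g (G.numComponents 1) ∂(configurationModel (2 * k) n) =
      chainMean k n fun x => g (cycleCount n x 1) := by
  refine (integral_eq_chainMean k n fun u => g (u 0)).trans ?_
  exact chainMean_congr fun x hx => congrArg g hx.componentCount_one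

end Transfer

section Moments

open LabelledMultigraph

variable {α : ℝ} {N : ℕ → ℕ}

lemma cycleCount_le_quadratic {k n : ℕ} (x : Fin k ⊕ ℕ → ℕ) {j : ℕ} (hj : j ≠ 0) :
    (cycleCount n x j : ℝ) ≤ ((cycleVertices n x : ℝ) + 1 / 2) * (cycleVertices n x + 3 / 2) := by
  have h : (cycleCount n x j : ℝ) ≤ cycleVertices n x := by exact_mod_cast cycleCount_le x hj
  nlinarith [(Nat.cast_nonneg (cycleVertices n x) : (0 : ℝ) ≤ _)]

lemma isBigO_mean_cycleCount
    (hN : (fun k => (N k : ℝ) - α * k) =O[atTop] fun _ => (1 : ℝ)) {j : ℕ} (hj : j ≠ 0) :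
    (fun k => chainMean k (N k) fun x => (cycleCount (N k) x j : ℝ)) =O[atTop] fun _ => (1 : ℝ) := by
  refine IsBigO.trans (.of_norm_le fun k => ?_) (isBigO_mean_cycleVertices hN)
  rw [Real.norm_of_nonneg (chainMean_nonneg fun x _ => Nat.cast_nonneg _)]
  exact chainMean_mono fun x _ => cycleCount_le_quadratic x hj

lemma isBigO_integral_numComponents_sub (hα : 0 < α)
    (hN : (fun k => (N k : ℝ) - α * k) =O[atTop] fun _ => (1 : ℝ)) (i : ℕ) :
    (fun k : ℕ => ∫ G, (G.numComponents (i + 2) : ℝ) ∂(configurationModel (2 * k) (N k)) -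
      α ^ i / (1 + α) ^ (i + 1) * k) =O[atTop] fun _ => (1 : ℝ) := by
  have h1 : (fun k : ℕ => (chainMean k (N k) (fun x => (pathCount x i : ℝ)) / k -
      α ^ i / (1 + α) ^ (i + 1)) * k) =O[atTop] fun k : ℕ => (k : ℝ)⁻¹ * k :=
    IsBigO.mul (eqUpToInv_mean_pathCount hα hN i) (isBigO_refl _ _)
  have h2 : (fun k : ℕ => (k : ℝ)⁻¹ * k) =O[atTop] fun _ => (1 : ℝ) :=
    .of_norm_le fun k => by
      rcases Nat.eq_zero_or_pos k with rfl | hk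
      · simp
      · rw [inv_mul_cancel₀ (by exact_mod_cast hk.ne'), norm_one]
  refine ((h1.trans h2).add (isBigO_mean_cycleCount hN (j := i + 2) (by omega))).congr' ?_ .rfl
  filter_upwards [eventually_ne_atTop 0] with k hk
  have hk' : (k : ℝ) ≠ 0 := by exact_mod_cast hk
  rw [integral_numComponents_add_two, sub_mul, div_mul_cancel₀ _ hk']
  ring

lemma isBigO_variance_numComponents (hα : 0 < α)
    (hN : (fun k => (N k : ℝ) - α * k) =O[atTop] fun _ => (1 : ℝ)) (i : ℕ) :
    (fun k : ℕ => Var[fun G => (G.numComponents (i + 2) : ℝ); configurationModel (2 * k) (N k)])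
      =O[atTop] fun k : ℕ => (k : ℝ) := by
  have h1 := (isBigO_mean_sq_pathCount hα hN i).const_mul_left 2
  have h2 : (fun _ : ℕ => (1 : ℝ)) =O[atTop] fun k : ℕ => (k : ℝ) :=
    IsBigO.of_bound 1 ((eventually_ge_atTop 1).mono fun k hk => by
      rw [norm_one, one_mul, Real.norm_natCast]
      exact_mod_cast hk)
  have h3 := ((isBigO_mean_cycleVertices hN).trans h2).const_mul_left 2
  refine IsBigO.trans (.of_norm_le fun k => ?_) (h1.add h3)
  rw [Real.norm_of_nonneg (variance_nonneg _ _)]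
  refine (variance_numComponents_add_two_le k (N k) i (α ^ i / (1 + α) ^ (i + 1) * k)).trans ?_
  rw [← chainMean_const_mul, ← chainMean_const_mul, ← chainMean_add]
  refine chainMean_mono fun x _ => ?_
  have h4 : (cycleCount (N k) x (i + 2) : ℝ) ≤ cycleVertices (N k) x := by
    exact_mod_cast cycleCount_le x (by omega)
  have h5 : (0 : ℝ) ≤ cycleCount (N k) x (i + 2) := Nat.cast_nonneg _
  nlinarith [sq_nonneg ((pathCount x i : ℝ) - α ^ i / (1 + α) ^ (i + 1) * k -
    cycleCount (N k) x (i + 2)), mul_le_mul h4 h4 h5 (h5.trans h4)]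

lemma tendsto_integral_numComponents_one (hα : 0 < α)
    (hN : (fun k => (N k : ℝ) - α * k) =O[atTop] fun _ => (1 : ℝ)) :
    Tendsto (fun k : ℕ => ∫ G, (G.numComponents 1 : ℝ) ∂(configurationModel (2 * k) (N k))) atTop
      (𝓝 (1 / 2 * (α / (1 + α)))) := by
  have h := tendsto_mean_loops hα hN 1
  simp only [Nat.descFactorial_one, pow_one] at h
  exact h.congr fun k => (integral_numComponents_one k (N k) fun u => (u : ℝ)).symm

lemma tendsto_variance_numComponents_one (hα : 0 < α)
    (hN : (fun k => (N k : ℝ) - α * k) =O[atTop] fun _ => (1 : ℝ)) :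
    Tendsto (fun k : ℕ => Var[fun G => (G.numComponents 1 : ℝ); configurationModel (2 * k) (N k)])
      atTop (𝓝 (1 / 2 * (α / (1 + α)))) := by
  have h1 := tendsto_mean_loops hα hN 1
  have h2 := tendsto_mean_loops hα hN 2
  have h3 := (h2.add h1).sub (h1.pow 2)
  rw [pow_one, add_sub_cancel_left] at h3
  refine h3.congr fun k => ?_
  rw [variance_eq_sub (memLp_numComponents k (N k) 1 2)]
  have h4 := integral_numComponents_one k (N k) fun u => (u : ℝ) ^ 2
  have h5 := integral_numComponents_one k (N k) fun u => (u : ℝ)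
  have h6 : ∀ f : LabelledMultigraph (2 * k + N k) → ℝ, f ^ 2 = fun G => f G ^ 2 := fun f => rfl
  rw [h6, h4, h5, ← chainMean_add]
  congr 1
  · refine chainMean_congr fun x _ => ?_
    rw [Nat.cast_descFactorial_two, Nat.descFactorial_one]
    ring
  · simp only [Nat.descFactorial_one]

end Moments

section Poisson

open LabelledMultigraph

/-- Weak convergence of laws on `ℕ` can be tested on the real line. -/
lemma tendsto_probabilityMeasure_nat {μ : ℕ → ProbabilityMeasure ℕ} {μ₀ : ProbabilityMeasure ℕ}
    (h : ∀ t : ℝ, Tendsto (fun k => charFun ((μ k : Measure ℕ).map ((↑) : ℕ → ℝ)) t) atTop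
      (𝓝 (charFun ((μ₀ : Measure ℕ).map ((↑) : ℕ → ℝ)) t))) : Tendsto μ atTop (𝓝 μ₀) := by
  have hm : Measurable ((↑) : ℕ → ℝ) := .of_discrete
  have h1 : Tendsto (fun k => (μ k).map hm.aemeasurable) atTop (𝓝 (μ₀.map hm.aemeasurable)) :=
    ProbabilityMeasure.tendsto_iff_tendsto_charFun.2 h
  rw [ProbabilityMeasure.tendsto_iff_forall_integral_tendsto] at h1 ⊢
  intro f
  obtain ⟨g, -, hg⟩ := BoundedContinuousFunction.exists_extension_norm_eq_of_isClosedEmbedding f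
    Nat.isClosedEmbedding_coe_real
  have h2 : ∀ ν : ProbabilityMeasure ℕ, ∫ x, g x ∂(ν.map hm.aemeasurable : Measure ℝ) =
      ∫ n, f n ∂(ν : Measure ℕ) := by
    intro ν
    rw [ProbabilityMeasure.toMeasure_map, integral_map hm.aemeasurable (by fun_prop)]
    exact integral_congr_ae (.of_forall fun n => congrFun hg n)
  simpa only [h2] using h1 g

variable {α : ℝ} {N : ℕ → ℕ}

lemma tendsto_numComponents_one (hα : 0 < α)
    (hN : (fun k => (N k : ℝ) - α * k) =O[atTop] fun _ => (1 : ℝ)) :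
    TendstoInDistribution (fun (k : ℕ) (G : LabelledMultigraph (2 * k + N k)) => G.numComponents 1)
      atTop (id : ℕ → ℕ) (fun k => configurationModel (2 * k) (N k))
      (poissonMeasure (1 / 2 * (α / (1 + α))).toNNReal) where
  forall_aemeasurable k := Measurable.of_discrete.aemeasurable
  aemeasurable_limit := aemeasurable_id
  tendsto := by
    refine tendsto_probabilityMeasure_nat fun t => ?_
    simp only [ProbabilityMeasure.coe_mk, Measure.map_id]
    rw [charFun_map_cast_poissonMeasure, Real.coe_toNNReal _ (by positivity)]
    refine (tendsto_mean_pow_loops hα hN (Complex.exp (t * Complex.I) - 1)).congr fun k => ?_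
    rw [Measure.map_map .of_discrete .of_discrete, charFun_apply,
      integral_map Measurable.of_discrete.aemeasurable (by fun_prop)]
    have h := integral_numComponents_one k (N k) fun u => Complex.exp (t * Complex.I) ^ u
    rw [add_sub_cancel, ← h]
    refine integral_congr_ae (.of_forall fun G => ?_)
    simp only [Function.comp_apply, Real.inner_apply]
    rw [← Complex.exp_nat_mul]
    congr 1
    push_cast
    ring

end Poisson

/-! ### The Gaussian limit -/

section CentralLimit

open LabelledMultigraph

variable {α : ℝ} {q : ℕ}

/-- The coordinates of a vector indexed by the sizes `2, …, q`, extended by zero, as a function of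
the number of vertices of degree two on a path. -/
noncomputable def pathWeight (t : Finset.Icc 2 q → ℝ) (i : ℕ) : ℝ :=
  if h : i + 2 ∈ Finset.Icc 2 q then t ⟨i + 2, h⟩ else 0

lemma pathWeight_eq_zero (t : Finset.Icc 2 q → ℝ) {i : ℕ} (hi : q - 1 ≤ i) : pathWeight t i = 0 :=
  dif_neg fun h => by
    have := Finset.mem_Icc.1 h
    omega

lemma sum_mul_eq_sum_pathWeight (t : Finset.Icc 2 q → ℝ) (f : ℝ → ℕ → ℝ) :
    ∑ j : Finset.Icc 2 q, f (t j) ((j : ℕ) - 2) =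
      ∑ i ∈ Finset.range (q - 1), f (pathWeight t i) i := by
  refine Finset.sum_bij (fun j _ => (j : ℕ) - 2) (fun j _ => ?_) (fun j _ j' _ h => ?_)
    (fun i hi => ?_) (fun j _ => ?_)
  · have := Finset.mem_Icc.1 j.2
    rw [Finset.mem_range]
    omega
  · have h1 := Finset.mem_Icc.1 j.2
    have h2 := Finset.mem_Icc.1 j'.2
    rw [Subtype.ext_iff]
    omega
  · have := Finset.mem_range.1 hi
    exact ⟨⟨i + 2, Finset.mem_Icc.2 (by omega)⟩, Finset.mem_univ _, by simp⟩
  · have h1 := Finset.mem_Icc.1 j.2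
    have h2 : (j : ℕ) - 2 + 2 = j := by omega
    have h3 : pathWeight t ((j : ℕ) - 2) = t j := by
      rw [pathWeight, dif_pos (by rw [h2]; exact j.2)]
      congr 1
      exact Subtype.ext h2
    rw [h3]

lemma limitCovariance_apply (i j : Finset.Icc 2 q) :
    limitCovariance α q i j =
      -(geometricLaw α ((i : ℕ) - 2) * geometricLaw α ((j : ℕ) - 2) *
        (1 + ((((i : ℕ) - 2 : ℕ) : ℝ) - α) * ((((j : ℕ) - 2 : ℕ) : ℝ) - α) / (α * (1 + α)))) +
        if i = j then geometricLaw α ((j : ℕ) - 2) else 0 := by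
  have hi := (Finset.mem_Icc.1 i.2).1
  have hj := (Finset.mem_Icc.1 j.2).1
  have h1 : (i : ℕ) + j - 4 = ((i : ℕ) - 2) + (j - 2) := by omega
  have h2 : (i : ℕ) + j - 2 = ((i : ℕ) - 2 + 1) + (j - 2 + 1) := by omega
  rw [limitCovariance, Matrix.of_apply, h1, h2, Nat.cast_sub hi, Nat.cast_sub hj, geometricLaw,
    geometricLaw, div_mul_div_comm, ← pow_add, ← pow_add]
  congr 1
  split_ifs with h
  · rw [h, ← geometricLaw_eq, geometricLaw]
  · simp

/-- The quadratic form of the limiting covariance matrix. -/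
lemma dotProduct_limitCovariance (t : Finset.Icc 2 q → ℝ) :
    t ⬝ᵥ (limitCovariance α q).mulVec t =
      (∑ i ∈ Finset.range (q - 1), geometricLaw α i * pathWeight t i ^ 2) -
        (∑ i ∈ Finset.range (q - 1), geometricLaw α i * pathWeight t i) ^ 2 -
        (∑ i ∈ Finset.range (q - 1), geometricLaw α i * (pathWeight t i * (i - α))) ^ 2 /
          (α * (1 + α)) := by
  rw [← sum_mul_eq_sum_pathWeight t fun x i => geometricLaw α i * x ^ 2,
    ← sum_mul_eq_sum_pathWeight t fun x i => geometricLaw α i * x,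
    ← sum_mul_eq_sum_pathWeight t fun x i => geometricLaw α i * (x * (i - α))]
  have h1 : ∀ i j : Finset.Icc 2 q, t i * (limitCovariance α q i j * t j) =
      (if i = j then geometricLaw α ((j : ℕ) - 2) * t j ^ 2 else 0) -
      (geometricLaw α ((i : ℕ) - 2) * t i) * (geometricLaw α ((j : ℕ) - 2) * t j) -
      (geometricLaw α ((i : ℕ) - 2) * (t i * ((((i : ℕ) - 2 : ℕ) : ℝ) - α))) *
        (geometricLaw α ((j : ℕ) - 2) * (t j * ((((j : ℕ) - 2 : ℕ) : ℝ) - α))) / (α * (1 + α)) := by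
    intro i j
    rw [limitCovariance_apply]
    split_ifs with h
    · rw [h]
      ring
    · ring
  simp only [dotProduct, Matrix.mulVec, Finset.mul_sum, h1, Finset.sum_sub_distrib,
    ← Finset.sum_div, Finset.sum_ite_eq, Finset.mem_univ, if_true]
  simp only [← Finset.mul_sum, ← Finset.sum_mul, sq]

lemma posSemidef_limitCovariance (hα : 0 < α) : (limitCovariance α q).PosSemidef := by
  refine Matrix.PosSemidef.of_dotProduct_mulVec_nonneg ?_ fun t => ?_
  · ext i j
    rw [Matrix.conjTranspose_apply, star_trivial, limitCovariance_apply, limitCovariance_apply]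
    congr 1
    · ring
    · by_cases h : i = j
      · rw [h]
      · rw [if_neg h, if_neg (Ne.symm h)]
  · rw [star_trivial, dotProduct_limitCovariance]
    -- the quadratic form is the minimum over `τ` of the variance of `s i + τ i` under the
    -- geometric law, attained at this `τ`
    set B := ∑ i ∈ Finset.range (q - 1), geometricLaw α i * (pathWeight t i * (i - α)) with hB
    have h := (hasSum_phase hα (pathWeight t) (fun i => pathWeight_eq_zero t)
      (-B / (α * (1 + α)))).2.nonneg fun i =>
        mul_nonneg (geometricLaw_pos hα i).le (sq_nonneg _)
    rw [← hB] at h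
    refine h.trans_eq ?_
    field_simp
    ring

lemma sum_path_eq {k : ℕ} (s : ℕ → ℝ) {a : ℕ} (ha : ∀ i, a ≤ i → s i = 0) (x : Fin k ⊕ ℕ → ℕ) :
    ∑ l, s (x (Sum.inl l)) = ∑ i ∈ Finset.range a, s i * pathCount x i := by
  simp only [pathCount, Finset.card_filter, Nat.cast_sum, Finset.mul_sum]
  rw [Finset.sum_comm]
  refine Finset.sum_congr rfl fun l _ => ?_
  by_cases h : x (Sum.inl l) < a
  · rw [Finset.sum_eq_single (x (Sum.inl l))]
    · simp
    · intro b _ hb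
      rw [if_neg hb.symm, Nat.cast_zero, mul_zero]
    · intro h'
      exact absurd (Finset.mem_range.2 h) h'
  · rw [ha _ (not_lt.1 h), Finset.sum_eq_zero]
    intro i hi
    rw [if_neg (by have := Finset.mem_range.1 hi; omega), Nat.cast_zero, mul_zero]

lemma prod_pathPhase {k : ℕ} (s : ℕ → ℝ) {a : ℕ} (ha : ∀ i, a ≤ i → s i = 0) (x : Fin k ⊕ ℕ → ℕ) :
    ∏ l, pathPhase s k (x (Sum.inl l)) =
      Complex.exp (((∑ i ∈ Finset.range a, s i * pathCount x i) / √k : ℝ) * Complex.I) := by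
  rw [← sum_path_eq s ha]
  simp only [pathPhase]
  rw [← Complex.exp_sum, ← Finset.sum_mul, Finset.sum_div, Complex.ofReal_sum]

variable {N : ℕ → ℕ}

/-- The convergence of the characteristic functions of the numbers of components: the cycles do
not contribute, because the number of vertices on them is bounded in mean. -/
lemma tendsto_integral_exp_numComponents (hα : 0 < α)
    (hN : (fun k => (N k : ℝ) - α * k) =O[atTop] fun _ => (1 : ℝ))
    (s : ℕ → ℝ) {a : ℕ} (ha : ∀ i, a ≤ i → s i = 0) :
    Tendsto (fun k : ℕ => ∫ G, Complex.exp (((∑ i ∈ Finset.range a,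
        s i * ((G.numComponents (i + 2) : ℝ) - geometricLaw α i * k)) / √k : ℝ) * Complex.I)
          ∂(configurationModel (2 * k) (N k))) atTop
      (𝓝 (Complex.exp (-((∑ i ∈ Finset.range a, geometricLaw α i * s i ^ 2) -
        (∑ i ∈ Finset.range a, geometricLaw α i * s i) ^ 2 -
        (∑ i ∈ Finset.range a, geometricLaw α i * (s i * (i - α))) ^ 2 / (α * (1 + α)) : ℝ) / 2))) := by
  have h1 := tendsto_mean_exp_paths hα hN s ha
  refine (tendsto_iff_of_dist ?_).1 h1
  set m := ∑ i ∈ Finset.range a, geometricLaw α i * s i with hm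
  set S := ∑ i ∈ Finset.range a, |s i| with hS
  have hS0 : 0 ≤ S := Finset.sum_nonneg fun _ _ => abs_nonneg _
  have hinv : Tendsto (fun k : ℕ => (√(k : ℝ))⁻¹) atTop (𝓝 0) :=
    tendsto_inv_atTop_zero.comp (Real.tendsto_sqrt_atTop.comp tendsto_natCast_atTop_atTop)
  have h2 : Tendsto (fun k : ℕ => S * ((√(k : ℝ))⁻¹ * chainMean k (N k) fun x =>
      ((cycleVertices (N k) x : ℝ) + 1 / 2) * (cycleVertices (N k) x + 3 / 2))) atTop (𝓝 0) := by
    have h3 := ((isBigO_refl (fun k : ℕ => (√(k : ℝ))⁻¹) atTop).mul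
      (isBigO_mean_cycleVertices hN)).trans_tendsto (by simpa using hinv)
    simpa using h3.const_mul S
  refine squeeze_zero' (.of_forall fun _ => dist_nonneg) ?_ h2
  filter_upwards [eventually_gt_atTop 0] with k hk
  have hk' : (0 : ℝ) < k := by exact_mod_cast hk
  have hs : 0 < √(k : ℝ) := Real.sqrt_pos.2 hk'
  have h4 := integral_eq_chainMean k (N k) fun u => Complex.exp (((∑ i ∈ Finset.range a,
    s i * ((u (i + 1) : ℝ) - geometricLaw α i * k)) / √k : ℝ) * Complex.I)
  refine (congrArg (dist _) h4).trans_le ?_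
  rw [dist_eq_norm, ← chainMean_const_mul, ← chainMean_sub]
  refine (norm_chainMean_le _).trans ?_
  rw [← mul_assoc, ← chainMean_const_mul]
  refine chainMean_mono fun x hx => ?_
  have h5 : (∑ i ∈ Finset.range a, s i * ((componentCount x (i + 1 + 1) : ℝ) -
      geometricLaw α i * k)) / √k = (-(√k * m) + (∑ i ∈ Finset.range a, s i * pathCount x i) / √k) +
        (∑ i ∈ Finset.range a, s i * cycleCount (N k) x (i + 2)) / √k := by
    have h6 : √(k : ℝ) * m = (m * k) / √k := by
      rw [eq_div_iff hs.ne']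
      rw [mul_right_comm, Real.mul_self_sqrt hk'.le, mul_comm]
    rw [h6, hm, ← neg_div, ← add_div, ← add_div, Finset.sum_mul, ← Finset.sum_neg_distrib,
      ← Finset.sum_add_distrib, ← Finset.sum_add_distrib]
    congr 1
    refine Finset.sum_congr rfl fun i _ => ?_
    have h7 : componentCount x (i + 1 + 1) = _ := hx.componentCount_add_two i
    rw [h7]
    push_cast
    ring
  simp only [h5]
  rw [prod_pathPhase s ha, ← Complex.ofReal_neg, ← Complex.exp_add, ← add_mul, ← Complex.ofReal_add,
    Complex.ofReal_add _ ((∑ i ∈ Finset.range a, s i * cycleCount (N k) x (i + 2)) / √k),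
    add_mul _ _ Complex.I, Complex.exp_add, ← mul_one_sub, norm_mul, Complex.norm_exp_ofReal_mul_I,
    one_mul, norm_sub_rev, mul_comm _ Complex.I]
  refine Real.norm_exp_I_mul_ofReal_sub_one_le.trans ?_
  rw [Real.norm_eq_abs, abs_div, abs_of_pos hs, div_eq_mul_inv, mul_right_comm]
  refine mul_le_mul_of_nonneg_right ?_ (inv_nonneg.2 hs.le)
  refine (Finset.abs_sum_le_sum_abs _ _).trans ?_
  rw [hS, Finset.sum_mul]
  refine Finset.sum_le_sum fun i _ => ?_
  rw [abs_mul, Nat.abs_cast]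
  exact mul_le_mul_of_nonneg_left (cycleCount_le_quadratic x (by omega)) (abs_nonneg _)

lemma tendsto_numComponents (hα : 0 < α)
    (hN : (fun k => (N k : ℝ) - α * k) =O[atTop] fun _ => (1 : ℝ)) (q : ℕ) :
    TendstoInDistribution
      (fun (k : ℕ) (G : LabelledMultigraph (2 * k + N k)) =>
        (WithLp.toLp 2 fun j : Finset.Icc 2 q =>
          1 / √(((2 * k : ℕ) : ℝ) / 2) * ((G.numComponents j : ℝ) -
            α ^ ((j : ℕ) - 2) / (1 + α) ^ ((j : ℕ) - 1) * (((2 * k : ℕ) : ℝ) / 2)) :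
          EuclideanSpace ℝ (Finset.Icc 2 q)))
      atTop (id : EuclideanSpace ℝ (Finset.Icc 2 q) → EuclideanSpace ℝ (Finset.Icc 2 q))
      (fun k => configurationModel (2 * k) (N k)) (multivariateGaussian 0 (limitCovariance α q)) where
  forall_aemeasurable k := Measurable.of_discrete.aemeasurable
  aemeasurable_limit := aemeasurable_id
  tendsto := by
    refine ProbabilityMeasure.tendsto_iff_tendsto_charFun.2 fun t => ?_
    simp only [ProbabilityMeasure.coe_mk, Measure.map_id]
    rw [charFun_multivariateGaussian (posSemidef_limitCovariance hα), inner_zero_right,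
      dotProduct_limitCovariance]
    have h1 := tendsto_integral_exp_numComponents hα hN (pathWeight t)
      (a := q - 1) fun i => pathWeight_eq_zero t
    rw [Complex.ofReal_zero, zero_mul, zero_sub, ← neg_div]
    refine h1.congr fun k => ?_
    rw [charFun_apply, integral_map Measurable.of_discrete.aemeasurable (by fun_prop)]
    refine integral_congr_ae (.of_forall fun G => ?_)
    beta_reduce
    congr 3
    rw [PiLp.inner_apply, ← sum_mul_eq_sum_pathWeight t fun x i =>
      x * ((G.numComponents (i + 2) : ℝ) - geometricLaw α i * k), Finset.sum_div]
    refine Finset.sum_congr rfl fun j _ => ?_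
    have hj := (Finset.mem_Icc.1 j.2).1
    have h2 : (j : ℕ) - 2 + 2 = j := by omega
    have h3 : (j : ℕ) - 1 = j - 2 + 1 := by omega
    have h4 : ((2 * k : ℕ) : ℝ) / 2 = k := by
      push_cast
      ring
    rw [h2, Real.inner_apply]
    change _ = 1 / √(((2 * k : ℕ) : ℝ) / 2) * ((G.numComponents j : ℝ) -
      α ^ ((j : ℕ) - 2) / (1 + α) ^ ((j : ℕ) - 1) * (((2 * k : ℕ) : ℝ) / 2)) * t j
    rw [h3, h4, geometricLaw]
    ring

end CentralLimit

/-! ### The asymptotic component structure -/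

lemma isBigO_floor_sub {α : ℝ} (hα : 0 < α) :
    (fun k : ℕ => ((⌊α * (2 * k : ℕ) / 2⌋₊ : ℕ) : ℝ) - α * k) =O[atTop] fun _ => (1 : ℝ) := by
  refine IsBigO.of_bound 1 (.of_forall fun k => ?_)
  have h1 : α * (2 * k : ℕ) / 2 = α * k := by
    push_cast
    ring
  rw [h1, norm_one, mul_one, Real.norm_eq_abs, abs_le]
  have h2 := Nat.floor_le (show 0 ≤ α * k by positivity)
  have h3 := Nat.lt_floor_add_one (α * k)
  constructor <;> linarith

theorem theorem2 (α : ℝ) (hα : 0 < α) :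
    (∀ j : ℕ, 2 ≤ j →
      ((fun k : ℕ => ∫ G, (G.numComponents j : ℝ)
            ∂(LabelledMultigraph.configurationModel (2 * k) ⌊α * (2 * k : ℕ) / 2⌋₊))
          ~[atTop] fun k : ℕ =>
            α ^ (j - 2) / (1 + α) ^ (j - 1) * (((2 * k : ℕ) : ℝ) / 2)) ∧
      ((fun k : ℕ => Var[fun G => (G.numComponents j : ℝ);
            LabelledMultigraph.configurationModel (2 * k) ⌊α * (2 * k : ℕ) / 2⌋₊])
          =O[atTop] fun k : ℕ => ((2 * k : ℕ) : ℝ) / 2)) ∧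
    ((fun k : ℕ => ∫ G, (G.numComponents 1 : ℝ)
          ∂(LabelledMultigraph.configurationModel (2 * k) ⌊α * (2 * k : ℕ) / 2⌋₊))
        ~[atTop] fun _ => 1 / 2 * (α / (1 + α))) ∧
    ((fun k : ℕ => Var[fun G => (G.numComponents 1 : ℝ);
          LabelledMultigraph.configurationModel (2 * k) ⌊α * (2 * k : ℕ) / 2⌋₊])
        ~[atTop] fun _ => 1 / 2 * (α / (1 + α))) ∧
    (∀ q : ℕ, 2 ≤ q →
      (limitCovariance α q).PosSemidef ∧
      TendstoInDistribution
        (fun (k : ℕ) (G : LabelledMultigraph (2 * k + ⌊α * (2 * k : ℕ) / 2⌋₊)) =>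
          (WithLp.toLp 2 fun j : Finset.Icc 2 q =>
            1 / √(((2 * k : ℕ) : ℝ) / 2) *
              ((G.numComponents j : ℝ)
                - α ^ ((j : ℕ) - 2) / (1 + α) ^ ((j : ℕ) - 1) * (((2 * k : ℕ) : ℝ) / 2)) :
            EuclideanSpace ℝ (Finset.Icc 2 q)))
        atTop
        (id : EuclideanSpace ℝ (Finset.Icc 2 q) → EuclideanSpace ℝ (Finset.Icc 2 q))
        (fun k => LabelledMultigraph.configurationModel (2 * k) ⌊α * (2 * k : ℕ) / 2⌋₊)
        (multivariateGaussian 0 (limitCovariance α q))) ∧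
    TendstoInDistribution
      (fun (k : ℕ) (G : LabelledMultigraph (2 * k + ⌊α * (2 * k : ℕ) / 2⌋₊)) =>
        G.numComponents 1)
      atTop
      (id : ℕ → ℕ)
      (fun k => LabelledMultigraph.configurationModel (2 * k) ⌊α * (2 * k : ℕ) / 2⌋₊)
      (poissonMeasure (1 / 2 * (α / (1 + α))).toNNReal) := by
  have hN := isBigO_floor_sub hα
  have hhalf : ∀ k : ℕ, ((2 * k : ℕ) : ℝ) / 2 = k := fun k => by
    push_cast
    ring
  have hlam : 1 / 2 * (α / (1 + α)) ≠ 0 := by positivity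
  refine ⟨fun j hj => ?_, (isEquivalent_const_iff_tendsto hlam).2
      (tendsto_integral_numComponents_one hα hN), (isEquivalent_const_iff_tendsto hlam).2
      (tendsto_variance_numComponents_one hα hN), fun q _ => ⟨posSemidef_limitCovariance hα,
      tendsto_numComponents hα hN q⟩, tendsto_numComponents_one hα hN⟩
  obtain ⟨i, rfl⟩ := Nat.exists_eq_add_of_le' hj
  simp only [hhalf]
  exact ⟨isEquivalent_of_sub_isBigO (by positivity) (isBigO_integral_numComponents_sub hα hN i),
    isBigO_variance_numComponents hα hN i⟩
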